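/- **Setting.** Let $X$ be a countably infinite set and $(b,c)$ a connected weighted graph over $X$: $b:X\times X\to[0,\infty)$ is symmetric, vanishes on the diagonal and satisfies $\sum_y b(x,y)<\infty$ for all $x$; $c:X\to[0,\infty)$; and any two vertices are joined by a finite path of pairs with $b>0$. For $f:X\to\mathbb R$ put $$\widetilde Q(f)=\tfrac12\sum_{x,y}b(x,y)(f(x)-f(y))^2+\sum_x c(x)f(x)^2\in[0,\infty],\qquad \widetilde D=\{f:\widetilde Q(f)<\infty\},\qquad \|f\|_o^2=\widetilde Q(f)+f(o)^2 ,$$ and let $D_0$ be the $\|\cdot\|_o$-closure in $\widetilde D$ of the space $C_c(X)$ of finitely supported functions (it does not depend on $o\in X$). Assume that the graph is transient, i.e. $f\in D_0$ and $\widetilde Q(f)=0$ imply $f=0$. A function $h$ with $\sum_y b(x,y)|h(y)|<\infty$ for all $x$ is harmonic if $\sum_y b(x,y)(h(x)-h(y))+c(x)h(x)=0$ for all $x$. Let $\mathcal A$ be the uniform closure of $\widetilde D\cap\ell^\infty(X)$ in $\ell^\infty(X)$, let $\mathcal A^+$ be the algebra generated by $\mathcal A$ and $1$, and let $R$ (the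 Royden compactification) be the Gelfand space of $\mathcal A^+$, so that $\mathcal A^+\cong C(R)$ and $X\subseteq R$. The harmonic boundary $\partial_hX$ is the set of all $z\in R\setminus X$ at which every $f\in D_0\cap\ell^\infty(X)$ vanishes; assume $\partial_hX\neq\emptyset$. For $f\in\widetilde D\cap \ell^\infty(X)$ let $\gamma_0f=f|_{\partial_hX}$. For $x\in X$ the harmonic measure $\mu_x$ is the unique regular Borel measure on $\partial_hX$ with $\mu_x(\partial_hX)\le1$ and $h(x)=\int\gamma_0h\,d\mu_x$ for all harmonic $h\in\widetilde D\cap\ell^\infty(X)$, normalized, if $1\notin\mathcal A$, by $\mu_x(\{p_\infty\})=0$, where $p_\infty$ is the unique point of $\partial_hX$ at which all of $\mathcal A$ vanishes. Let $\mu=\mu_z$ for some $z\in X$. The trace map $\operatorname{Tr}:\widetilde D\to L^2(\partial_hX,\mu)$ is the unique $\|\cdot\|_o$-continuous linear extension of $\gamma_0$, and $H_\varphi(x)=\int\varphi\,d\mu_x$ for $\varphi\in L^2(\partial_hX,\mu)$. A quadratic form is set equal to $\infty$ off its domain. A Dirichlet form in the wide sense on a (real) $L^2$-space is a nonnegative quadratic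 form $q$ on a linear subspace $D(q)$ which is closed ($D(q)$ is complete for $(q(\cdot)+\|\cdot\|_2^2)^{1/2}$) and Markovian ($f\in D(q)$ implies $C\circ f\in D(q)$ and $q(C\circ f)\le q(f)$ for all $C:\mathbb R\to\mathbb R$ with $|C(r)|\le|r|$, $|C(r)-C(s)|\le|r-s|$); it is a Dirichlet form if moreover $D(q)$ is dense. Let $m:X\to(0,\infty)$, regarded as a measure on $X$. Let $Q^{(N)}$ be the restriction of $\widetilde Q$ to $\widetilde D\cap\ell^2(X,m)$ and $Q^{(D)}$ the restriction of $Q^{(N)}$ to the closure of $C_c(X)$ with respect to $(Q^{(N)}(\cdot)+\|\cdot\|_2^2)^{1/2}$. For a Dirichlet form $Q$ on $\ell^2(X,m)$, $D(Q_e)$ is the set of pointwise limits $f$ of $Q$-Cauchy sequences $(f_n)$ in $D(Q)$, and $Q_e(f)=\lim_nQ(f_n)$ (independently of the sequence). **Theorem.** The harmonic measures $\mu_x$, $x\in X$, and the trace map exist, and for every Dirichlet form $Q$ on $\ell^2(X,m)$ with $Q^{(D)}\ge Q\ge Q^{(N)}$ (pointwise as functions with values in $[0,\infty]$) the following holds.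 The form $\operatorname{Tr}Q$ on $L^2(\partial_hX,\mu)$ with domain $D(\operatorname{Tr}Q)=\operatorname{Tr}D(Q_e)$ and $$\operatorname{Tr}Q(\varphi)=Q_e(H_\varphi),\qquad \varphi\in\operatorname{Tr}D(Q_e),$$ is well defined (that is, $Q_e(H_\varphi)<\infty$ for these $\varphi$) and is a Dirichlet form in the wide sense on $L^2(\partial_hX,\mu)$. In particular, the Dirichlet-to-Neumann form $q^{DN}=\operatorname{Tr}Q^{(N)}$ is a Dirichlet form in the wide sense on $L^2(\partial_hX,\mu)$. If $m$ is finite, i.e. $\sum_xm(x)<\infty$, then $q^{DN}$ is densely defined. -/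

import Mathlib

open MeasureTheory Filter Topology
open scoped ENNReal NNReal

/-! ### Quadratic forms on real vector spaces and Dirichlet forms on `L²` -/

/-- The domain of a quadratic form; a form takes the value `∞` off its domain. -/
def formDomain {V : Type*} (q : V → ℝ≥0∞) : Set V := {f | q f < ∞}

/-- `q` is a (nonnegative) quadratic form whose domain is a linear subspace: it is the diagonal of
a nonnegative symmetric bilinear form on a subspace `D`, and `∞` outside `D`. -/
def IsQuadraticForm {V : Type*} [AddCommGroup V] [Module ℝ V] (q : V → ℝ≥0∞) : Prop :=
  ∃ (D : Submodule ℝ V) (B : D →ₗ[ℝ] D →ₗ[ℝ] ℝ),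
    (∀ f g : D, B f g = B g f) ∧ (∀ f : D, 0 ≤ B f f) ∧
    (∀ f : D, q (f : V) = ENNReal.ofReal (B f f)) ∧ ∀ f : V, f ∉ D → q f = ∞

/-- The sequence `u` in the domain of `q` is Cauchy with respect to the seminorm `q ^ (1/2)`. -/
def IsFormCauchy {V : Type*} [AddCommGroup V] (q : V → ℝ≥0∞) (u : ℕ → V) : Prop :=
  (∀ n, u n ∈ formDomain q) ∧
    Tendsto (fun p : ℕ × ℕ => q (u p.1 - u p.2)) atTop (𝓝 0)

def IsNormalContraction (C : ℝ → ℝ) : Prop :=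
  (∀ r, |C r| ≤ |r|) ∧ ∀ r s, |C r - C s| ≤ |r - s|

section DirichletForms

variable {E : Type*} [MeasurableSpace E] {μ : Measure E}

/-- The domain of `q` is complete with respect to the form norm `(q(f) + ‖f‖²) ^ (1/2)`. -/
def IsClosedForm (q : Lp ℝ 2 μ → ℝ≥0∞) : Prop :=
  ∀ u : ℕ → Lp ℝ 2 μ, IsFormCauchy q u → CauchySeq u →
    ∃ f ∈ formDomain q, Tendsto (fun n => q (u n - f)) atTop (𝓝 0) ∧ Tendsto u atTop (𝓝 f)

/-- `C ∘ f ∈ D(q)` and `q (C ∘ f) ≤ q f` for all `f ∈ D(q)` and all normal contractions `C`. -/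
def IsMarkovianForm (q : Lp ℝ 2 μ → ℝ≥0∞) : Prop :=
  ∀ C : ℝ → ℝ, IsNormalContraction C → ∀ f g : Lp ℝ 2 μ,
    (g =ᵐ[μ] fun x => C (f x)) → q g ≤ q f

/-- Dirichlet form in the wide sense on `L²(E, μ)`: closed and Markovian, possibly not densely
defined. -/
structure IsDirichletFormWide (q : Lp ℝ 2 μ → ℝ≥0∞) : Prop where
  quadratic : IsQuadraticForm q
  closed : IsClosedForm q
  markovian : IsMarkovianForm q

/-- Dirichlet form on `L²(E, μ)`. -/
structure IsDirichletForm (q : Lp ℝ 2 μ → ℝ≥0∞) : Prop extends IsDirichletFormWide q where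
  dense : Dense (formDomain q)

/-- `u` is an approximating sequence for `f`: `Q`-Cauchy, in `D(Q)`, converging pointwise. -/
def IsApproximating (Q : Lp ℝ 2 μ → ℝ≥0∞) (u : ℕ → Lp ℝ 2 μ) (f : E → ℝ) : Prop :=
  IsFormCauchy Q u ∧ ∀ x, Tendsto (fun n => u n x) atTop (𝓝 (f x))

open Classical in
/-- The extended Dirichlet form of a Dirichlet form `Q` on `ℓ²(E, μ)`, where `μ` is a measure of
full support on a discrete space (so that elements of `L²` are genuine functions):
`Q_e f = lim Q (u n)` for an approximating sequence `u` of `f`, and `∞` if there is none.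
The limit does not depend on the approximating sequence. -/
noncomputable def extendedForm (Q : Lp ℝ 2 μ → ℝ≥0∞) (f : E → ℝ) : ℝ≥0∞ :=
  if h : ∃ u, IsApproximating Q u f then limUnder atTop (fun n => Q (h.choose n)) else ∞

end DirichletForms

/-! ### Weighted graphs -/

/-- A weighted graph `(b, c)` over `X`. -/
structure WeightedGraph (X : Type*) where
  b : X → X → ℝ
  c : X → ℝ
  b_nonneg : ∀ x y, 0 ≤ b x y
  b_symm : ∀ x y, b x y = b y x
  b_diag : ∀ x, b x x = 0
  b_summable : ∀ x, Summable (b x)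
  c_nonneg : ∀ x, 0 ≤ c x

/-- The measure on the discrete space `X` with point masses `m x`. -/
noncomputable def vertexMeasure {X : Type*} [MeasurableSpace X] (m : X → ℝ) : Measure X :=
  Measure.sum fun x => ENNReal.ofReal (m x) • Measure.dirac x

namespace WeightedGraph

variable {X : Type*} (G : WeightedGraph X)

/-- Any two vertices are joined by a path of edges. -/
def Connected : Prop := ∀ x y : X, Relation.ReflTransGen (fun u v => 0 < G.b u v) x y

/-- The formal Laplacian. -/
noncomputable def laplacian (f : X → ℝ) (x : X) : ℝ :=
  (∑' y, G.b x y * (f x - f y)) + G.c x * f x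

/-- `h` is in the domain of the formal Laplacian and `ℒ h = 0`. -/
def IsHarmonic (h : X → ℝ) : Prop :=
  (∀ x, Summable fun y => G.b x y * |h y|) ∧ ∀ x, G.laplacian h x = 0

/-- The energy form on all functions. -/
noncomputable def energy (f : X → ℝ) : ℝ≥0∞ :=
  2⁻¹ * (∑' x, ∑' y, ENNReal.ofReal (G.b x y * (f x - f y) ^ 2))
    + ∑' x, ENNReal.ofReal (G.c x * f x ^ 2)

theorem energy_add_le (f g : X → ℝ) :
    G.energy (f + g) ≤ 2 * (G.energy f + G.energy g) := by
  have key : ∀ k s t : ℝ, 0 ≤ k → ENNReal.ofReal (k * (s + t) ^ 2) ≤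
      2 * (ENNReal.ofReal (k * s ^ 2) + ENNReal.ofReal (k * t ^ 2)) := by
    intro k s t hk
    rw [← ENNReal.ofReal_add (by positivity) (by positivity),
      show (2 : ℝ≥0∞) = ENNReal.ofReal 2 by simp, ← ENNReal.ofReal_mul (by norm_num)]
    refine ENNReal.ofReal_le_ofReal ?_
    nlinarith [mul_nonneg hk (sq_nonneg (s - t))]
  have h1 : (∑' x, ∑' y, ENNReal.ofReal (G.b x y * ((f + g) x - (f + g) y) ^ 2)) ≤
      2 * ((∑' x, ∑' y, ENNReal.ofReal (G.b x y * (f x - f y) ^ 2)) +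
        ∑' x, ∑' y, ENNReal.ofReal (G.b x y * (g x - g y) ^ 2)) := by
    simp only [← ENNReal.tsum_add, ← ENNReal.tsum_mul_left]
    refine ENNReal.tsum_le_tsum fun x => ENNReal.tsum_le_tsum fun y => ?_
    have := key (G.b x y) (f x - f y) (g x - g y) (G.b_nonneg x y)
    rwa [show f x - f y + (g x - g y) = (f + g) x - (f + g) y by simp; ring] at this
  have h2 : (∑' x, ENNReal.ofReal (G.c x * (f + g) x ^ 2)) ≤
      2 * ((∑' x, ENNReal.ofReal (G.c x * f x ^ 2)) +
        ∑' x, ENNReal.ofReal (G.c x * g x ^ 2)) := by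
    simp only [← ENNReal.tsum_add, ← ENNReal.tsum_mul_left]
    exact ENNReal.tsum_le_tsum fun x => key (G.c x) (f x) (g x) (G.c_nonneg x)
  unfold energy
  refine (add_le_add (mul_le_mul_right h1 _) h2).trans (le_of_eq ?_)
  ring

theorem energy_smul (a : ℝ) (f : X → ℝ) :
    G.energy (a • f) = ENNReal.ofReal (a ^ 2) * G.energy f := by
  have h1 : ∀ x y, ENNReal.ofReal (G.b x y * ((a • f) x - (a • f) y) ^ 2) =
      ENNReal.ofReal (a ^ 2) * ENNReal.ofReal (G.b x y * (f x - f y) ^ 2) := by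
    intro x y
    rw [← ENNReal.ofReal_mul (sq_nonneg a)]
    congr 1
    simp only [Pi.smul_apply, smul_eq_mul]
    ring
  have h2 : ∀ x, ENNReal.ofReal (G.c x * (a • f) x ^ 2) =
      ENNReal.ofReal (a ^ 2) * ENNReal.ofReal (G.c x * f x ^ 2) := by
    intro x
    rw [← ENNReal.ofReal_mul (sq_nonneg a)]
    congr 1
    simp only [Pi.smul_apply, smul_eq_mul]
    ring
  unfold energy
  simp only [h1, h2, ENNReal.tsum_mul_left]
  ring

/-- The space of functions of finite energy. -/
def finiteEnergy : Submodule ℝ (X → ℝ) where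
  carrier := {f | G.energy f < ∞}
  zero_mem' := by simp [energy]
  add_mem' := fun {f g} hf hg => (G.energy_add_le f g).trans_lt
    (ENNReal.mul_lt_top (by simp) (ENNReal.add_lt_top.2 ⟨hf, hg⟩))
  smul_mem' := fun a f hf => by
    show G.energy (a • f) < ∞
    rw [energy_smul]
    exact ENNReal.mul_lt_top ENNReal.ofReal_lt_top hf

/-- The square of the norm `‖f‖_o`, that is, the energy of `f` plus `f(o)²`. -/
noncomputable def normSq (o : X) (f : X → ℝ) : ℝ≥0∞ := G.energy f + ENNReal.ofReal (f o ^ 2)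

/-- `D₀`, the closure of the finitely supported functions in the space of functions of finite
energy with respect to the norm `‖·‖_o`. On a connected graph these norms are equivalent, and the
closure does not depend on `o`. -/
def vanishing : Set (X → ℝ) :=
  {f | f ∈ G.finiteEnergy ∧ ∀ o : X, ∀ ε : ℝ≥0∞, 0 < ε →
    ∃ φ : X → ℝ, (Function.support φ).Finite ∧ G.normSq o (f - φ) < ε}

def Transient : Prop := ∀ f ∈ G.vanishing, G.energy f = 0 → f = 0

/-! ### The Royden compactification and the harmonic boundary -/

/-- The algebra `𝒜`: the uniform closure of the bounded functions of finite energy. -/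
def uniformClosure : Set (X → ℝ) :=
  {f | ∀ ε : ℝ, 0 < ε → ∃ g ∈ G.finiteEnergy, (∃ M : ℝ, ∀ x, |g x| ≤ M) ∧ ∀ x, |f x - g x| ≤ ε}

/-- The algebra `𝒜⁺` generated by `𝒜` and the constant function `1`. All its elements are bounded;
those which have finite energy are exactly the bounded functions of finite energy. -/
def roydenAlgebra : Subalgebra ℝ (X → ℝ) := Algebra.adjoin ℝ G.uniformClosure

theorem mem_roydenAlgebra_of_bounded {f : X → ℝ} (hf : f ∈ G.finiteEnergy)
    (hb : ∃ M : ℝ, ∀ x, |f x| ≤ M) : f ∈ G.roydenAlgebra :=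
  Algebra.subset_adjoin fun ε hε => ⟨f, hf, hb, fun x => by simpa using hε.le⟩

theorem bounded_of_mem_roydenAlgebra {f : X → ℝ} (hf : f ∈ G.roydenAlgebra) :
    ∃ M : ℝ, ∀ x, |f x| ≤ M := by
  induction hf using Algebra.adjoin_induction with
  | mem f hf =>
    obtain ⟨g, -, ⟨M, hM⟩, h⟩ := hf 1 one_pos
    refine ⟨1 + M, fun x => ?_⟩
    have := abs_add_le (f x - g x) (g x)
    rw [sub_add_cancel] at this
    linarith [h x, hM x]
  | algebraMap r => exact ⟨|r|, fun x => le_of_eq (by simp)⟩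
  | add f g _ _ hf hg =>
    obtain ⟨M, hM⟩ := hf
    obtain ⟨N, hN⟩ := hg
    exact ⟨M + N, fun x => (abs_add_le _ _).trans (add_le_add (hM x) (hN x))⟩
  | mul f g _ _ hf hg =>
    obtain ⟨M, hM⟩ := hf
    obtain ⟨N, hN⟩ := hg
    refine ⟨M * N, fun x => ?_⟩
    rw [Pi.mul_apply, abs_mul]
    exact mul_le_mul (hM x) (hN x) (abs_nonneg _) ((abs_nonneg _).trans (hM x))

/-- The Royden compactification `R`: the Gelfand space of `𝒜⁺`, consisting of all characters of
`𝒜⁺` with the topology of pointwise convergence. The value of (the continuous extension of)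
`f ∈ 𝒜⁺` at `χ ∈ R` is `χ f`. -/
def Royden : Type _ := G.roydenAlgebra →ₐ[ℝ] ℝ

/-- The value at the point `χ` of the Royden compactification of the continuous extension of
`f ∈ 𝒜⁺`. -/
def Royden.eval {G : WeightedGraph X} (χ : G.Royden) (f : G.roydenAlgebra) : ℝ :=
  (show G.roydenAlgebra →ₐ[ℝ] ℝ from χ) f

instance : TopologicalSpace G.Royden :=
  TopologicalSpace.induced (fun (χ : G.Royden) (f : G.roydenAlgebra) => χ.eval f) Pi.topologicalSpace

instance : MeasurableSpace G.Royden := borel G.Royden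

instance : BorelSpace G.Royden := ⟨rfl⟩

/-- The embedding of `X` into its Royden compactification by point evaluation. -/
def toRoyden (x : X) : G.Royden := (Pi.evalAlgHom ℝ (fun _ : X => ℝ) x).comp G.roydenAlgebra.val

/-- The Royden boundary. -/
def roydenBoundary : Set G.Royden := (Set.range G.toRoyden)ᶜ

/-- The harmonic boundary: the points of the Royden boundary at which all bounded functions in `D₀`
vanish. It carries the subspace topology and its Borel sets. -/
def harmonicBoundary : Set G.Royden :=
  {χ | χ ∈ G.roydenBoundary ∧
    ∀ f : G.roydenAlgebra, (f : X → ℝ) ∈ G.vanishing → χ.eval f = 0}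

/-- The restriction of (the continuous extension of) a function in `𝒜⁺` to the harmonic boundary;
on `𝒜` this is the preliminary trace map. -/
def preTrace (f : G.roydenAlgebra) (p : G.harmonicBoundary) : ℝ := p.1.eval f

/-! ### Harmonic measures, harmonic extension and trace map -/

/-- `μ` is the harmonic measure at `x`: a regular Borel measure on the harmonic boundary of mass at
most one which represents the value at `x` of every bounded harmonic function of finite energy.
The last clause is the normalization `μ {p_∞} = 0`: a point at which all functions in `𝒜` vanish
exists precisely if `1 ∉ 𝒜`, and then it is the unique such point, called `p_∞`. -/
structure IsHarmonicMeasureAt (x : X) (μ : Measure G.harmonicBoundary) : Prop where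
  regular : μ.Regular
  mass_le_one : μ Set.univ ≤ 1
  represents : ∀ h : G.roydenAlgebra, (h : X → ℝ) ∈ G.finiteEnergy → G.IsHarmonic h →
    (h : X → ℝ) x = ∫ p, G.preTrace h p ∂μ
  normalized : ∀ p : G.harmonicBoundary,
    (∀ f : G.roydenAlgebra, (f : X → ℝ) ∈ G.uniformClosure → G.preTrace f p = 0) → μ {p} = 0

open Classical in
/-- The harmonic measure at `x`. -/
noncomputable def harmonicMeasure (x : X) : Measure G.harmonicBoundary :=
  if h : ∃ μ, G.IsHarmonicMeasureAt x μ then h.choose else 0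

/-- The harmonic extension to `X` of a function on the harmonic boundary. -/
noncomputable def harmonicExtension (φ : G.harmonicBoundary → ℝ) (x : X) : ℝ :=
  ∫ p, φ p ∂(G.harmonicMeasure x)

/-- `T` is a linear operator from the functions of finite energy to `L²` of the harmonic measure
at `z` which is continuous with respect to `‖·‖_o` and extends the preliminary trace map on bounded
functions of finite energy. -/
structure IsTraceMap (z : X) (T : G.finiteEnergy →ₗ[ℝ] Lp ℝ 2 (G.harmonicMeasure z)) : Prop where
  continuous : ∀ o : X, ∃ K : ℝ≥0, ∀ f : G.finiteEnergy,
    ‖T f‖ₑ ^ 2 ≤ K * G.normSq o (f : X → ℝ)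
  extends_preTrace : ∀ (f : G.roydenAlgebra) (hf : (f : X → ℝ) ∈ G.finiteEnergy),
    T ⟨f, hf⟩ =ᵐ[G.harmonicMeasure z] G.preTrace f

open Classical in
/-- The trace map. -/
noncomputable def traceMap (z : X) : G.finiteEnergy →ₗ[ℝ] Lp ℝ 2 (G.harmonicMeasure z) :=
  if h : ∃ T, G.IsTraceMap z T then h.choose else 0

/-! ### The forms `Q^(N)` and `Q^(D)`, trace forms and the Dirichlet-to-Neumann form -/

section Forms

variable [MeasurableSpace X] (m : X → ℝ)

/-- The form `Q^(N)`, the restriction of the energy to `ℓ²(X, m)`. -/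
noncomputable def neumannForm (f : Lp ℝ 2 (vertexMeasure m)) : ℝ≥0∞ := G.energy f

open Classical in
/-- The form `Q^(D)`, the restriction of `Q^(N)` to the closure of the finitely supported functions
with respect to the form norm of `Q^(N)`. -/
noncomputable def dirichletForm (f : Lp ℝ 2 (vertexMeasure m)) : ℝ≥0∞ :=
  if ∀ ε : ℝ≥0∞, 0 < ε → ∃ φ : Lp ℝ 2 (vertexMeasure m), (Function.support φ).Finite ∧
      G.neumannForm m (f - φ) + ‖f - φ‖ₑ ^ 2 < ε
  then G.neumannForm m f else ∞

variable {m}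

/-- The set of all traces of functions in the domain of the extended form of `Q`. -/
def traceDomain (z : X) (Q : Lp ℝ 2 (vertexMeasure m) → ℝ≥0∞) :
    Set (Lp ℝ 2 (G.harmonicMeasure z)) :=
  {φ | ∃ f : G.finiteEnergy, (f : X → ℝ) ∈ formDomain (extendedForm Q) ∧ G.traceMap z f = φ}

open Classical in
/-- The trace form of `Q` on `L²` of the harmonic measure at `z`. -/
noncomputable def traceForm (z : X) (Q : Lp ℝ 2 (vertexMeasure m) → ℝ≥0∞)
    (φ : Lp ℝ 2 (G.harmonicMeasure z)) : ℝ≥0∞ :=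
  if φ ∈ G.traceDomain z Q then extendedForm Q (G.harmonicExtension φ) else ∞

variable (m)

/-- The Dirichlet-to-Neumann form. -/
noncomputable def dirichletToNeumannForm (z : X) : Lp ℝ 2 (G.harmonicMeasure z) → ℝ≥0∞ :=
  G.traceForm z (G.neumannForm m)

end Forms

end WeightedGraph

/-!
# Trace forms on the harmonic boundary of a transient graph

**Potential theory.** On a transient connected graph the energy controls the point evaluations on
`D₀`, so every function `f` of finite energy splits orthogonally as `f = v + h` with `v ∈ D₀` and
`h` harmonic (`IsHarmonicPart`, `exists_isHarmonicPart`). Points of the Royden compactification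
commute with normal contractions (`Royden.eval_compRoyden`), and bounded harmonic functions of
finite energy satisfy a maximum principle on the harmonic boundary (`le_of_forall_boundary_le`).
Hence evaluation of harmonic functions at a vertex extends, by the theorems of Hahn-Banach and
Riesz, to a positive measure on the harmonic boundary (`exists_isHarmonicMeasureAt`). Harnack's
inequality makes the harmonic measures at different vertices comparable
(`exists_harmonicMeasure_le`), so harmonic extension is continuous on `L²`.

**The trace map.** For a bounded harmonic function `h` the integral of the boundary values of `h²`
is the value at `z` of the harmonic part of `h²`, which is estimated by the energy of `h` with the
help of the equilibrium potential of `z` (`exists_harmonicPart_sq_le`). So boundary values are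
continuous from the energy norm to `L²` and extend from the bounded functions by truncation
(`exists_isTraceMap`). The trace vanishes on `D₀`, the harmonic extension of the trace of `f` is
the harmonic part of `f` (`IsTraceMap.harmonicExtension_eq`), and the trace commutes with normal
contractions (`IsTraceMap.comp_ae_eq`).

**The extended form.** The regularization `u ↦ inf_v q(v) + α ‖u - v‖²` of a closed Markovian form
`q` on `ℓ²(X, m)` is a bounded Markovian form, hence the energy of some weighted graph
(`exists_energy_eq_moreau`). Energies are lower semicontinuous for pointwise convergence by Fatou's
lemma, and so is the supremum `q` of its regularizations (`IsDirichletFormWide.le_of_tendsto`). It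
follows that the extended form does not depend on approximating sequences and is a Markovian
quadratic form on all functions, again lower semicontinuous for pointwise convergence. If `q` lies
between `Q^(D)` and `Q^(N)`, its extended form moreover dominates the energy and agrees with it on
the finitely supported functions (`isEnergyExtension_extendedForm`).

**The trace form.** Let `F` be such an extended form. It agrees with the energy on `D₀`, and since
`F` minus the energy is nonnegative, the harmonic part of `f` is `F`-orthogonal to `D₀`. Thus
`F h ≤ F f` for the harmonic part `h` of `f` (`IsEnergyExtension.le_of_isHarmonicPart`): among all
functions with trace `φ` the harmonic extension of `φ` has the smallest `F`. This gives finiteness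
of the trace form on its domain and its Markov property; closedness follows from the semicontinuity
of `F` and the continuity of harmonic extension and trace (`isDirichletFormWide_traceForm`). If `m`
is finite, then the bounded functions of finite energy belong to `ℓ²(X, m)`, and their boundary
values are dense in `L²` by the Stone-Weierstrass theorem (`dense_boundaryLp`).
-/

/-! ### Quadratic forms with values in `[0, ∞]` -/

section QuadraticForms

variable {V : Type*} {q : V → ℝ≥0∞}

/-- The seminorm `q ^ (1/2)` on the domain of a quadratic form (with a junk value off the
domain). -/
noncomputable def formNorm (q : V → ℝ≥0∞) (f : V) : ℝ := √(q f).toReal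

theorem formNorm_nonneg (f : V) : 0 ≤ formNorm q f := Real.sqrt_nonneg _

theorem formNorm_sq (f : V) : formNorm q f ^ 2 = (q f).toReal := Real.sq_sqrt ENNReal.toReal_nonneg

theorem ofReal_formNorm_sq {f : V} (hf : q f < ∞) : ENNReal.ofReal (formNorm q f ^ 2) = q f := by
  rw [formNorm_sq, ENNReal.ofReal_toReal hf.ne]

variable [AddCommGroup V] [Module ℝ V]

namespace IsQuadraticForm

theorem smul (hq : IsQuadraticForm q) (a : ℝ) (f : V) :
    q (a • f) = ENNReal.ofReal (a ^ 2) * q f := by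
  obtain ⟨D, B, hs, hp, hD, hoff⟩ := hq
  by_cases hf : f ∈ D
  · have h1 := hD (a • ⟨f, hf⟩)
    have h2 := hD ⟨f, hf⟩
    simp only [Submodule.coe_smul, map_smul, LinearMap.smul_apply, smul_eq_mul] at h1 h2
    rw [h1, h2, ← ENNReal.ofReal_mul (sq_nonneg a)]
    congr 1; ring
  · by_cases ha : a = 0
    · subst ha
      have := hD 0
      simpa using this
    · rw [hoff f hf, hoff, ENNReal.mul_top]
      · simpa using ha
      · rwa [D.smul_mem_iff ha]

theorem map_zero (hq : IsQuadraticForm q) : q 0 = 0 := by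
  simpa using hq.smul 0 0

theorem neg (hq : IsQuadraticForm q) (f : V) : q (-f) = q f := by
  simpa using hq.smul (-1) f

theorem sub_comm (hq : IsQuadraticForm q) (f g : V) : q (f - g) = q (g - f) := by
  rw [← hq.neg, neg_sub]

theorem parallelogram (hq : IsQuadraticForm q) (f g : V) :
    q (f + g) + q (f - g) = 2 * (q f + q g) := by
  obtain ⟨D, B, hs, hp, hD, hoff⟩ := hq
  by_cases hfg : f ∈ D ∧ g ∈ D
  · obtain ⟨hf, hg⟩ := hfg
    have h1 := hD ⟨f, hf⟩
    have h2 := hD ⟨g, hg⟩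
    have h3 := hD (⟨f, hf⟩ + ⟨g, hg⟩)
    have h4 := hD (⟨f, hf⟩ - ⟨g, hg⟩)
    have p3 := hp (⟨f, hf⟩ + ⟨g, hg⟩)
    have p4 := hp (⟨f, hf⟩ - ⟨g, hg⟩)
    have p1 := hp ⟨f, hf⟩
    have p2 := hp ⟨g, hg⟩
    simp only [Submodule.coe_add, Submodule.coe_sub] at h3 h4
    rw [h1, h2, h3, h4, ← ENNReal.ofReal_add p3 p4, ← ENNReal.ofReal_add p1 p2,
      show (2 : ℝ≥0∞) = ENNReal.ofReal 2 by simp, ← ENNReal.ofReal_mul (by norm_num)]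
    congr 1
    simp only [map_add, map_sub, LinearMap.add_apply, LinearMap.sub_apply]
    ring
  · have hr : 2 * (q f + q g) = ∞ := by
      rw [not_and_or] at hfg
      rcases hfg with h | h <;> simp [hoff _ h]
    rw [hr]
    by_cases hp : f + g ∈ D
    · by_cases hm : f - g ∈ D
      · refine absurd ⟨?_, ?_⟩ hfg
        · have := D.smul_mem (1 / 2 : ℝ) (D.add_mem hp hm)
          convert this using 1
          module
        · have := D.smul_mem (1 / 2 : ℝ) (D.sub_mem hp hm)
          convert this using 1
          module
      · simp [hoff _ hm]
    · simp [hoff _ hp]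

theorem add_le (hq : IsQuadraticForm q) (f g : V) : q (f + g) ≤ 2 * (q f + q g) :=
  (hq.parallelogram f g) ▸ le_self_add

theorem sub_le (hq : IsQuadraticForm q) (f g : V) : q (f - g) ≤ 2 * (q f + q g) :=
  (hq.parallelogram f g) ▸ le_add_self

theorem add_lt_top (hq : IsQuadraticForm q) {f g : V} (hf : q f < ∞) (hg : q g < ∞) :
    q (f + g) < ∞ :=
  (hq.add_le f g).trans_lt (ENNReal.mul_lt_top (by simp) (ENNReal.add_lt_top.2 ⟨hf, hg⟩))

theorem sub_lt_top (hq : IsQuadraticForm q) {f g : V} (hf : q f < ∞) (hg : q g < ∞) :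
    q (f - g) < ∞ :=
  (hq.sub_le f g).trans_lt (ENNReal.mul_lt_top (by simp) (ENNReal.add_lt_top.2 ⟨hf, hg⟩))

theorem smul_lt_top (hq : IsQuadraticForm q) (a : ℝ) {f : V} (hf : q f < ∞) : q (a • f) < ∞ := by
  rw [hq.smul]
  exact ENNReal.mul_lt_top ENNReal.ofReal_lt_top hf

/-- The domain of a quadratic form as a submodule. -/
def domain (hq : IsQuadraticForm q) : Submodule ℝ V where
  carrier := formDomain q
  zero_mem' := by simp [formDomain, hq.map_zero]
  add_mem' := fun hf hg => hq.add_lt_top hf hg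
  smul_mem' := fun a _ hf => hq.smul_lt_top a hf

theorem convex_le (hq : IsQuadraticForm q) (M : ℝ≥0∞) : Convex ℝ {f | q f ≤ M} := by
  obtain ⟨D, B, hs, hp, hD, hoff⟩ := hq
  rcases eq_or_ne M ∞ with rfl | hM
  · simpa using convex_univ
  have hmem : ∀ f, q f ≤ M → f ∈ D := fun f hf => by
    by_contra h
    rw [hoff f h] at hf
    exact hM (top_le_iff.1 hf)
  intro f hf g hg a b ha hb hab
  have hfD := hmem f hf
  have hgD := hmem g hg
  have h1 := hD ⟨f, hfD⟩
  have h2 := hD ⟨g, hgD⟩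
  have h3 := hD (a • ⟨f, hfD⟩ + b • ⟨g, hgD⟩)
  simp only [Submodule.coe_add, Submodule.coe_smul] at h1 h2 h3
  simp only [Set.mem_ofPred_eq] at hf hg ⊢
  rw [h1, ENNReal.ofReal_le_iff_le_toReal hM] at hf
  rw [h2, ENNReal.ofReal_le_iff_le_toReal hM] at hg
  rw [h3, ENNReal.ofReal_le_iff_le_toReal hM]
  have h4 := hp (⟨f, hfD⟩ - ⟨g, hgD⟩)
  have h5 := hs ⟨f, hfD⟩ ⟨g, hgD⟩
  simp only [map_add, map_sub, map_smul, LinearMap.add_apply, LinearMap.sub_apply,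
    LinearMap.smul_apply, smul_eq_mul] at h4 ⊢
  have hb' : b = 1 - a := by linarith
  subst hb'
  nlinarith [mul_nonneg (mul_nonneg ha hb) h4]

/-- The expansion of a quadratic form along a line. -/
theorem exists_expansion (hq : IsQuadraticForm q) {f g : V} (hf : q f < ∞) (hg : q g < ∞) :
    ∃ β : ℝ, ∀ t : ℝ, (q (f + t • g)).toReal = (q f).toReal + 2 * t * β + t ^ 2 * (q g).toReal := by
  obtain ⟨D, B, hs, hp, hD, hoff⟩ := hq
  have hmem : ∀ f, q f < ∞ → f ∈ D := fun f hf => by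
    by_contra h
    simp [hoff f h] at hf
  have hfD := hmem f hf
  have hgD := hmem g hg
  refine ⟨B ⟨f, hfD⟩ ⟨g, hgD⟩, fun t => ?_⟩
  have h1 := hD ⟨f, hfD⟩
  have h2 := hD ⟨g, hgD⟩
  have h3 := hD (⟨f, hfD⟩ + t • ⟨g, hgD⟩)
  simp only [Submodule.coe_add, Submodule.coe_smul] at h1 h2 h3
  rw [h1, h2, h3, ENNReal.toReal_ofReal (hp _), ENNReal.toReal_ofReal (hp _),
    ENNReal.toReal_ofReal (hp _)]
  have h5 := hs ⟨f, hfD⟩ ⟨g, hgD⟩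
  simp only [map_add, map_smul, LinearMap.add_apply, LinearMap.smul_apply, smul_eq_mul]
  rw [← h5]
  ring

theorem formNorm_add_le (hq : IsQuadraticForm q) {f g : V} (hf : q f < ∞) (hg : q g < ∞) :
    formNorm q (f + g) ≤ formNorm q f + formNorm q g := by
  obtain ⟨β, hβ⟩ := hq.exists_expansion hf hg
  have h1 := hβ 1
  rw [one_smul] at h1
  have h2 : discrim (q g).toReal (2 * β) (q f).toReal ≤ 0 := discrim_le_zero fun t => by
    have := (hβ t).symm.trans_ge (ENNReal.toReal_nonneg)
    linarith
  have h3 : β ≤ formNorm q f * formNorm q g := by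
    refine le_of_sq_le_sq ?_ (mul_nonneg (formNorm_nonneg _) (formNorm_nonneg _))
    rw [mul_pow, formNorm_sq, formNorm_sq]
    unfold discrim at h2
    linarith
  refine Real.sqrt_le_iff.2 ⟨add_nonneg (formNorm_nonneg _) (formNorm_nonneg _), ?_⟩
  rw [h1, ← formNorm_sq, ← formNorm_sq]
  nlinarith

theorem formNorm_sub_comm (hq : IsQuadraticForm q) (f g : V) :
    formNorm q (f - g) = formNorm q (g - f) := by
  rw [formNorm, formNorm, hq.sub_comm]

theorem abs_formNorm_sub_le (hq : IsQuadraticForm q) {f g : V} (hf : q f < ∞) (hg : q g < ∞) :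
    |formNorm q f - formNorm q g| ≤ formNorm q (f - g) := by
  have h1 := hq.formNorm_add_le (hq.sub_lt_top hf hg) hg
  have h2 := hq.formNorm_add_le (hq.sub_lt_top hg hf) hf
  rw [sub_add_cancel] at h1 h2
  rw [hq.formNorm_sub_comm g f] at h2
  exact abs_le.2 ⟨by linarith, by linarith⟩

theorem tendsto_of_tendsto_sub (hq : IsQuadraticForm q) {u v : ℕ → V} (hu : ∀ n, q (u n) < ∞)
    (hv : ∀ n, q (v n) < ∞) (huv : Tendsto (fun n => q (u n - v n)) atTop (𝓝 0)) {l : ℝ≥0∞}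
    (hl : l < ∞) (h : Tendsto (fun n => q (u n)) atTop (𝓝 l)) :
    Tendsto (fun n => q (v n)) atTop (𝓝 l) := by
  have h1 : Tendsto (fun n => formNorm q (u n)) atTop (𝓝 √l.toReal) :=
    (Real.continuous_sqrt.tendsto _).comp ((ENNReal.tendsto_toReal hl.ne).comp h)
  have h2 : Tendsto (fun n => formNorm q (u n - v n)) atTop (𝓝 0) := by
    have := (Real.continuous_sqrt.tendsto _).comp
      ((ENNReal.tendsto_toReal ENNReal.zero_ne_top).comp huv)
    rwa [ENNReal.toReal_zero, Real.sqrt_zero] at this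
  have h3 : Tendsto (fun n => formNorm q (u n) - formNorm q (v n)) atTop (𝓝 0) :=
    squeeze_zero_norm (fun n => hq.abs_formNorm_sub_le (hu n) (hv n)) h2
  have h4 : Tendsto (fun n => formNorm q (v n)) atTop (𝓝 √l.toReal) := by
    simpa using h1.sub h3
  have h5 := (ENNReal.continuous_ofReal.tendsto _).comp (h4.pow 2)
  rw [Real.sq_sqrt ENNReal.toReal_nonneg, ENNReal.ofReal_toReal hl.ne] at h5
  exact h5.congr fun n => ofReal_formNorm_sq (hv n)

theorem exists_tendsto_of_cauchy (hq : IsQuadraticForm q) {u : ℕ → V} (hu : IsFormCauchy q u) :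
    ∃ l < ∞, Tendsto (fun n => q (u n)) atTop (𝓝 l) := by
  have h2 : Tendsto (fun p : ℕ × ℕ => formNorm q (u p.1 - u p.2)) atTop (𝓝 0) := by
    have := (Real.continuous_sqrt.tendsto _).comp
      ((ENNReal.tendsto_toReal ENNReal.zero_ne_top).comp hu.2)
    rwa [ENNReal.toReal_zero, Real.sqrt_zero] at this
  have h1 : CauchySeq fun n => formNorm q (u n) := by
    rw [Metric.cauchySeq_iff]
    intro ε hε
    have := h2.eventually (gt_mem_nhds hε)
    rw [eventually_atTop] at this
    obtain ⟨⟨a, b⟩, hab⟩ := this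
    refine ⟨max a b, fun m hm n hn => ?_⟩
    exact (hq.abs_formNorm_sub_le (hu.1 m) (hu.1 n)).trans_lt
      (hab (m, n) ⟨(le_max_left _ _).trans hm, (le_max_right _ _).trans hn⟩)
  obtain ⟨L, hL⟩ := cauchySeq_tendsto_of_complete h1
  refine ⟨ENNReal.ofReal (L ^ 2), ENNReal.ofReal_lt_top, ?_⟩
  exact ((ENNReal.continuous_ofReal.tendsto _).comp (hL.pow 2)).congr fun n =>
    ofReal_formNorm_sq (hu.1 n)

/-- A homogeneous function satisfying one half of the parallelogram law is a quadratic form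
(Jordan and von Neumann). -/
theorem of_parallelogram (hs : ∀ (a : ℝ) f, q (a • f) = ENNReal.ofReal (a ^ 2) * q f)
    (hp : ∀ f g, q (f + g) + q (f - g) ≤ 2 * (q f + q g)) : IsQuadraticForm q := by
  have hfin : ∀ f g, q f < ∞ → q g < ∞ → q (f + g) < ∞ := fun f g hf hg =>
    (le_self_add.trans (hp f g)).trans_lt
      (ENNReal.mul_lt_top (by simp) (ENNReal.add_lt_top.2 ⟨hf, hg⟩))
  let D : Submodule ℝ V :=
    { carrier := {f | q f < ∞}
      zero_mem' := by have := hs 0 0; simp at this; simp [this]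
      add_mem' := fun {f g} hf hg => hfin f g hf hg
      smul_mem' := fun a f hf => by
        show q (a • f) < ∞
        rw [hs]; exact ENNReal.mul_lt_top ENNReal.ofReal_lt_top hf }
  let r : D → ℝ := fun f => (q f).toReal
  have hr0 : ∀ f, 0 ≤ r f := fun f => ENNReal.toReal_nonneg
  have hrs : ∀ (a : ℝ) f, r (a • f) = a ^ 2 * r f := fun a f => by
    simp only [r, Submodule.coe_smul, hs, ENNReal.toReal_mul, ENNReal.toReal_ofReal (sq_nonneg a)]
  have hple : ∀ f g, r (f + g) + r (f - g) ≤ 2 * (r f + r g) := fun f g => by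
    have h := hp f g
    have h1 : q ((f + g : D) : V) < ∞ := (f + g).2
    have h2 : q ((f - g : D) : V) < ∞ := (f - g).2
    have h3 : q (f : V) < ∞ := f.2
    have h4 : q (g : V) < ∞ := g.2
    have h5 := ENNReal.toReal_mono
      (ENNReal.mul_lt_top (by simp) (ENNReal.add_lt_top.2 ⟨h3, h4⟩)).ne h
    simp only [Submodule.coe_add, Submodule.coe_sub] at h1 h2
    rw [ENNReal.toReal_add h1.ne h2.ne, ENNReal.toReal_mul, ENNReal.toReal_add h3.ne h4.ne] at h5
    simpa [r] using h5
  -- the converse inequality is the given one for `f + g` and `f - g`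
  have hpe : ∀ f g, r (f + g) + r (f - g) = 2 * (r f + r g) := fun f g => by
    refine le_antisymm (hple f g) ?_
    have h := hple (f + g) (f - g)
    rw [show f + g + (f - g) = (2 : ℝ) • f by module,
      show f + g - (f - g) = (2 : ℝ) • g by module, hrs, hrs] at h
    linarith
  have hrn : ∀ f, r (-f) = r f := fun f => by simpa using hrs (-1) f
  let b : D → D → ℝ := fun f g => (r (f + g) - r f - r g) / 2
  have hbs : ∀ f g, b f g = b g f := fun f g => by
    simp only [b, add_comm f g]; ring
  have hbadd : ∀ f g h, b (f + g) h = b f h + b g h := fun f g h => by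
    have e1 := hpe (f + h) g
    have e2 := hpe (f - g) h
    have e3 := hpe f (g - h)
    have e4 := hpe g h
    have e5 := hpe f g
    rw [show f + h + g = f + g + h by abel, show f + h - g = f - g + h by abel] at e1
    rw [show f + (g - h) = f + g - h by abel, show f - (g - h) = f - g + h by abel] at e3
    have e6 := hpe (f + g) h
    have e7 := hpe (g + h) f
    rw [show g + h + f = f + g + h by abel, show g + h - f = - (f - g - h) by abel, hrn] at e7
    simp only [b]
    linarith
  have hbdd : ∀ f g, |b f g| ≤ 3 / 2 * (r f + r g) := fun f g => by
    have h1 := hple f g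
    have h2 := hr0 (f + g)
    have h3 := hr0 (f - g)
    have h4 := hr0 f
    have h5 := hr0 g
    simp only [b]
    rw [abs_le]
    constructor <;> linarith
  -- `b` is additive and locally bounded in its first argument, hence linear
  have hbsmul : ∀ (a : ℝ) f g, b (a • f) g = a * b f g := fun a f g => by
    let φ : ℝ →+ ℝ := AddMonoidHom.mk' (fun t => b (t • f) g) fun s t => by
      simp only [add_smul, hbadd]
    have hc : Continuous φ := by
      refine continuous_of_continuousAt_zero φ ?_
      rw [ContinuousAt, _root_.map_zero, Metric.tendsto_nhds]
      intro ε hε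
      obtain ⟨N, hN⟩ := exists_nat_gt (3 / 2 * (r f + r g) / ε)
      have hN0 : (0 : ℝ) < N := lt_of_le_of_lt
        (div_nonneg (mul_nonneg (by norm_num) (add_nonneg (hr0 _) (hr0 _))) hε.le) hN
      have : ∀ᶠ t : ℝ in 𝓝 0, |t| < 1 / N := by
        have := Metric.ball_mem_nhds (0 : ℝ) (one_div_pos.2 hN0)
        filter_upwards [this] with t ht
        simpa using ht
      filter_upwards [this] with t ht
      have h1 : φ (N * t) = N * φ t := by
        have := φ.map_nsmul N t
        simpa using this
      have h2 : |φ (N * t)| ≤ 3 / 2 * (r f + r g) := by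
        refine (hbdd _ _).trans ?_
        rw [hrs]
        have : |N * t| ≤ 1 := by
          rw [abs_mul, abs_of_pos hN0]
          rw [lt_div_iff₀ hN0] at ht
          linarith
        have h3 : ((N : ℝ) * t) ^ 2 ≤ 1 := by
          rw [← sq_abs]; exact pow_le_one₀ (abs_nonneg _) this
        have := hr0 f
        nlinarith
      rw [h1, abs_mul, abs_of_pos hN0] at h2
      rw [dist_zero_right, Real.norm_eq_abs]
      rw [div_lt_iff₀ hε] at hN
      have := h2.trans_lt hN
      exact lt_of_mul_lt_mul_left this hN0.le
    have := (φ.toRealLinearMap hc).map_smul a 1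
    simpa [φ] using this
  refine ⟨D, LinearMap.mk₂ ℝ b hbadd (fun a f g => hbsmul a f g)
    (fun f g h => by rw [hbs, hbadd, hbs g, hbs h])
    (fun a f g => by rw [hbs, hbsmul, hbs g]; rfl), ?_, ?_, ?_, ?_⟩
  · exact hbs
  all_goals
    have hbf : ∀ f, b f f = r f := fun f => by
      have := hrs 2 f
      rw [two_smul] at this
      simp only [b, this]; ring
  · intro f
    rw [LinearMap.mk₂_apply, hbf]; exact hr0 f
  · intro f
    rw [LinearMap.mk₂_apply, hbf]
    exact (ENNReal.ofReal_toReal (ne_of_lt f.2)).symm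
  · intro f hf
    exact top_le_iff.1 (not_lt.1 hf)

/-- Nearly minimizing vectors of a quadratic form in a decreasing sequence of convex sets form a
Cauchy sequence, by the parallelogram law. Applied to a constant sequence of sets this yields
minimizing sequences, applied to the convex hulls of the tails of a bounded sequence it yields
Cauchy sequences of convex combinations. -/
theorem exists_cauchy_mem (hq : IsQuadraticForm q) {K : ℕ → Set V} (hK : Antitone K)
    (hc : ∀ n, Convex ℝ (K n)) {M : ℝ≥0∞} (hM : M < ∞) (h : ∀ n, ∃ u ∈ K n, q u ≤ M) :
    ∃ v, (∀ n, v n ∈ K n) ∧ IsFormCauchy q v ∧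
      Tendsto (fun n => q (v n)) atTop (𝓝 (⨆ n, ⨅ u ∈ K n, q u)) := by
  set d : ℕ → ℝ≥0∞ := fun n => ⨅ u ∈ K n, q u with hd
  have hdM : ∀ n, d n ≤ M := fun n => by
    obtain ⟨u, hu, hq⟩ := h n
    exact (iInf₂_le u hu).trans hq
  have hdm : Monotone d := fun n m hnm => by
    refine le_iInf₂ fun u hu => iInf₂_le u (hK hnm hu)
  have hdt : Tendsto d atTop (𝓝 (⨆ n, d n)) := tendsto_atTop_iSup hdm
  have hDM : (⨆ n, d n) < ∞ := (iSup_le hdM).trans_lt hM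
  have hex : ∀ n : ℕ, ∃ v ∈ K n, q v < d n + ENNReal.ofReal (1 / (n + 1)) := fun n => by
    have : d n < d n + ENNReal.ofReal (1 / (n + 1)) :=
      ENNReal.lt_add_right ((hdM n).trans_lt hM).ne (by
        simp only [ne_eq, ENNReal.ofReal_eq_zero, not_le]; positivity)
    simpa [hd, iInf_lt_iff] using this
  choose v hvK hv using hex
  have hδ : Tendsto (fun n : ℕ => d n + ENNReal.ofReal (1 / (n + 1))) atTop (𝓝 (⨆ n, d n)) := by
    have h1 := (ENNReal.continuous_ofReal.tendsto 0).comp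
      (tendsto_one_div_add_atTop_nhds_zero_nat (𝕜 := ℝ))
    simpa using hdt.add h1
  have hvfin : ∀ n, q (v n) < ∞ := fun n =>
    (hv n).trans_le le_top
  have hvt : Tendsto (fun n => q (v n)) atTop (𝓝 (⨆ n, d n)) :=
    tendsto_of_tendsto_of_tendsto_of_le_of_le hdt hδ (fun n => iInf₂_le (v n) (hvK n))
      fun n => (hv n).le
  refine ⟨v, hvK, ⟨hvfin, ?_⟩, hvt⟩
  -- the midpoint of `v i` and `v j` lies in `K (min i j)`
  have hkey : ∀ p : ℕ × ℕ, q (v p.1 - v p.2) ≤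
      2 * (q (v p.1) + q (v p.2)) - 4 * d (min p.1 p.2) := fun p => by
    have h1 : q ((1 / 2 : ℝ) • (v p.1 + v p.2)) = 4⁻¹ * q (v p.1 + v p.2) := by
      rw [hq.smul, show ((1 / 2 : ℝ) ^ 2) = 4⁻¹ by norm_num, ENNReal.ofReal_inv_of_pos (by norm_num)]
      simp
    have h2 : d (min p.1 p.2) ≤ 4⁻¹ * q (v p.1 + v p.2) := by
      rw [← h1]
      refine iInf₂_le _ ?_
      rw [smul_add]
      exact hc _ (hK (min_le_left _ _) (hvK p.1)) (hK (min_le_right _ _) (hvK p.2))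
        (by norm_num) (by norm_num) (by norm_num)
    have h3 : 4 * d (min p.1 p.2) ≤ q (v p.1 + v p.2) := by
      calc 4 * d (min p.1 p.2) ≤ 4 * (4⁻¹ * q (v p.1 + v p.2)) := by gcongr
        _ = q (v p.1 + v p.2) := by
          rw [← mul_assoc, ENNReal.mul_inv_cancel (by norm_num) (by norm_num), one_mul]
    rw [← hq.parallelogram]
    refine ENNReal.le_sub_of_add_le_left ?_ (by gcongr)
    exact ENNReal.mul_ne_top (by simp) ((hdM _).trans_lt hM).ne
  refine tendsto_of_tendsto_of_tendsto_of_le_of_le tendsto_const_nhds ?_ (fun p => zero_le) hkey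
  have hfst : Tendsto (fun p : ℕ × ℕ => p.1) atTop atTop := by
    rw [← prod_atTop_atTop_eq]; exact tendsto_fst
  have hsnd : Tendsto (fun p : ℕ × ℕ => p.2) atTop atTop := by
    rw [← prod_atTop_atTop_eq]; exact tendsto_snd
  have hmin : Tendsto (fun p : ℕ × ℕ => min p.1 p.2) atTop atTop :=
    tendsto_atTop.2 fun n => by
      filter_upwards [hfst.eventually_ge_atTop n, hsnd.eventually_ge_atTop n] with p h1 h2
      exact le_min h1 h2
  have h1 := ENNReal.Tendsto.const_mul (a := 2) ((hvt.comp hfst).add (hvt.comp hsnd))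
    (Or.inr (by simp))
  have h2 := ENNReal.Tendsto.const_mul (a := 4) (hdt.comp hmin) (Or.inr (by simp))
  have h3 := ENNReal.Tendsto.sub h1 h2 (Or.inl
    (ENNReal.mul_ne_top (by simp) (ENNReal.add_ne_top.2 ⟨hDM.ne, hDM.ne⟩)))
  have h4 : 2 * ((⨆ n, d n) + ⨆ n, d n) - 4 * ⨆ n, d n = 0 := by
    rw [← two_mul, ← mul_assoc]; norm_num
  rw [h4] at h3
  exact h3

/-- Every bounded sequence has convex combinations of its tails which form a Cauchy sequence. -/
theorem exists_cauchy_mem_convexHull (hq : IsQuadraticForm q) {u : ℕ → V} {M : ℝ≥0∞} (hM : M < ∞)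
    (hu : ∀ n, q (u n) ≤ M) :
    ∃ v, (∀ n, v n ∈ convexHull ℝ (u '' Set.Ici n)) ∧ IsFormCauchy q v ∧ (∀ n, q (v n) ≤ M) ∧
      ∃ l ≤ M, Tendsto (fun n => q (v n)) atTop (𝓝 l) := by
  obtain ⟨v, hv, hc, ht⟩ := hq.exists_cauchy_mem
    (K := fun n => convexHull ℝ (u '' Set.Ici n))
    (fun n m hnm => convexHull_mono (Set.image_mono (Set.Ici_subset_Ici.2 hnm)))
    (fun n => convex_convexHull ℝ _) hM
    (fun n => ⟨u n, subset_convexHull ℝ _ ⟨n, Set.mem_Ici.2 le_rfl, rfl⟩, hu n⟩)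
  have hle : ∀ n, q (v n) ≤ M := fun n =>
    convexHull_min (by rintro _ ⟨k, -, rfl⟩; exact hu k) (hq.convex_le M) (hv n)
  exact ⟨v, hv, hc, hle, _, le_of_tendsto' ht hle, ht⟩

/-- A quadratic form pulled back along a linear map, and set to `∞` off a subspace. -/
theorem comp_of_domain (hq : IsQuadraticForm q) {W : Type*} [AddCommGroup W] [Module ℝ W]
    (D : Submodule ℝ W) (L : D →ₗ[ℝ] V) {p : W → ℝ≥0∞} (hp : ∀ w : D, p w = q (L w))
    (hoff : ∀ w ∉ D, p w = ∞) : IsQuadraticForm p := by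
  have h0 : p 0 = 0 := by simpa [hq.map_zero] using hp 0
  refine of_parallelogram (fun a w => ?_) fun f g => ?_
  · by_cases hw : w ∈ D
    · have h1 := hp ⟨w, hw⟩
      have h2 := hp (a • ⟨w, hw⟩)
      rw [_root_.map_smul, hq.smul, ← h1] at h2
      exact h2
    · rcases eq_or_ne a 0 with rfl | ha
      · simp [h0]
      · rw [hoff w hw, hoff, ENNReal.mul_top]
        · simpa using ha
        · rwa [D.smul_mem_iff ha]
  · by_cases hfg : f ∈ D ∧ g ∈ D
    · obtain ⟨hf, hg⟩ := hfg
      have h1 := hp ⟨f, hf⟩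
      have h2 := hp ⟨g, hg⟩
      have h3 := hp (⟨f, hf⟩ + ⟨g, hg⟩)
      have h4 := hp (⟨f, hf⟩ - ⟨g, hg⟩)
      rw [_root_.map_add] at h3
      rw [_root_.map_sub] at h4
      simp only [Submodule.coe_add, Submodule.coe_sub] at h3 h4
      rw [h1, h2, h3, h4, hq.parallelogram]
    · rw [not_and_or] at hfg
      rcases hfg with h | h <;> simp [hoff _ h]

theorem comp (hq : IsQuadraticForm q) {W : Type*} [AddCommGroup W] [Module ℝ W]
    (L : W →ₗ[ℝ] V) : IsQuadraticForm (q ∘ L) :=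
  hq.comp_of_domain ⊤ (L ∘ₗ Submodule.subtype _) (fun _ => rfl) (fun _ hw => absurd trivial hw)

end IsQuadraticForm

/-- Convex combinations of the tails of a convergent sequence have the same limit. -/
theorem tendsto_of_mem_convexHull {F : Type*} [NormedAddCommGroup F] [NormedSpace ℝ F]
    (L : V →ₗ[ℝ] F) {u v : ℕ → V} {f : F} (hu : Tendsto (fun n => L (u n)) atTop (𝓝 f))
    (hv : ∀ n, v n ∈ convexHull ℝ (u '' Set.Ici n)) :
    Tendsto (fun n => L (v n)) atTop (𝓝 f) := by
  rw [Metric.tendsto_atTop] at hu ⊢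
  intro ε hε
  obtain ⟨N, hN⟩ := hu ε hε
  refine ⟨N, fun n hn => ?_⟩
  have : convexHull ℝ (u '' Set.Ici n) ⊆ L ⁻¹' Metric.ball f ε :=
    convexHull_min (by rintro _ ⟨k, hk, rfl⟩; exact hN k (hn.trans hk))
      ((convex_ball f ε).linear_preimage L)
  exact this (hv n)

theorem IsFormCauchy.sub  (hq : IsQuadraticForm q) {u v : ℕ → V} (hu : IsFormCauchy q u) (hv : IsFormCauchy q v) :
    IsFormCauchy q (fun n => u n - v n) := by
  refine ⟨fun n => hq.sub_lt_top (hu.1 n) (hv.1 n), ?_⟩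
  have h1 := ENNReal.Tendsto.const_mul (a := 2) (hu.2.add hv.2) (Or.inr ENNReal.ofNat_ne_top)
  rw [add_zero, mul_zero] at h1
  refine tendsto_of_tendsto_of_tendsto_of_le_of_le tendsto_const_nhds h1 (fun _ => zero_le)
    fun p => ?_
  have h2 := hq.sub_le (u p.1 - u p.2) (v p.1 - v p.2)
  rwa [sub_sub_sub_comm] at h2

theorem IsFormCauchy.smul  (hq : IsQuadraticForm q) {u : ℕ → V} (hu : IsFormCauchy q u) (a : ℝ) :
    IsFormCauchy q (fun n => a • u n) := by
  refine ⟨fun n => hq.smul_lt_top a (hu.1 n), ?_⟩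
  have h1 := ENNReal.Tendsto.const_mul (a := ENNReal.ofReal (a ^ 2)) hu.2
    (Or.inr ENNReal.ofReal_ne_top)
  rw [mul_zero] at h1
  refine h1.congr fun p => ?_
  rw [← hq.smul, smul_sub]

theorem IsFormCauchy.add  (hq : IsQuadraticForm q) {u v : ℕ → V} (hu : IsFormCauchy q u) (hv : IsFormCauchy q v) :
    IsFormCauchy q (fun n => u n + v n) := by
  have h1 := hu.sub hq (hv.smul hq (-1))
  simpa using h1

end QuadraticForms

/-! ### Lower semicontinuity and pointwise convergence -/

theorem LowerSemicontinuous.le_of_tendsto {W : Type*} [TopologicalSpace W] {q : W → ℝ≥0∞}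
    (hq : LowerSemicontinuous q) {u : ℕ → W} {f : W} (hu : Tendsto u atTop (𝓝 f)) {M : ℝ≥0∞}
    (h : ∀ᶠ n in atTop, q (u n) ≤ M) : q f ≤ M :=
  (hq.isClosed_preimage M).mem_of_tendsto hu h

theorem LowerSemicontinuous.le_of_tendsto_of_tendsto {W : Type*} [TopologicalSpace W]
    {q : W → ℝ≥0∞} (hq : LowerSemicontinuous q) {u : ℕ → W} {f : W} (hu : Tendsto u atTop (𝓝 f))
    {a : ℕ → ℝ≥0∞} {l : ℝ≥0∞} (ha : Tendsto a atTop (𝓝 l)) (h : ∀ n, q (u n) ≤ a n) : q f ≤ l :=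
  le_of_forall_gt_imp_ge_of_dense fun _ hb =>
    hq.le_of_tendsto hu ((ha.eventually_lt_const hb).mono fun n hn => (h n).trans hn.le)

/-- A Cauchy sequence with respect to a lower semicontinuous form converges in the form sense to
its limit in the weaker topology. -/
theorem LowerSemicontinuous.tendsto_sub {W : Type*} [AddCommGroup W] [Module ℝ W]
    [TopologicalSpace W] [ContinuousSub W] {q : W → ℝ≥0∞}
    (hq : LowerSemicontinuous q) {u : ℕ → W} {f : W} (hu : Tendsto u atTop (𝓝 f))
    (hc : Tendsto (fun p : ℕ × ℕ => q (u p.1 - u p.2)) atTop (𝓝 0)) :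
    Tendsto (fun n => q (u n - f)) atTop (𝓝 0) := by
  rw [ENNReal.tendsto_atTop_zero]
  intro ε hε
  have := hc.eventually (Iic_mem_nhds hε)
  rw [eventually_atTop] at this
  obtain ⟨⟨a, b⟩, hab⟩ := this
  refine ⟨a, fun n hn => hq.le_of_tendsto (tendsto_const_nhds.sub hu) ?_⟩
  filter_upwards [eventually_ge_atTop b] with m hm
  exact hab (n, m) ⟨hn, hm⟩

theorem eq_zero_of_forall_nonneg_quadratic {β c : ℝ} (h : ∀ t : ℝ, 0 ≤ 2 * t * β + t ^ 2 * c) :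
    β = 0 := by
  have h2 := discrim_le_zero (a := c) (b := 2 * β) (c := 0) fun t => by linarith [h t]
  unfold discrim at h2
  nlinarith

/-! ### Truncation -/

/-- Truncation of a real number at the levels `M` and `-M`. -/
def clamp (M r : ℝ) : ℝ := max (min r M) (-M)

theorem abs_clamp_sub_le (M N r s : ℝ) : |clamp M r - clamp N s| ≤ |r - s| + |M - N| := by
  unfold clamp
  have h1 := abs_max_sub_max_le_max (min r M) (-M) (min s N) (-N)
  have h2 := abs_min_sub_min_le_max r M s N
  have h3 : |-M - -N| = |M - N| := by rw [← abs_neg]; ring_nf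
  rw [h3] at h1
  have := abs_nonneg (r - s)
  have := abs_nonneg (M - N)
  refine h1.trans (max_le (h2.trans (max_le ?_ ?_)) ?_) <;> linarith

theorem abs_clamp_sub_clamp_le (M r s : ℝ) : |clamp M r - clamp M s| ≤ |r - s| := by
  simpa using abs_clamp_sub_le M M r s

theorem abs_clamp_le {M : ℝ} (hM : 0 ≤ M) (r : ℝ) : |clamp M r| ≤ M :=
  abs_le.2 ⟨le_max_right _ _, max_le (min_le_right _ _) (by linarith)⟩

theorem clamp_of_abs_le {M r : ℝ} (h : |r| ≤ M) : clamp M r = r := by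
  rw [abs_le] at h
  rw [clamp, min_eq_left h.2, max_eq_left h.1]

theorem clamp_zero {M : ℝ} (hM : 0 ≤ M) : clamp M 0 = 0 := clamp_of_abs_le (by simpa)

theorem isNormalContraction_clamp {M : ℝ} (hM : 0 ≤ M) : IsNormalContraction (clamp M) :=
  ⟨fun r => by simpa [clamp_zero hM] using abs_clamp_sub_clamp_le M r 0, abs_clamp_sub_clamp_le M⟩

theorem IsNormalContraction.continuous {C : ℝ → ℝ} (hC : IsNormalContraction C) : Continuous C :=
  LipschitzWith.continuous (K := 1) (LipschitzWith.of_dist_le_mul fun r s => by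
    simpa [Real.dist_eq] using hC.2 r s)

theorem isNormalContraction_id : IsNormalContraction id := ⟨fun _ => le_rfl, fun _ _ => le_rfl⟩

theorem IsNormalContraction.lipschitzWith {C : ℝ → ℝ} (hC : IsNormalContraction C) :
    LipschitzWith 1 C :=
  LipschitzWith.of_dist_le_mul fun r s => by simpa [Real.dist_eq] using hC.2 r s

theorem IsNormalContraction.map_zero {C : ℝ → ℝ} (hC : IsNormalContraction C) : C 0 = 0 := by
  simpa using hC.1 0

namespace WeightedGraph

variable {X : Type*} (G : WeightedGraph X)

/-! ### The energy as a weighted sum of squares of a gradient -/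

/-- The index set of the gradient is `(X × X) ⊕ X`; the weight is `b / 2` on the first and `c` on
the second summand. -/
noncomputable def gradWeight : (X × X) ⊕ X → ℝ :=
  Sum.elim (fun p => G.b p.1 p.2 / 2) G.c

/-- The differences of a function along all pairs of vertices, together with its values. -/
def grad (f : X → ℝ) : (X × X) ⊕ X → ℝ :=
  Sum.elim (fun p => f p.1 - f p.2) f

theorem gradWeight_nonneg (i : (X × X) ⊕ X) : 0 ≤ G.gradWeight i := by
  rcases i with p | x
  · exact div_nonneg (G.b_nonneg _ _) (by norm_num)
  · exact G.c_nonneg x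

theorem grad_add (f g : X → ℝ) (i : (X × X) ⊕ X) : grad (f + g) i = grad f i + grad g i := by
  rcases i with p | x
  · simp only [grad, Sum.elim_inl, Pi.add_apply]; ring
  · simp [grad]

theorem grad_sub (f g : X → ℝ) (i : (X × X) ⊕ X) : grad (f - g) i = grad f i - grad g i := by
  rcases i with p | x
  · simp only [grad, Sum.elim_inl, Pi.sub_apply]; ring
  · simp [grad]

theorem grad_smul (a : ℝ) (f : X → ℝ) (i : (X × X) ⊕ X) : grad (a • f) i = a * grad f i := by
  rcases i with p | x
  · simp only [grad, Sum.elim_inl, Pi.smul_apply, smul_eq_mul]; ring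
  · simp [grad]

theorem continuous_grad (i : (X × X) ⊕ X) : Continuous fun f : X → ℝ => grad f i := by
  rcases i with p | x
  · simp only [grad, Sum.elim_inl]; fun_prop
  · simp only [grad, Sum.elim_inr]; fun_prop

theorem abs_grad_le_of_lipschitz {f g : X → ℝ} (h1 : ∀ x y, |f x - f y| ≤ |g x - g y|)
    (h2 : ∀ x, |f x| ≤ |g x|) (i : (X × X) ⊕ X) : |grad f i| ≤ |grad g i| := by
  rcases i with p | x
  · exact h1 _ _
  · exact h2 x

theorem energy_eq_tsum (f : X → ℝ) :
    G.energy f = ∑' i, ENNReal.ofReal (G.gradWeight i * grad f i ^ 2) := by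
  rw [ENNReal.summable.tsum_sum ENNReal.summable, energy, ENNReal.tsum_prod', ← ENNReal.tsum_mul_left]
  congr 1
  refine tsum_congr fun x => ?_
  rw [← ENNReal.tsum_mul_left]
  refine tsum_congr fun y => ?_
  simp only [gradWeight, grad, Sum.elim_inl]
  rw [show G.b x y / 2 * (f x - f y) ^ 2 = 2⁻¹ * (G.b x y * (f x - f y) ^ 2) by ring,
    ENNReal.ofReal_mul (p := 2⁻¹) (by norm_num), ENNReal.ofReal_inv_of_pos (by norm_num)]
  simp

theorem lowerSemicontinuous_energy : LowerSemicontinuous G.energy := by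
  rw [show G.energy = fun f => ∑' i, ENNReal.ofReal (G.gradWeight i * grad f i ^ 2) from
    funext G.energy_eq_tsum]
  refine lowerSemicontinuous_tsum fun i => Continuous.lowerSemicontinuous ?_
  exact ENNReal.continuous_ofReal.comp (continuous_const.mul ((continuous_grad i).pow 2))

theorem isQuadraticForm_energy : IsQuadraticForm G.energy := by
  refine .of_parallelogram G.energy_smul fun f g => le_of_eq ?_
  simp only [energy_eq_tsum, ← ENNReal.tsum_add, ← ENNReal.tsum_mul_left]
  refine tsum_congr fun i => ?_
  have hw := G.gradWeight_nonneg i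
  rw [← ENNReal.ofReal_add (by positivity) (by positivity),
    ← ENNReal.ofReal_add (by positivity) (by positivity),
    show (2 : ℝ≥0∞) = ENNReal.ofReal 2 by simp, ← ENNReal.ofReal_mul (by norm_num),
    grad_add, grad_sub]
  congr 1; ring

theorem energy_le_of_grad_sq_le {f g h : X → ℝ} {a b : ℝ} (ha : 0 ≤ a) (hb : 0 ≤ b)
    (H : ∀ i, grad f i ^ 2 ≤ a * grad g i ^ 2 + b * grad h i ^ 2) :
    G.energy f ≤ ENNReal.ofReal a * G.energy g + ENNReal.ofReal b * G.energy h := by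
  simp only [energy_eq_tsum, ← ENNReal.tsum_add, ← ENNReal.tsum_mul_left]
  refine ENNReal.tsum_le_tsum fun i => ?_
  have hw := G.gradWeight_nonneg i
  rw [← ENNReal.ofReal_mul ha, ← ENNReal.ofReal_mul hb,
    ← ENNReal.ofReal_add (by positivity) (by positivity)]
  refine ENNReal.ofReal_le_ofReal ?_
  have := mul_le_mul_of_nonneg_left (H i) hw
  linarith

theorem energy_le_of_lipschitz {f g : X → ℝ} (h1 : ∀ x y, |f x - f y| ≤ |g x - g y|)
    (h2 : ∀ x, |f x| ≤ |g x|) : G.energy f ≤ G.energy g := by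
  have := G.energy_le_of_grad_sq_le (f := f) (g := g) (h := 0) zero_le_one le_rfl fun i => by
    simpa using sq_le_sq.2 (abs_grad_le_of_lipschitz h1 h2 i)
  simpa using this

theorem energy_comp_le {C : ℝ → ℝ} (hC : IsNormalContraction C) (f : X → ℝ) :
    G.energy (C ∘ f) ≤ G.energy f :=
  G.energy_le_of_lipschitz (fun _ _ => hC.2 _ _) fun _ => hC.1 _

theorem energy_mul_le {f g : X → ℝ} {M N : ℝ} (hf : ∀ x, |f x| ≤ M) (hg : ∀ x, |g x| ≤ N) :
    G.energy (f * g) ≤ ENNReal.ofReal (2 * N ^ 2) * G.energy f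
      + ENNReal.ofReal (2 * M ^ 2) * G.energy g := by
  refine G.energy_le_of_grad_sq_le (by positivity) (by positivity) fun i => ?_
  have sqle : ∀ {a A : ℝ}, |a| ≤ A → a ^ 2 ≤ A ^ 2 := fun h => by
    rw [← sq_abs]; exact pow_le_pow_left₀ (abs_nonneg _) h 2
  rcases i with ⟨x, y⟩ | x
  · simp only [grad, Sum.elim_inl, Pi.mul_apply]
    have h1 := mul_le_mul_of_nonneg_right (sqle (hf y)) (sq_nonneg (g x - g y))
    have h2 := mul_le_mul_of_nonneg_right (sqle (hg x)) (sq_nonneg (f x - f y))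
    nlinarith [sq_nonneg ((f x - f y) * g x - f y * (g x - g y))]
  · simp only [grad, Sum.elim_inr, Pi.mul_apply]
    have h1 := mul_le_mul_of_nonneg_right (sqle (hf x)) (sq_nonneg (g x))
    have h2 := mul_nonneg (sq_nonneg N) (sq_nonneg (f x))
    have h3 := mul_nonneg (sq_nonneg M) (sq_nonneg (g x))
    nlinarith

/-- Dominated convergence for the energy. -/
theorem tendsto_energy_sub {u : ℕ → X → ℝ} {f g : X → ℝ} (hu : Tendsto u atTop (𝓝 f))
    (hg : G.energy g < ∞) (h : ∀ n i, |grad (u n) i| ≤ |grad g i|) :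
    Tendsto (fun n => G.energy (u n - f)) atTop (𝓝 0) := by
  have hf : ∀ i, |grad f i| ≤ |grad g i| := fun i =>
    le_of_tendsto' ((((continuous_grad i).tendsto f).comp hu).abs) fun n => h n i
  rw [energy_eq_tsum] at hg
  have hsum : Summable fun i => 4 * (G.gradWeight i * grad g i ^ 2) := by
    refine ((ENNReal.summable_toReal hg.ne).congr fun i => ENNReal.toReal_ofReal ?_).mul_left 4
    exact mul_nonneg (G.gradWeight_nonneg i) (sq_nonneg _)
  have hb : ∀ n i, G.gradWeight i * grad (u n - f) i ^ 2 ≤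
      4 * (G.gradWeight i * grad g i ^ 2) := fun n i => by
    have hw := G.gradWeight_nonneg i
    have h1 : (grad (u n) i - grad f i) ^ 2 ≤ 4 * grad g i ^ 2 := by
      have := abs_sub (grad (u n) i) (grad f i)
      have h3 := h n i
      have h4 := hf i
      rw [← sq_abs, ← sq_abs (grad g i)]
      nlinarith [abs_nonneg (grad (u n) i - grad f i), abs_nonneg (grad g i)]
    rw [grad_sub]
    nlinarith
  have hnn : ∀ n i, 0 ≤ G.gradWeight i * grad (u n - f) i ^ 2 := fun n i =>
    mul_nonneg (G.gradWeight_nonneg i) (sq_nonneg _)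
  have hlim : Tendsto (fun n => ∑' i, G.gradWeight i * grad (u n - f) i ^ 2) atTop
      (𝓝 (∑' i : (X × X) ⊕ X, (0 : ℝ))) := by
    refine tendsto_tsum_of_dominated_convergence hsum (fun i => ?_)
      (Eventually.of_forall fun n i => ?_)
    · have h1 : Tendsto (fun n => grad (u n - f) i) atTop (𝓝 0) := by
        have := (((continuous_grad i).tendsto f).comp hu).sub_const (grad f i)
        rw [sub_self] at this
        exact this.congr fun n => (grad_sub _ _ _).symm
      simpa using (h1.pow 2).const_mul (G.gradWeight i)
    · rw [Real.norm_of_nonneg (hnn n i)]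
      exact hb n i
  have := (ENNReal.continuous_ofReal.tendsto _).comp hlim
  rw [tsum_zero, ENNReal.ofReal_zero] at this
  refine this.congr fun n => ?_
  rw [Function.comp_apply, ENNReal.ofReal_tsum_of_nonneg (hnn n)
    (Summable.of_nonneg_of_le (hnn n) (hb n) hsum), energy_eq_tsum]

/-! ### The energy as a bilinear form -/

/-- The bilinear form of the energy. The sum converges for functions of finite energy. -/
noncomputable def energyForm (f g : X → ℝ) : ℝ := ∑' i, G.gradWeight i * (grad f i * grad g i)

variable {G}

theorem summable_grad_sq {f : X → ℝ} (hf : G.energy f < ∞) :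
    Summable fun i => G.gradWeight i * grad f i ^ 2 := by
  rw [energy_eq_tsum] at hf
  have := ENNReal.summable_toReal hf.ne
  refine this.congr fun i => ENNReal.toReal_ofReal ?_
  exact mul_nonneg (G.gradWeight_nonneg i) (sq_nonneg _)

theorem summable_grad_mul {f g : X → ℝ} (hf : G.energy f < ∞) (hg : G.energy g < ∞) :
    Summable fun i => G.gradWeight i * (grad f i * grad g i) := by
  refine Summable.of_norm_bounded ((summable_grad_sq hf).add (summable_grad_sq hg)) fun i => ?_
  have hw := G.gradWeight_nonneg i
  rw [Real.norm_eq_abs, abs_mul, abs_of_nonneg hw, ← mul_add]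
  refine mul_le_mul_of_nonneg_left ?_ hw
  rw [abs_le]
  constructor <;> nlinarith [sq_nonneg (grad f i + grad g i), sq_nonneg (grad f i - grad g i),
    sq_nonneg (grad f i), sq_nonneg (grad g i)]

theorem toReal_energy {f : X → ℝ} : (G.energy f).toReal = G.energyForm f f := by
  rw [energy_eq_tsum, ENNReal.tsum_toReal_eq (fun i => ENNReal.ofReal_ne_top), energyForm]
  refine tsum_congr fun i => ?_
  rw [ENNReal.toReal_ofReal (mul_nonneg (G.gradWeight_nonneg i) (sq_nonneg _)), sq]

theorem energyForm_comm (f g : X → ℝ) : G.energyForm f g = G.energyForm g f := by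
  simp only [energyForm, mul_comm (grad f _)]

theorem energyForm_add_left {f g h : X → ℝ} (hf : G.energy f < ∞) (hg : G.energy g < ∞)
    (hh : G.energy h < ∞) : G.energyForm (f + g) h = G.energyForm f h + G.energyForm g h := by
  rw [energyForm, energyForm, energyForm,
    ← (summable_grad_mul hf hh).tsum_add (summable_grad_mul hg hh)]
  refine tsum_congr fun i => ?_
  rw [grad_add]; ring

theorem energyForm_sub_left {f g h : X → ℝ} (hf : G.energy f < ∞) (hg : G.energy g < ∞)
    (hh : G.energy h < ∞) : G.energyForm (f - g) h = G.energyForm f h - G.energyForm g h := by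
  rw [energyForm, energyForm, energyForm,
    ← (summable_grad_mul hf hh).tsum_sub (summable_grad_mul hg hh)]
  refine tsum_congr fun i => ?_
  rw [grad_sub]; ring

theorem energyForm_smul_left (a : ℝ) (f h : X → ℝ) :
    G.energyForm (a • f) h = a * G.energyForm f h := by
  rw [energyForm, energyForm, ← tsum_mul_left]
  refine tsum_congr fun i => ?_
  rw [grad_smul]; ring

theorem energyForm_add_right {f g h : X → ℝ} (hf : G.energy f < ∞) (hg : G.energy g < ∞)
    (hh : G.energy h < ∞) : G.energyForm f (g + h) = G.energyForm f g + G.energyForm f h := by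
  rw [energyForm_comm, energyForm_add_left hg hh hf, energyForm_comm g, energyForm_comm h]

theorem energyForm_sub_right {f g h : X → ℝ} (hf : G.energy f < ∞) (hg : G.energy g < ∞)
    (hh : G.energy h < ∞) : G.energyForm f (g - h) = G.energyForm f g - G.energyForm f h := by
  rw [energyForm_comm, energyForm_sub_left hg hh hf, energyForm_comm g, energyForm_comm h]

theorem energyForm_smul_right (a : ℝ) (f h : X → ℝ) :
    G.energyForm f (a • h) = a * G.energyForm f h := by
  rw [energyForm_comm, energyForm_smul_left, energyForm_comm]

theorem energy_add_smul_toReal {f g : X → ℝ} (hf : G.energy f < ∞) (hg : G.energy g < ∞) (t : ℝ) :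
    (G.energy (f + t • g)).toReal =
      (G.energy f).toReal + 2 * t * G.energyForm f g + t ^ 2 * (G.energy g).toReal := by
  have htg := G.isQuadraticForm_energy.smul_lt_top t hg
  have hs := G.isQuadraticForm_energy.add_lt_top hf htg
  simp only [toReal_energy]
  rw [energyForm_add_left hf htg hs, energyForm_add_right hf hf htg,
    energyForm_add_right htg hf htg, energyForm_smul_left, energyForm_smul_left,
    energyForm_smul_right, energyForm_comm g f]
  simp only [energyForm_smul_right]
  ring

theorem abs_energyForm_le {f g : X → ℝ} (hf : G.energy f < ∞) (hg : G.energy g < ∞) :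
    |G.energyForm f g| ≤ formNorm G.energy f * formNorm G.energy g := by
  have h2 := discrim_le_zero (a := (G.energy g).toReal) (b := 2 * G.energyForm f g)
    (c := (G.energy f).toReal) fun t => by
      have := (energy_add_smul_toReal hf hg t).symm.trans_ge ENNReal.toReal_nonneg
      linarith
  refine abs_le_of_sq_le_sq ?_ (mul_nonneg (formNorm_nonneg _) (formNorm_nonneg _))
  rw [mul_pow, formNorm_sq, formNorm_sq]
  unfold discrim at h2
  linarith

theorem tendsto_energyForm {u : ℕ → X → ℝ} {f g : X → ℝ} (hu : ∀ n, G.energy (u n) < ∞)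
    (hf : G.energy f < ∞) (hg : G.energy g < ∞)
    (h : Tendsto (fun n => G.energy (u n - f)) atTop (𝓝 0)) :
    Tendsto (fun n => G.energyForm g (u n)) atTop (𝓝 (G.energyForm g f)) := by
  have h2 : Tendsto (fun n => formNorm G.energy (u n - f)) atTop (𝓝 0) := by
    have := (Real.continuous_sqrt.tendsto _).comp
      ((ENNReal.tendsto_toReal ENNReal.zero_ne_top).comp h)
    rwa [ENNReal.toReal_zero, Real.sqrt_zero] at this
  rw [tendsto_iff_norm_sub_tendsto_zero]
  have h3 := h2.const_mul (formNorm G.energy g)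
  rw [mul_zero] at h3
  refine squeeze_zero (fun _ => norm_nonneg _) (fun n => ?_) h3
  rw [← energyForm_sub_right hg (hu n) hf]
  exact abs_energyForm_le hg (G.isQuadraticForm_energy.sub_lt_top (hu n) hf)

/-! ### Indicator functions of vertices and the formal Laplacian -/

theorem energy_single_lt_top [DecidableEq X] (x : X) : G.energy (Pi.single x 1) < ∞ := by
  have hb : (∑' y, ENNReal.ofReal (G.b x y)) < ∞ :=
    (G.b_summable x).tsum_ofReal_lt_top
  have h1 : (∑' u, ∑' v, ENNReal.ofReal
      (G.b u v * ((Pi.single x 1 : X → ℝ) u - (Pi.single x 1 : X → ℝ) v) ^ 2)) ≤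
      (∑' y, ENNReal.ofReal (G.b x y)) + ∑' y, ENNReal.ofReal (G.b x y) := by
    have : ∀ u v, ENNReal.ofReal
        (G.b u v * ((Pi.single x 1 : X → ℝ) u - (Pi.single x 1 : X → ℝ) v) ^ 2) ≤
        (if u = x then ENNReal.ofReal (G.b x v) else 0) +
          (if v = x then ENNReal.ofReal (G.b x u) else 0) := by
      intro u v
      by_cases hu : u = x
      · by_cases hv : v = x
        · simp [hu, hv]
        · subst hu; simp [hv]
      · by_cases hv : v = x
        · subst hv; simp [hu, G.b_symm u v]
        · simp [hu, hv]
    refine (ENNReal.tsum_le_tsum fun u => ENNReal.tsum_le_tsum fun v => this u v).trans ?_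
    simp only [ENNReal.tsum_add]
    refine add_le_add ?_ ?_
    · rw [ENNReal.tsum_comm]
      simp
    · simp
  have h2 : (∑' u, ENNReal.ofReal (G.c u * (Pi.single x 1 : X → ℝ) u ^ 2)) < ∞ := by
    rw [tsum_eq_single x fun u hu => by simp [hu]]
    exact ENNReal.ofReal_lt_top
  refine ENNReal.add_lt_top.2 ⟨ENNReal.mul_lt_top (by simp) (h1.trans_lt ?_), h2⟩
  exact ENNReal.add_lt_top.2 ⟨hb, hb⟩

theorem summable_b_mul_sub {f : X → ℝ} (hf : G.energy f < ∞) (x : X) :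
    Summable fun y => G.b x y * (f x - f y) := by
  have h1 : Summable fun y => G.b x y / 2 * (f x - f y) ^ 2 := by
    have := (summable_grad_sq hf).comp_injective
      (i := fun y => Sum.inl (x, y)) (fun y z h => by simpa using h)
    exact this
  refine Summable.of_norm_bounded ((h1.mul_left 2).add (G.b_summable x)) fun y => ?_
  have hb := G.b_nonneg x y
  rw [Real.norm_eq_abs, abs_mul, abs_of_nonneg hb]
  nlinarith [sq_nonneg (|f x - f y| - 1), sq_abs (f x - f y), abs_nonneg (f x - f y)]

theorem summable_b_mul_abs {f : X → ℝ} (hf : G.energy f < ∞) (x : X) :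
    Summable fun y => G.b x y * |f y| := by
  refine Summable.of_norm_bounded
    ((summable_b_mul_sub hf x).norm.add ((G.b_summable x).mul_right |f x|)) fun y => ?_
  have hb := G.b_nonneg x y
  rw [Real.norm_eq_abs, Real.norm_eq_abs, abs_mul, abs_mul, abs_of_nonneg hb, abs_abs, ← mul_add]
  refine mul_le_mul_of_nonneg_left ?_ hb
  have := abs_sub_abs_le_abs_sub (f y) (f x)
  rw [abs_sub_comm] at this
  linarith

/-- Green's formula for the indicator function of a vertex. -/
theorem energyForm_single [DecidableEq X] {f : X → ℝ} (hf : G.energy f < ∞) (x : X) :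
    G.energyForm f (Pi.single x 1) = G.laplacian f x := by
  have hs := summable_b_mul_sub hf x
  have hr : HasSum (fun p : X × X => if p.1 = x then G.b p.1 p.2 / 2 * (f p.1 - f p.2) else 0)
      (∑' y, G.b x y / 2 * (f x - f y)) := by
    have hi : Function.Injective fun y : X => (x, y) := fun y z h => by simpa using h
    rw [← hi.hasSum_iff]
    · simp only [Function.comp_def, if_true]
      refine Summable.hasSum ((hs.div_const 2).congr fun y => ?_)
      ring
    · rintro ⟨u, v⟩ h
      rw [if_neg]
      rintro rfl
      exact h ⟨v, rfl⟩
  have hc : HasSum (fun p : X × X => if p.2 = x then G.b p.1 p.2 / 2 * (f p.2 - f p.1) else 0)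
      (∑' y, G.b x y / 2 * (f x - f y)) := by
    have hi : Function.Injective fun y : X => (y, x) := fun y z h => by simpa using h
    rw [← hi.hasSum_iff]
    · simp only [Function.comp_def, if_true, G.b_symm _ x]
      refine Summable.hasSum ((hs.div_const 2).congr fun y => ?_)
      ring
    · rintro ⟨u, v⟩ h
      rw [if_neg]
      rintro rfl
      exact h ⟨u, rfl⟩
  have h1 := hr.add hc
  have h2 : HasSum (fun u => G.c u * (f u * (Pi.single x 1 : X → ℝ) u)) (G.c x * f x) := by
    have := hasSum_single (f := fun u => G.c u * (f u * (Pi.single x 1 : X → ℝ) u)) x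
      fun u hu => by simp [hu]
    simpa using this
  have h3 : HasSum (fun i => G.gradWeight i * (grad f i * grad (Pi.single x 1) i))
      (((∑' y, G.b x y / 2 * (f x - f y)) + ∑' y, G.b x y / 2 * (f x - f y)) + G.c x * f x) := by
    refine HasSum.sum ?_ h2
    refine h1.congr_fun ?_
    rintro ⟨u, v⟩
    simp only [Function.comp_def, gradWeight, grad, Sum.elim_inl, Pi.single_apply]
    split_ifs <;> ring
  rw [energyForm, h3.tsum_eq, laplacian, ← two_mul, ← tsum_mul_left]
  congr 1
  refine tsum_congr fun y => ?_
  ring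

end WeightedGraph

namespace WeightedGraph

variable {X : Type*} {G : WeightedGraph X}

/-! ### Continuity of point evaluations and completeness -/

theorem isQuadraticForm_normSq (o : X) : IsQuadraticForm (G.normSq o) := by
  refine .of_parallelogram (fun a f => ?_) fun f g => le_of_eq ?_
  · rw [normSq, normSq, G.isQuadraticForm_energy.smul, mul_add, ← ENNReal.ofReal_mul (sq_nonneg a),
      Pi.smul_apply, smul_eq_mul, mul_pow]
  · have h1 := G.isQuadraticForm_energy.parallelogram f g
    have h2 : ENNReal.ofReal ((f + g) o ^ 2) + ENNReal.ofReal ((f - g) o ^ 2) =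
        2 * (ENNReal.ofReal (f o ^ 2) + ENNReal.ofReal (g o ^ 2)) := by
      rw [← ENNReal.ofReal_add (by positivity) (by positivity),
        ← ENNReal.ofReal_add (by positivity) (by positivity),
        show (2 : ℝ≥0∞) = ENNReal.ofReal 2 by simp, ← ENNReal.ofReal_mul (by norm_num)]
      congr 1
      simp only [Pi.add_apply, Pi.sub_apply]
      ring
    simp only [normSq]
    calc _ = (G.energy (f + g) + G.energy (f - g)) +
          (ENNReal.ofReal ((f + g) o ^ 2) + ENNReal.ofReal ((f - g) o ^ 2)) := by ring
      _ = _ := by rw [h1, h2]; ring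

theorem ofReal_sq_sub_le_energy {x y : X} (h : 0 < G.b x y) (f : X → ℝ) :
    ENNReal.ofReal ((f x - f y) ^ 2) ≤ ENNReal.ofReal (2 / G.b x y) * G.energy f := by
  have h1 : ENNReal.ofReal (G.gradWeight (Sum.inl (x, y)) * grad f (Sum.inl (x, y)) ^ 2) ≤
      G.energy f := by
    rw [energy_eq_tsum]
    exact ENNReal.le_tsum (f := fun i => ENNReal.ofReal (G.gradWeight i * grad f i ^ 2))
      (Sum.inl (x, y))
  refine le_trans (le_of_eq ?_) (mul_le_mul_right h1 _)
  rw [← ENNReal.ofReal_mul (by positivity)]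
  congr 1
  simp only [gradWeight, grad, Sum.elim_inl]
  field_simp

/-- Point evaluations are continuous with respect to the norms `‖·‖_o`, as the graph is
connected. -/
theorem exists_sq_le_normSq (hconn : G.Connected) (o x : X) :
    ∃ K : ℝ≥0, ∀ f : X → ℝ, ENNReal.ofReal (f x ^ 2) ≤ K * G.normSq o f := by
  induction hconn o x with
  | refl => exact ⟨1, fun f => by simp [normSq]⟩
  | @tail y x _ hyx ih =>
    obtain ⟨K, hK⟩ := ih
    refine ⟨2 * (K + Real.toNNReal (2 / G.b y x)), fun f => ?_⟩
    have h1 := ofReal_sq_sub_le_energy hyx f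
    have h2 : ENNReal.ofReal (f x ^ 2) ≤
        2 * (ENNReal.ofReal (f y ^ 2) + ENNReal.ofReal ((f y - f x) ^ 2)) := by
      rw [← ENNReal.ofReal_add (by positivity) (by positivity),
        show (2 : ℝ≥0∞) = ENNReal.ofReal 2 by simp, ← ENNReal.ofReal_mul (by norm_num)]
      refine ENNReal.ofReal_le_ofReal ?_
      nlinarith [sq_nonneg (f y + (f y - f x))]
    have h3 : G.energy f ≤ G.normSq o f := le_self_add
    calc _ ≤ _ := h2
      _ ≤ 2 * (K * G.normSq o f + ENNReal.ofReal (2 / G.b y x) * G.normSq o f) := by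
        gcongr
        · exact hK f
        · exact h1.trans (by gcongr)
      _ = _ := by
        push_cast
        rw [ENNReal.ofReal]; ring

theorem tendsto_of_tendsto_ofReal_sq {ι : Type*} {l : Filter ι} {a : ι → ℝ}
    (h : Tendsto (fun i => ENNReal.ofReal (a i ^ 2)) l (𝓝 0)) : Tendsto a l (𝓝 0) := by
  have h1 := (ENNReal.tendsto_toReal ENNReal.zero_ne_top).comp h
  have h2 := (Real.continuous_sqrt.tendsto _).comp h1
  rw [ENNReal.toReal_zero, Real.sqrt_zero] at h2
  rw [tendsto_zero_iff_abs_tendsto_zero]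
  refine h2.congr fun i => ?_
  simp [ENNReal.toReal_ofReal (sq_nonneg _), Real.sqrt_sq_eq_abs]

theorem tendsto_apply_of_tendsto_normSq (hconn : G.Connected) (o : X) {ι : Type*} {l : Filter ι}
    {u : ι → X → ℝ} (h : Tendsto (fun i => G.normSq o (u i)) l (𝓝 0)) :
    Tendsto u l (𝓝 0) := by
  refine tendsto_pi_nhds.2 fun x => tendsto_of_tendsto_ofReal_sq ?_
  obtain ⟨K, hK⟩ := exists_sq_le_normSq hconn o x
  have := ENNReal.Tendsto.const_mul (a := K) h (Or.inr (by simp))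
  rw [mul_zero] at this
  exact tendsto_of_tendsto_of_tendsto_of_le_of_le tendsto_const_nhds this (fun _ => zero_le)
    fun i => hK (u i)

theorem tendsto_normSq {ι : Type*} {l : Filter ι} {u : ι → X → ℝ} {f : X → ℝ}
    (h1 : Tendsto u l (𝓝 f)) (h2 : Tendsto (fun i => G.energy (u i - f)) l (𝓝 0)) (o : X) :
    Tendsto (fun i => G.normSq o (u i - f)) l (𝓝 0) := by
  have h3 := (tendsto_pi_nhds.1 h1 o).sub_const (f o)
  have h4 := (ENNReal.continuous_ofReal.tendsto _).comp (h3.pow 2)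
  simpa [normSq] using h2.add h4

theorem tendsto_of_tendsto_normSq (hconn : G.Connected) (o : X) {ι : Type*} {l : Filter ι}
    {u : ι → X → ℝ} {f : X → ℝ} (h : Tendsto (fun i => G.normSq o (u i - f)) l (𝓝 0)) :
    Tendsto u l (𝓝 f) := by
  have := (tendsto_apply_of_tendsto_normSq hconn o h).add_const f
  simpa using this

/-- Completeness of the space of functions of finite energy. -/
theorem exists_tendsto_of_cauchy (hconn : G.Connected) (o : X) {u : ℕ → X → ℝ}
    (hu : IsFormCauchy G.energy u)
    (ho : Tendsto (fun p : ℕ × ℕ => u p.1 o - u p.2 o) atTop (𝓝 0)) :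
    ∃ f, Tendsto u atTop (𝓝 f) ∧ Tendsto (fun n => G.energy (u n - f)) atTop (𝓝 0) := by
  have h1 : Tendsto (fun p : ℕ × ℕ => G.normSq o (u p.1 - u p.2)) atTop (𝓝 0) := by
    have := (ENNReal.continuous_ofReal.tendsto _).comp (ho.pow 2)
    simpa [normSq] using hu.2.add this
  have h2 := tendsto_apply_of_tendsto_normSq hconn o h1
  have h3 : ∀ x, ∃ a, Tendsto (fun n => u n x) atTop (𝓝 a) := fun x => by
    refine cauchySeq_tendsto_of_complete (cauchySeq_iff_tendsto_dist_atTop_0.2 ?_)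
    have := (tendsto_pi_nhds.1 h2 x).abs
    simpa [Real.dist_eq] using this
  choose f hf using h3
  have hf' : Tendsto u atTop (𝓝 f) := tendsto_pi_nhds.2 hf
  exact ⟨f, hf', G.lowerSemicontinuous_energy.tendsto_sub hf' hu.2⟩

theorem energy_lt_top_of_tendsto {u : ℕ → X → ℝ} {f : X → ℝ} (hu : ∀ n, G.energy (u n) < ∞)
    (h : Tendsto (fun n => G.energy (u n - f)) atTop (𝓝 0)) : G.energy f < ∞ := by
  obtain ⟨n, hn⟩ := (h.eventually (gt_mem_nhds ENNReal.zero_lt_top)).exists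
  have := G.isQuadraticForm_energy.sub_lt_top (hu n) hn
  rwa [sub_sub_cancel] at this

/-! ### The space `D₀` -/

theorem energy_lt_top_of_finite_support {φ : X → ℝ} (h : (Function.support φ).Finite) :
    G.energy φ < ∞ := by
  classical
  have h1 : φ = ∑ x ∈ h.toFinset, φ x • Pi.single x (1 : ℝ) := by
    ext y
    simp only [Finset.sum_apply, Pi.smul_apply, smul_eq_mul, Pi.single_apply, mul_ite, mul_one,
      mul_zero, Finset.sum_ite_eq, Set.Finite.mem_toFinset, Function.mem_support]
    split_ifs with h2
    · rfl
    · exact not_not.1 h2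
  have h2 : ∑ x ∈ h.toFinset, φ x • (Pi.single x (1 : ℝ) : X → ℝ) ∈ G.finiteEnergy :=
    Submodule.sum_mem _ fun x _ => Submodule.smul_mem _ _ (energy_single_lt_top x)
  rw [← h1] at h2
  exact h2

theorem mem_vanishing_of_finite_support {φ : X → ℝ} (h : (Function.support φ).Finite) :
    φ ∈ G.vanishing :=
  ⟨energy_lt_top_of_finite_support h, fun o ε hε => ⟨φ, h, by
    rw [sub_self, (isQuadraticForm_normSq o).map_zero]; exact hε⟩⟩

theorem mem_vanishing_of_tendsto {u : ℕ → X → ℝ} {f : X → ℝ} (hu : ∀ n, u n ∈ G.vanishing)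
    (h1 : Tendsto u atTop (𝓝 f)) (h2 : Tendsto (fun n => G.energy (u n - f)) atTop (𝓝 0)) :
    f ∈ G.vanishing := by
  refine ⟨energy_lt_top_of_tendsto (fun n => (hu n).1) h2, fun o ε hε => ?_⟩
  have hε4 : 0 < ε / 4 := ENNReal.div_pos hε.ne' (by simp)
  obtain ⟨n, hn⟩ := ((tendsto_normSq h1 h2 o).eventually (gt_mem_nhds hε4)).exists
  obtain ⟨φ, hφ, hφ2⟩ := (hu n).2 o (ε / 4) hε4
  refine ⟨φ, hφ, ?_⟩
  have h3 := (isQuadraticForm_normSq (G := G) o).add_le (f - u n) (u n - φ)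
  rw [sub_add_sub_cancel, (isQuadraticForm_normSq o).sub_comm f (u n)] at h3
  refine h3.trans_lt ?_
  calc 2 * (G.normSq o (u n - f) + G.normSq o (u n - φ)) < 2 * (ε / 4 + ε / 4) := by
        gcongr
        simp
    _ = ε := by
        rw [← two_mul, ← mul_assoc, mul_comm, show (2 : ℝ≥0∞) * 2 = 4 by norm_num]
        exact ENNReal.div_mul_cancel (by simp) (by simp)

variable (G) in
/-- The space `D₀` as a submodule. -/
def vanishingSubmodule : Submodule ℝ (X → ℝ) where
  carrier := G.vanishing
  zero_mem' := mem_vanishing_of_finite_support (by simp)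
  add_mem' := fun {f g} hf hg => by
    refine ⟨G.finiteEnergy.add_mem hf.1 hg.1, fun o ε hε => ?_⟩
    have hε4 : 0 < ε / 4 := ENNReal.div_pos hε.ne' (by simp)
    obtain ⟨φ, hφ, hφ2⟩ := hf.2 o _ hε4
    obtain ⟨ψ, hψ, hψ2⟩ := hg.2 o _ hε4
    refine ⟨φ + ψ, (hφ.union hψ).subset (Function.support_add _ _), ?_⟩
    rw [add_sub_add_comm]
    refine ((isQuadraticForm_normSq o).add_le _ _).trans_lt ?_
    calc 2 * (G.normSq o (f - φ) + G.normSq o (g - ψ)) < 2 * (ε / 4 + ε / 4) := by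
          gcongr
          simp
      _ = ε := by
          rw [← two_mul, ← mul_assoc, mul_comm, show (2 : ℝ≥0∞) * 2 = 4 by norm_num]
          exact ENNReal.div_mul_cancel (by simp) (by simp)
  smul_mem' := fun a f hf => by
    refine ⟨G.finiteEnergy.smul_mem a hf.1, fun o ε hε => ?_⟩
    rcases eq_or_ne a 0 with rfl | ha
    · exact ⟨0, by simp, by rw [zero_smul, sub_zero, (isQuadraticForm_normSq o).map_zero]; exact hε⟩
    have ha2 : ENNReal.ofReal (a ^ 2) ≠ 0 := by
      simp only [ne_eq, ENNReal.ofReal_eq_zero, not_le]; positivity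
    obtain ⟨φ, hφ, hφ2⟩ := hf.2 o (ε / ENNReal.ofReal (a ^ 2))
      (ENNReal.div_pos hε.ne' ENNReal.ofReal_ne_top)
    refine ⟨a • φ, hφ.subset (Function.support_const_smul_subset a φ), ?_⟩
    rw [← smul_sub, (isQuadraticForm_normSq o).smul, mul_comm]
    exact (ENNReal.lt_div_iff_mul_lt (Or.inl ha2) (Or.inl ENNReal.ofReal_ne_top)).1 hφ2

theorem exists_tendsto_of_mem_vanishing (hconn : G.Connected) [Nonempty X] {f : X → ℝ}
    (hf : f ∈ G.vanishing) :
    ∃ φ : ℕ → X → ℝ, (∀ n, (Function.support (φ n)).Finite) ∧ Tendsto φ atTop (𝓝 f) ∧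
      Tendsto (fun n => G.energy (φ n - f)) atTop (𝓝 0) := by
  let o : X := Classical.arbitrary X
  have : ∀ n : ℕ, ∃ φ : X → ℝ, (Function.support φ).Finite ∧
      G.normSq o (f - φ) < ENNReal.ofReal (1 / (n + 1)) := fun n =>
    hf.2 o _ (by simp only [ENNReal.ofReal_pos]; positivity)
  choose φ hφ hφ2 using this
  have h1 : Tendsto (fun n => G.normSq o (φ n - f)) atTop (𝓝 0) := by
    have h0 := (ENNReal.continuous_ofReal.tendsto 0).comp
      (tendsto_one_div_add_atTop_nhds_zero_nat (𝕜 := ℝ))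
    rw [ENNReal.ofReal_zero] at h0
    refine tendsto_of_tendsto_of_tendsto_of_le_of_le tendsto_const_nhds h0 (fun _ => zero_le)
      fun n => ?_
    rw [(isQuadraticForm_normSq o).sub_comm]
    exact (hφ2 n).le
  refine ⟨φ, hφ, tendsto_of_tendsto_normSq hconn o h1, ?_⟩
  exact tendsto_of_tendsto_of_tendsto_of_le_of_le tendsto_const_nhds h1 (fun _ => zero_le)
    fun n => le_self_add

/-- `D₀` is closed under pointwise convergence of sequences of bounded energy. -/
theorem mem_vanishing_of_bounded {u : ℕ → X → ℝ} {f : X → ℝ} (hu : ∀ n, u n ∈ G.vanishing)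
    {M : ℝ≥0∞} (hM : M < ∞) (hb : ∀ n, G.energy (u n) ≤ M) (h : Tendsto u atTop (𝓝 f)) :
    f ∈ G.vanishing := by
  obtain ⟨v, hv, hc, -, -⟩ := G.isQuadraticForm_energy.exists_cauchy_mem_convexHull hM hb
  have hvD : ∀ n, v n ∈ G.vanishing := fun n =>
    convexHull_min (by rintro _ ⟨k, -, rfl⟩; exact hu k)
      (G.vanishingSubmodule.convex) (hv n)
  have hvf : Tendsto v atTop (𝓝 f) := tendsto_pi_nhds.2 fun x =>
    tendsto_of_mem_convexHull (LinearMap.proj x) (tendsto_pi_nhds.1 h x) hv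
  exact mem_vanishing_of_tendsto hvD hvf (G.lowerSemicontinuous_energy.tendsto_sub hvf hc.2)

theorem map_mem_vanishing (hconn : G.Connected) [Nonempty X] {f : X → ℝ} (hf : f ∈ G.vanishing)
    {T : (X → ℝ) → X → ℝ} (hT : Continuous T)
    (hs : ∀ φ, (Function.support φ).Finite → (Function.support (T φ)).Finite) {a b : ℝ≥0∞}
    (ha : a < ∞) (hb : b < ∞) (hE : ∀ φ, G.energy (T φ) ≤ a * G.energy φ + b) :
    T f ∈ G.vanishing := by
  obtain ⟨φ, hφ, hφ1, hφ2⟩ := exists_tendsto_of_mem_vanishing hconn hf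
  obtain ⟨N, hN⟩ := eventually_atTop.1 (hφ2.eventually (Iic_mem_nhds zero_lt_one))
  have h1 : ∀ n, G.energy (φ (n + N)) ≤ 2 * (1 + G.energy f) := fun n => by
    have h2 := G.isQuadraticForm_energy.add_le (φ (n + N) - f) f
    rw [sub_add_cancel] at h2
    refine h2.trans ?_
    gcongr
    exact hN (n + N) (Nat.le_add_left _ _)
  have hfin : 2 * (1 + G.energy f) < ∞ :=
    ENNReal.mul_lt_top (by simp) (ENNReal.add_lt_top.2 ⟨by simp, hf.1⟩)
  refine mem_vanishing_of_bounded (u := fun n => T (φ (n + N))) (M := a * (2 * (1 + G.energy f)) + b)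
    (fun n => mem_vanishing_of_finite_support (hs _ (hφ _)))
    (ENNReal.add_lt_top.2 ⟨ENNReal.mul_lt_top ha hfin, hb⟩)
    (fun n => (hE _).trans (by gcongr; exact h1 n)) ?_
  exact (hT.tendsto f).comp (hφ1.comp (tendsto_add_atTop_nat N))

/-- `D₀` is an order ideal in the functions of finite energy. -/
theorem mem_vanishing_of_abs_le (hconn : G.Connected) [Nonempty X] {u f : X → ℝ}
    (hf : f ∈ G.vanishing) (hu : G.energy u < ∞) (h : ∀ x, |u x| ≤ |f x|) : u ∈ G.vanishing := by
  have h1 : (fun x => clamp |f x| (u x)) = u := funext fun x => clamp_of_abs_le (h x)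
  rw [← h1]
  refine map_mem_vanishing hconn hf (T := fun φ x => clamp |φ x| (u x)) (a := ENNReal.ofReal 2)
    (b := ENNReal.ofReal 2 * G.energy u) ?_ (fun φ hφ => hφ.subset fun x hx => ?_) (by simp)
    (ENNReal.mul_lt_top (by simp) hu) fun φ => ?_
  · unfold clamp; fun_prop
  · contrapose hx
    rw [Function.mem_support, not_not] at hx ⊢
    simp only [hx, abs_zero]
    have := abs_clamp_le (le_refl 0) (u x)
    exact abs_nonpos_iff.1 this
  · refine G.energy_le_of_grad_sq_le (by norm_num) (by norm_num) fun i => ?_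
    rcases i with ⟨x, y⟩ | x
    · simp only [grad, Sum.elim_inl]
      have h2 := abs_clamp_sub_le |φ x| |φ y| (u x) (u y)
      have h3 := abs_abs_sub_abs_le (φ x) (φ y)
      rw [← sq_abs, ← sq_abs (φ x - φ y), ← sq_abs (u x - u y)]
      nlinarith [abs_nonneg (clamp |φ x| (u x) - clamp |φ y| (u y)), abs_nonneg (u x - u y),
        sq_nonneg (|u x - u y| - |φ x - φ y|)]
    · simp only [grad, Sum.elim_inr]
      have h2 := abs_clamp_le (abs_nonneg (φ x)) (u x)
      have := sq_le_sq.2 (h2.trans (le_abs_self _))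
      rw [sq_abs] at this
      nlinarith [sq_nonneg (u x), sq_nonneg (φ x)]

/-- The bounded functions in `D₀` form an ideal in the bounded functions of finite energy. -/
theorem mul_mem_vanishing (hconn : G.Connected) [Nonempty X] {f g : X → ℝ} (hf : f ∈ G.vanishing)
    (hg : G.energy g < ∞) {M N : ℝ} (hM : ∀ x, |f x| ≤ M) (hN : ∀ x, |g x| ≤ N) :
    f * g ∈ G.vanishing := by
  have hM0 : 0 ≤ M := (abs_nonneg _).trans (hM (Classical.arbitrary X))
  have h1 : (fun x => clamp M (f x) * g x) = f * g :=
    funext fun x => by rw [clamp_of_abs_le (hM x), Pi.mul_apply]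
  rw [← h1]
  refine map_mem_vanishing hconn hf (T := fun φ x => clamp M (φ x) * g x)
    (a := ENNReal.ofReal (2 * N ^ 2))
    (b := ENNReal.ofReal (2 * M ^ 2) * G.energy g) ?_ (fun φ hφ => hφ.subset fun x hx => ?_)
    ENNReal.ofReal_lt_top (ENNReal.mul_lt_top ENNReal.ofReal_lt_top hg) fun φ => ?_
  · unfold clamp; fun_prop
  · contrapose hx
    rw [Function.mem_support, not_not] at hx ⊢
    rw [hx, clamp_zero hM0, zero_mul]
  · refine (G.energy_mul_le (f := clamp M ∘ φ) (fun x => abs_clamp_le hM0 _) hN).trans ?_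
    gcongr
    exact G.energy_comp_le (isNormalContraction_clamp hM0) φ

/-! ### Transience and the Royden decomposition -/

/-- On a transient graph the energy alone controls the point evaluations on `D₀`: otherwise there are
functions in `D₀` with value one at `o` and energy tending to zero, and their limit contradicts
transience. -/
theorem exists_sq_le_energy (hconn : G.Connected) (htrans : G.Transient) (o : X) :
    ∃ K : ℝ, 0 < K ∧ ∀ f ∈ G.vanishing, f o ^ 2 ≤ K * (G.energy f).toReal := by
  by_contra! hcon
  have h1 : ∀ n : ℕ, ∃ f ∈ G.vanishing, f o = 1 ∧ (G.energy f).toReal < 1 / (n + 1) := fun n => by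
    obtain ⟨f, hf, hfo⟩ := hcon (n + 1) (by positivity)
    have h2 : 0 < f o ^ 2 := lt_of_le_of_lt (by positivity) hfo
    have h0 : f o ≠ 0 := fun h => by simp [h] at h2
    refine ⟨(f o)⁻¹ • f, G.vanishingSubmodule.smul_mem _ hf, by simp [h0], ?_⟩
    rw [G.energy_smul, ENNReal.toReal_mul, ENNReal.toReal_ofReal (sq_nonneg _), inv_pow,
      inv_mul_lt_iff₀ h2, mul_one_div, lt_div_iff₀ (by positivity)]
    linarith
  choose f hf hfo hfe using h1
  have hft : Tendsto (fun n => G.energy (f n)) atTop (𝓝 0) := by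
    have h0 := (ENNReal.continuous_ofReal.tendsto 0).comp
      (tendsto_one_div_add_atTop_nhds_zero_nat (𝕜 := ℝ))
    rw [ENNReal.ofReal_zero] at h0
    refine tendsto_of_tendsto_of_tendsto_of_le_of_le tendsto_const_nhds h0 (fun _ => zero_le)
      fun n => ?_
    rw [← ENNReal.ofReal_toReal (ne_of_lt (hf n).1)]
    exact ENNReal.ofReal_le_ofReal (hfe n).le
  have hc : IsFormCauchy G.energy f := by
    refine ⟨fun n => (hf n).1, ?_⟩
    have h2 : Tendsto (fun p : ℕ × ℕ => 2 * (G.energy (f p.1) + G.energy (f p.2))) atTop (𝓝 0) := by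
      rw [← prod_atTop_atTop_eq]
      have := ENNReal.Tendsto.const_mul (a := 2)
        ((hft.comp (tendsto_fst (g := atTop (α := ℕ)))).add
          (hft.comp (tendsto_snd (f := atTop (α := ℕ))))) (Or.inr (by simp))
      simpa using this
    exact tendsto_of_tendsto_of_tendsto_of_le_of_le tendsto_const_nhds h2 (fun _ => zero_le)
      fun p => G.isQuadraticForm_energy.sub_le _ _
  obtain ⟨g, hg1, hg2⟩ := exists_tendsto_of_cauchy hconn o hc (by simp [hfo])
  have hg0 : G.energy g = 0 := by
    refine le_antisymm (ENNReal.le_of_forall_pos_le_add fun ε hε _ => ?_) zero_le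
    refine G.lowerSemicontinuous_energy.le_of_tendsto hg1 ?_
    rw [zero_add]
    exact hft.eventually (Iic_mem_nhds (by simpa using hε))
  have h3 := htrans g (mem_vanishing_of_tendsto hf hg1 hg2) hg0
  have h4 := tendsto_nhds_unique (tendsto_pi_nhds.1 hg1 o)
    (by simp only [hfo]; exact tendsto_const_nhds (x := (1 : ℝ)))
  rw [h3] at h4
  simp at h4

theorem eq_zero_of_energyForm_self (htrans : G.Transient) {f : X → ℝ} (hf : f ∈ G.vanishing)
    (h : G.energyForm f f = 0) : f = 0 := by
  refine htrans f hf ?_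
  rw [← toReal_energy, ENNReal.toReal_eq_zero_iff] at h
  exact h.resolve_right (ne_of_lt hf.1)

variable (G) in
/-- `h` is the harmonic part of `f` in the Royden decomposition: it is orthogonal to `D₀` and
differs from `f` by an element of `D₀`. -/
structure IsHarmonicPart (f h : X → ℝ) : Prop where
  energy_lt_top : G.energy h < ∞
  sub_mem : f - h ∈ G.vanishing
  orthogonal : ∀ v ∈ G.vanishing, G.energyForm h v = 0

/-- Energy minimizing elements of a set of functions which differ by elements of `D₀` exist, and
they are orthogonal to the directions in `D₀` along which the set is invariant. -/
theorem exists_minimizer (hconn : G.Connected) (htrans : G.Transient) [Nonempty X]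
    {S : Set (X → ℝ)} {W : Set (X → ℝ)} (hS : S.Nonempty) (hc : Convex ℝ S)
    (hfin : ∀ u ∈ S, G.energy u < ∞) (hsub : ∀ u ∈ S, ∀ v ∈ S, u - v ∈ G.vanishing)
    (hcl : ∀ (u : ℕ → X → ℝ) f, (∀ n, u n ∈ S) → Tendsto u atTop (𝓝 f) →
      Tendsto (fun n => G.energy (u n - f)) atTop (𝓝 0) → f ∈ S)
    (hW : ∀ v ∈ W, G.energy v < ∞ ∧ ∀ u ∈ S, ∀ t : ℝ, u + t • v ∈ S) :
    ∃ h ∈ S, (∀ u ∈ S, G.energy h ≤ G.energy u) ∧ ∀ v ∈ W, G.energyForm h v = 0 := by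
  obtain ⟨w, hw⟩ := hS
  let o : X := Classical.arbitrary X
  obtain ⟨u, hu, hcu, hlim⟩ := G.isQuadraticForm_energy.exists_cauchy_mem (K := fun _ => S)
    (fun _ _ _ => le_rfl) (fun _ => hc) (hfin w hw) fun _ => ⟨w, hw, le_rfl⟩
  obtain ⟨K, -, hK⟩ := exists_sq_le_energy hconn htrans o
  have ho : Tendsto (fun p : ℕ × ℕ => u p.1 o - u p.2 o) atTop (𝓝 0) := by
    have h1 := ((ENNReal.tendsto_toReal ENNReal.zero_ne_top).comp hcu.2).const_mul K
    rw [ENNReal.toReal_zero, mul_zero] at h1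
    have h2 : Tendsto (fun p : ℕ × ℕ => (u p.1 o - u p.2 o) ^ 2) atTop (𝓝 0) :=
      squeeze_zero (fun _ => sq_nonneg _) (fun p => hK _ (hsub _ (hu p.1) _ (hu p.2))) h1
    have h3 := (ENNReal.continuous_ofReal.tendsto _).comp h2
    rw [ENNReal.ofReal_zero] at h3
    exact tendsto_of_tendsto_ofReal_sq h3
  obtain ⟨h, hh1, hh2⟩ := exists_tendsto_of_cauchy hconn o hcu ho
  have hhS := hcl u h hu hh1 hh2
  have hmin : ∀ v ∈ S, G.energy h ≤ G.energy v := fun v hv => by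
    have h1 := G.isQuadraticForm_energy.tendsto_of_tendsto_sub hcu.1 (fun _ => hfin h hhS) hh2
      (lt_of_le_of_lt (iSup_le fun n => iInf₂_le (f := fun u _ => G.energy u) w hw)
        (hfin w hw)) hlim
    rw [tendsto_nhds_unique (tendsto_const_nhds (x := G.energy h)) h1]
    exact iSup_le fun n => iInf₂_le v hv
  refine ⟨h, hhS, hmin, fun v hv => ?_⟩
  refine eq_zero_of_forall_nonneg_quadratic (c := (G.energy v).toReal) fun t => ?_
  have h1 := energy_add_smul_toReal (hfin h hhS) (hW v hv).1 t
  have h2 := ENNReal.toReal_mono (hfin _ ((hW v hv).2 h hhS t)).ne (hmin _ ((hW v hv).2 h hhS t))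
  linarith

/-- The Royden decomposition. -/
theorem exists_isHarmonicPart (hconn : G.Connected) (htrans : G.Transient) [Nonempty X]
    {f : X → ℝ} (hf : G.energy f < ∞) :
    ∃ h, G.IsHarmonicPart f h ∧ ∀ u, f - u ∈ G.vanishing → G.energy h ≤ G.energy u := by
  let V := G.vanishingSubmodule
  have hc : Convex ℝ {u | f - u ∈ V} := by
    intro u hu v hv a b ha hb hab
    simp only [Set.mem_ofPred_eq] at hu hv ⊢
    have := V.add_mem (V.smul_mem a hu) (V.smul_mem b hv)
    convert this using 1
    rw [smul_sub, smul_sub, show a • f - a • u + (b • f - b • v) =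
      (a + b) • f - (a • u + b • v) by rw [add_smul]; abel, hab, one_smul]
  have hfin : ∀ u ∈ {u | f - u ∈ V}, G.energy u < ∞ := by
    intro u hu
    have := G.isQuadraticForm_energy.sub_lt_top hf hu.1
    rwa [sub_sub_cancel] at this
  have hsub : ∀ u ∈ {u | f - u ∈ V}, ∀ v ∈ {u | f - u ∈ V}, u - v ∈ G.vanishing := by
    intro u hu v hv
    have := V.sub_mem hv hu
    rwa [sub_sub_sub_cancel_left] at this
  obtain ⟨h, hh, hmin, ho⟩ := exists_minimizer hconn htrans (W := G.vanishing)
    ⟨f, by simp [V]⟩ hc hfin hsub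
    (fun u g hu h1 h2 => mem_vanishing_of_tendsto hu (h1.const_sub f) (h2.congr fun n => by
      rw [← G.isQuadraticForm_energy.neg]
      congr 1
      abel))
    (fun v hv => ⟨hv.1, fun u hu t => by
      simp only [Set.mem_ofPred_eq] at hu ⊢
      rw [← sub_sub]
      exact V.sub_mem hu (V.smul_mem t hv)⟩)
  exact ⟨h, ⟨(hmin f (by simp [V])).trans_lt hf, hh, ho⟩, hmin⟩

namespace IsHarmonicPart

theorem of_mem_vanishing {f : X → ℝ} (hf : f ∈ G.vanishing) : G.IsHarmonicPart f 0 where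
  energy_lt_top := by simp [G.isQuadraticForm_energy.map_zero]
  sub_mem := by rwa [sub_zero]
  orthogonal := fun v _ => by
    have := energyForm_smul_left (G := G) 0 0 v
    simpa using this

theorem self {h : X → ℝ} (hh : G.energy h < ∞) (ho : ∀ v ∈ G.vanishing, G.energyForm h v = 0) :
    G.IsHarmonicPart h h where
  energy_lt_top := hh
  sub_mem := by rw [sub_self]; exact G.vanishingSubmodule.zero_mem
  orthogonal := ho

theorem add {f g h k : X → ℝ} (h1 : G.IsHarmonicPart f h) (h2 : G.IsHarmonicPart g k) :
    G.IsHarmonicPart (f + g) (h + k) where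
  energy_lt_top := G.isQuadraticForm_energy.add_lt_top h1.energy_lt_top h2.energy_lt_top
  sub_mem := by
    rw [add_sub_add_comm]
    exact G.vanishingSubmodule.add_mem h1.sub_mem h2.sub_mem
  orthogonal := fun v hv => by
    rw [energyForm_add_left h1.energy_lt_top h2.energy_lt_top hv.1, h1.orthogonal v hv,
      h2.orthogonal v hv, add_zero]

theorem smul (a : ℝ) {f h : X → ℝ} (h1 : G.IsHarmonicPart f h) :
    G.IsHarmonicPart (a • f) (a • h) where
  energy_lt_top := G.isQuadraticForm_energy.smul_lt_top a h1.energy_lt_top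
  sub_mem := by
    rw [← smul_sub]
    exact G.vanishingSubmodule.smul_mem a h1.sub_mem
  orthogonal := fun v hv => by
    rw [energyForm_smul_left, h1.orthogonal v hv, mul_zero]

theorem energy_eq_add {f h : X → ℝ} (h1 : G.IsHarmonicPart f h) :
    (G.energy f).toReal = (G.energy h).toReal + (G.energy (f - h)).toReal := by
  have := energy_add_smul_toReal h1.energy_lt_top h1.sub_mem.1 1
  rw [h1.orthogonal _ h1.sub_mem, one_smul, add_sub_cancel] at this
  linarith

/-- The harmonic part of a bounded function satisfies the same bound: truncating the harmonic part
does not increase the energy and changes it by an element of `D₀` only. -/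
theorem abs_le (hconn : G.Connected) (htrans : G.Transient) [Nonempty X] {f h : X → ℝ}
    (h1 : G.IsHarmonicPart f h) {M : ℝ} (hM : ∀ x, |f x| ≤ M) (x : X) : |h x| ≤ M := by
  have hM0 : 0 ≤ M := (abs_nonneg _).trans (hM x)
  have hle := G.energy_comp_le (isNormalContraction_clamp hM0) h
  have hv : clamp M ∘ h - h ∈ G.vanishing := by
    refine mem_vanishing_of_abs_le hconn h1.sub_mem
      (G.isQuadraticForm_energy.sub_lt_top (hle.trans_lt h1.energy_lt_top) h1.energy_lt_top)
      fun y => ?_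
    have hy := _root_.abs_le.1 (hM y)
    simp only [Pi.sub_apply, Function.comp_apply, clamp]
    rcases le_total (h y) M with h2 | h2
    · rw [min_eq_left h2]
      rcases le_total (-M) (h y) with h3 | h3
      · rw [max_eq_left h3]; simp
      · rw [max_eq_right h3, abs_of_nonneg (by linarith), abs_of_nonneg (by linarith)]; linarith
    · rw [min_eq_right h2, max_eq_left (by linarith), abs_of_nonpos (by linarith),
        abs_of_nonpos (by linarith)]; linarith
  have h3 := energy_add_smul_toReal h1.energy_lt_top hv.1 1
  rw [h1.orthogonal _ hv, one_smul, add_sub_cancel] at h3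
  have h4 := ENNReal.toReal_mono h1.energy_lt_top.ne hle
  have h5 : G.energyForm (clamp M ∘ h - h) (clamp M ∘ h - h) = 0 := by
    rw [← toReal_energy]
    have : 0 ≤ (G.energy (clamp M ∘ h - h)).toReal := ENNReal.toReal_nonneg
    linarith
  have h6 := congrFun (eq_zero_of_energyForm_self htrans hv h5) x
  simp only [Pi.sub_apply, Function.comp_apply, Pi.zero_apply, sub_eq_zero] at h6
  rw [← h6]
  exact abs_clamp_le hM0 _

end IsHarmonicPart

/-! ### Harmonic functions of finite energy -/

theorem energyForm_eq_zero_of_finite_support {h φ : X → ℝ} (hh : G.energy h < ∞)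
    (hl : ∀ x, G.laplacian h x = 0) (hφ : (Function.support φ).Finite) :
    G.energyForm h φ = 0 := by
  classical
  have key : ∀ s : Finset X, G.energy (∑ x ∈ s, φ x • (Pi.single x (1 : ℝ) : X → ℝ)) < ∞ ∧
      G.energyForm h (∑ x ∈ s, φ x • (Pi.single x (1 : ℝ) : X → ℝ)) = 0 := fun s => by
    induction s using Finset.induction_on with
    | empty =>
      refine ⟨by simp [G.isQuadraticForm_energy.map_zero], ?_⟩
      simpa using energyForm_smul_right (G := G) 0 h 0
    | insert x s hx ih =>
      have h1 : G.energy (φ x • (Pi.single x (1 : ℝ) : X → ℝ)) < ∞ :=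
        G.isQuadraticForm_energy.smul_lt_top _ (energy_single_lt_top x)
      rw [Finset.sum_insert hx]
      refine ⟨G.isQuadraticForm_energy.add_lt_top h1 ih.1, ?_⟩
      rw [energyForm_add_right hh h1 ih.1, ih.2, energyForm_smul_right, energyForm_single hh, hl x]
      simp
  have h1 : φ = ∑ x ∈ hφ.toFinset, φ x • Pi.single x (1 : ℝ) := by
    ext y
    simp only [Finset.sum_apply, Pi.smul_apply, smul_eq_mul, Pi.single_apply, mul_ite, mul_one,
      mul_zero, Finset.sum_ite_eq, Set.Finite.mem_toFinset, Function.mem_support]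
    split_ifs with h2
    · rfl
    · exact not_not.1 h2
  rw [h1]
  exact (key _).2

/-- A function of finite energy is harmonic if and only if it is orthogonal to `D₀`. -/
theorem isHarmonic_iff (hconn : G.Connected) [Nonempty X] {h : X → ℝ} (hh : G.energy h < ∞) :
    G.IsHarmonic h ↔ ∀ v ∈ G.vanishing, G.energyForm h v = 0 := by
  classical
  constructor
  · intro hl v hv
    obtain ⟨φ, hφ, -, hφ2⟩ := exists_tendsto_of_mem_vanishing hconn hv
    have h1 := tendsto_energyForm (fun n => energy_lt_top_of_finite_support (hφ n)) hv.1 hh hφ2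
    simp only [energyForm_eq_zero_of_finite_support hh hl.2 (hφ _)] at h1
    exact tendsto_nhds_unique h1 tendsto_const_nhds
  · intro ho
    refine ⟨summable_b_mul_abs hh, fun x => ?_⟩
    rw [← energyForm_single hh]
    refine ho _ (mem_vanishing_of_finite_support ((Set.finite_singleton x).subset fun y hy => ?_))
    by_contra hxy
    simp [show y ≠ x from hxy] at hy

/-- The Harnack inequality for nonnegative harmonic functions. -/
theorem exists_harnack (hconn : G.Connected) (x z : X) :
    ∃ K : ℝ, 0 ≤ K ∧ ∀ h : X → ℝ, G.IsHarmonic h → G.energy h < ∞ → (∀ y, 0 ≤ h y) →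
      h x ≤ K * h z := by
  induction hconn z x with
  | refl => exact ⟨1, zero_le_one, fun h _ _ _ => by simp⟩
  | @tail y x _ hyx ih =>
    obtain ⟨K, hK0, hK⟩ := ih
    have hd : 0 ≤ (∑' w, G.b y w) + G.c y :=
      add_nonneg (tsum_nonneg fun w => G.b_nonneg y w) (G.c_nonneg y)
    refine ⟨((∑' w, G.b y w) + G.c y) / G.b y x * K,
      mul_nonneg (div_nonneg hd hyx.le) hK0, fun h hh hf h0 => ?_⟩
    have h1 := hh.2 y
    have hs : Summable fun w => G.b y w * h w :=
      (hh.1 y).congr fun w => by rw [abs_of_nonneg (h0 w)]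
    have h2 : (∑' w, G.b y w * (h y - h w)) = (∑' w, G.b y w) * h y - ∑' w, G.b y w * h w := by
      rw [← tsum_mul_right, ← ((G.b_summable y).mul_right (h y)).tsum_sub hs]
      refine tsum_congr fun w => ?_
      ring
    have h3 : G.b y x * h x ≤ ∑' w, G.b y w * h w :=
      hs.le_tsum x fun w _ => mul_nonneg (G.b_nonneg y w) (h0 w)
    rw [laplacian, h2] at h1
    -- harmonicity at `y` bounds the value at a neighbour `x` by the value at `y`
    have h4 : h x ≤ ((∑' w, G.b y w) + G.c y) / G.b y x * h y := by
      rw [div_mul_eq_mul_div, le_div_iff₀ hyx]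
      linarith
    refine h4.trans ?_
    rw [mul_assoc]
    exact mul_le_mul_of_nonneg_left (hK h hh hf h0) (div_nonneg hd hyx.le)

/-! ### Equilibrium potentials and squares of harmonic functions -/

/-- The equilibrium potential of a vertex. Up to a positive factor it represents the point
evaluation on `D₀`. -/
theorem exists_equilibrium (hconn : G.Connected) (htrans : G.Transient) (z : X) :
    ∃ e ∈ G.vanishing, (∀ x, 0 ≤ e x ∧ e x ≤ 1) ∧
      ∃ κ : ℝ, 0 < κ ∧ ∀ v ∈ G.vanishing, G.energyForm e v = κ * v z := by
  classical
  have : Nonempty X := ⟨z⟩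
  let V := G.vanishingSubmodule
  have hz : (Pi.single z 1 : X → ℝ) ∈ G.vanishing :=
    mem_vanishing_of_finite_support ((Set.finite_singleton z).subset fun y hy => by
      by_contra hxy
      simp [show y ≠ z from hxy] at hy)
  have hc : Convex ℝ {u | u ∈ V ∧ u z = 1} := by
    intro u hu v hv a b ha hb hab
    refine ⟨V.add_mem (V.smul_mem a hu.1) (V.smul_mem b hv.1), ?_⟩
    simp [hu.2, hv.2, hab]
  have hcl : ∀ (u : ℕ → X → ℝ) f, (∀ n, u n ∈ {u | u ∈ V ∧ u z = 1}) → Tendsto u atTop (𝓝 f) →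
      Tendsto (fun n => G.energy (u n - f)) atTop (𝓝 0) → f ∈ {u | u ∈ V ∧ u z = 1} := by
    intro u f hu h1 h2
    refine ⟨mem_vanishing_of_tendsto (fun n => (hu n).1) h1 h2, ?_⟩
    refine tendsto_nhds_unique (tendsto_pi_nhds.1 h1 z) ?_
    simp only [(hu _).2]
    exact tendsto_const_nhds
  obtain ⟨e₀, he₀, hmin, -⟩ := exists_minimizer hconn htrans (S := {u | u ∈ V ∧ u z = 1}) (W := ∅)
    ⟨_, hz, by simp⟩ hc
    (fun u hu => hu.1.1) (fun u hu v hv => V.sub_mem hu.1 hv.1) hcl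
    (fun v hv => absurd hv (Set.notMem_empty v))
  -- truncating a minimizer yields a minimizer with values in `[0, 1]`
  let C : ℝ → ℝ := fun r => max (min r 1) 0
  have hC : IsNormalContraction C := by
    have hL : ∀ r s, |C r - C s| ≤ |r - s| := fun r s => by
      refine (abs_max_sub_max_le_abs _ _ _).trans ?_
      have := abs_min_sub_min_le_max r 1 s 1
      rw [sub_self, abs_zero, max_eq_left (abs_nonneg _)] at this
      exact this
    exact ⟨fun r => by simpa [C] using hL r 0, hL⟩
  have heE : G.energy (C ∘ e₀) < ∞ := (G.energy_comp_le hC e₀).trans_lt he₀.1.1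
  have heV : C ∘ e₀ ∈ G.vanishing := mem_vanishing_of_abs_le hconn he₀.1 heE fun x => hC.1 _
  have hez : (C ∘ e₀) z = 1 := by simp [C, he₀.2]
  have hmin' : ∀ u ∈ V, u z = 1 → G.energy (C ∘ e₀) ≤ G.energy u := fun u hu huz =>
    (G.energy_comp_le hC e₀).trans (hmin u ⟨hu, huz⟩)
  set e := C ∘ e₀
  -- by minimality `e` is orthogonal to the functions in `D₀` which vanish at `z`
  have horth : ∀ v ∈ G.vanishing, v z = 0 → G.energyForm e v = 0 := fun v hv hvz => by
    refine eq_zero_of_forall_nonneg_quadratic (c := (G.energy v).toReal) fun t => ?_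
    have h1 := energy_add_smul_toReal heE hv.1 t
    have h3 : e + t • v ∈ V := V.add_mem heV (V.smul_mem t hv)
    have h2 := ENNReal.toReal_mono (ne_of_lt h3.1) (hmin' _ h3 (by simp [hez, hvz]))
    linarith
  refine ⟨e, heV, fun x => ⟨le_max_right _ _, max_le (min_le_right _ _) zero_le_one⟩,
    G.energyForm e e, ?_, fun v hv => ?_⟩
  · refine lt_of_le_of_ne (toReal_energy (G := G) (f := e) ▸ ENNReal.toReal_nonneg) fun h => ?_
    have := eq_zero_of_energyForm_self htrans heV h.symm
    rw [this] at hez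
    simp at hez
  · have h1 := horth (v - v z • e) (V.sub_mem hv (V.smul_mem _ heV)) (by simp [hez])
    rw [energyForm_sub_right heE hv.1 (V.smul_mem _ heV).1, energyForm_smul_right] at h1
    linarith

/-- The harmonic part of the square of a bounded harmonic function is controlled by the norm
`‖·‖_z`. This follows from the Leibniz type inequality
`∇(e h) ∇h ≤ ½ ∇e ∇(h²) + (∇h)²`, where `e` is the equilibrium potential of `z`. -/
theorem exists_harmonicPart_sq_le (hconn : G.Connected) (htrans : G.Transient) (z : X) :
    ∃ K : ℝ, 0 ≤ K ∧ ∀ h k : X → ℝ, G.energy h < ∞ → (∀ v ∈ G.vanishing, G.energyForm h v = 0) →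
      (∃ M, ∀ x, |h x| ≤ M) → G.IsHarmonicPart (h * h) k →
      k z ≤ h z ^ 2 + K * (G.energy h).toReal := by
  have : Nonempty X := ⟨z⟩
  obtain ⟨e, he, he01, κ, hκ, hrep⟩ := exists_equilibrium hconn htrans z
  refine ⟨2 / κ, by positivity, fun h k hh ho ⟨M, hM⟩ hk => ?_⟩
  have heb : ∀ x, |e x| ≤ 1 := fun x => _root_.abs_le.2 ⟨by linarith [(he01 x).1], (he01 x).2⟩
  have heh := mul_mem_vanishing hconn he hh heb hM
  have hhh : G.energy (h * h) < ∞ := (G.energy_mul_le hM hM).trans_lt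
    (ENNReal.add_lt_top.2 ⟨ENNReal.mul_lt_top ENNReal.ofReal_lt_top hh,
      ENNReal.mul_lt_top ENNReal.ofReal_lt_top hh⟩)
  have h1 : G.energyForm (e * h) h ≤ 1 / 2 * G.energyForm e (h * h) + G.energyForm h h := by
    rw [energyForm, energyForm, energyForm, ← tsum_mul_left,
      ← ((summable_grad_mul he.1 hhh).mul_left _).tsum_add (summable_grad_mul hh hh)]
    refine (summable_grad_mul heh.1 hh).tsum_le_tsum (fun i => ?_)
      (((summable_grad_mul he.1 hhh).mul_left _).add (summable_grad_mul hh hh))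
    rw [mul_left_comm (1 / 2 : ℝ), ← mul_add]
    refine mul_le_mul_of_nonneg_left ?_ (G.gradWeight_nonneg i)
    rcases i with ⟨x, y⟩ | x
    · simp only [grad, Sum.elim_inl, Pi.mul_apply]
      nlinarith [mul_nonneg (sub_nonneg.2 (he01 x).2) (sq_nonneg (h x - h y)),
        mul_nonneg (sub_nonneg.2 (he01 y).2) (sq_nonneg (h x - h y))]
    · simp only [grad, Sum.elim_inr, Pi.mul_apply]
      nlinarith [mul_nonneg (sub_nonneg.2 (he01 x).2) (sq_nonneg (h x)), sq_nonneg (h x)]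
  rw [energyForm_comm, ho _ heh, ← toReal_energy] at h1
  have h2 := hrep _ hk.sub_mem
  rw [energyForm_sub_right he.1 hhh hk.energy_lt_top, energyForm_comm e k, hk.orthogonal e he,
    sub_zero] at h2
  simp only [Pi.sub_apply, Pi.mul_apply] at h2
  have h3 : κ * (k z - h z ^ 2) ≤ 2 * (G.energy h).toReal := by nlinarith
  have h4 : k z - h z ^ 2 ≤ 2 / κ * (G.energy h).toReal := by
    rw [div_mul_eq_mul_div, le_div_iff₀ hκ]
    linarith
  linarith

end WeightedGraph

namespace WeightedGraph

variable {X : Type*} {G : WeightedGraph X}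

/-! ### The Royden algebra -/

theorem mem_uniformClosure_of_bounded {f : X → ℝ} (hf : f ∈ G.finiteEnergy)
    (hb : ∃ M : ℝ, ∀ x, |f x| ≤ M) : f ∈ G.uniformClosure :=
  fun ε hε => ⟨f, hf, hb, fun x => by simpa using hε.le⟩

theorem uniformClosure_add {f g : X → ℝ} (hf : f ∈ G.uniformClosure) (hg : g ∈ G.uniformClosure) :
    f + g ∈ G.uniformClosure := fun ε hε => by
  obtain ⟨u, hu, ⟨M, hM⟩, hfu⟩ := hf (ε / 2) (half_pos hε)
  obtain ⟨v, hv, ⟨N, hN⟩, hgv⟩ := hg (ε / 2) (half_pos hε)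
  refine ⟨u + v, G.finiteEnergy.add_mem hu hv,
    ⟨M + N, fun x => (abs_add_le _ _).trans (add_le_add (hM x) (hN x))⟩, fun x => ?_⟩
  have := abs_add_le (f x - u x) (g x - v x)
  simp only [Pi.add_apply, add_sub_add_comm]
  linarith [hfu x, hgv x]

theorem uniformClosure_smul (a : ℝ) {f : X → ℝ} (hf : f ∈ G.uniformClosure) :
    a • f ∈ G.uniformClosure := fun ε hε => by
  obtain ⟨u, hu, ⟨M, hM⟩, hfu⟩ := hf (ε / (|a| + 1)) (by positivity)
  refine ⟨a • u, G.finiteEnergy.smul_mem a hu, ⟨|a| * M, fun x => ?_⟩, fun x => ?_⟩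
  · simp only [Pi.smul_apply, smul_eq_mul, abs_mul]
    exact mul_le_mul_of_nonneg_left (hM x) (abs_nonneg a)
  · simp only [Pi.smul_apply, smul_eq_mul, ← mul_sub, abs_mul]
    have h1 := hfu x
    rw [le_div_iff₀ (by positivity)] at h1
    nlinarith [abs_nonneg (f x - u x)]

theorem uniformClosure_mul {f g : X → ℝ} (hf : f ∈ G.uniformClosure) (hg : g ∈ G.uniformClosure) :
    f * g ∈ G.uniformClosure := fun ε hε => by
  obtain ⟨u₀, -, ⟨M, hM⟩, hfu₀⟩ := hf 1 one_pos
  have hMf : ∀ x, |f x| ≤ |M| + 1 := fun x => by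
    have := abs_add_le (f x - u₀ x) (u₀ x)
    rw [sub_add_cancel] at this
    linarith [hfu₀ x, hM x, le_abs_self M]
  obtain ⟨v, hv, ⟨N, hN⟩, hgv⟩ := hg (ε / (2 * (|M| + 1))) (by positivity)
  have hN' : ∀ x, |v x| ≤ |N| := fun x => (hN x).trans (le_abs_self N)
  obtain ⟨u, hu, ⟨M', hM'⟩, hfu⟩ := hf (ε / (2 * (|N| + 1))) (by positivity)
  refine ⟨u * v, (G.energy_mul_le hM' hN).trans_lt (ENNReal.add_lt_top.2
    ⟨ENNReal.mul_lt_top ENNReal.ofReal_lt_top hu, ENNReal.mul_lt_top ENNReal.ofReal_lt_top hv⟩),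
    ⟨M' * N, fun x => ?_⟩, fun x => ?_⟩
  · rw [Pi.mul_apply, abs_mul]
    exact mul_le_mul (hM' x) (hN x) (abs_nonneg _) ((abs_nonneg _).trans (hM' x))
  · have h1 := hgv x
    have h2 := hfu x
    rw [le_div_iff₀ (by positivity)] at h1 h2
    have h3 := abs_add_le (f x * (g x - v x)) ((f x - u x) * v x)
    rw [abs_mul, abs_mul] at h3
    simp only [Pi.mul_apply]
    rw [show f x * g x - u x * v x = f x * (g x - v x) + (f x - u x) * v x by ring]
    nlinarith [abs_nonneg (g x - v x), abs_nonneg (f x - u x), hMf x, hN' x, abs_nonneg N]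

theorem mem_roydenAlgebra_of_mem_uniformClosure {f : X → ℝ} (hf : f ∈ G.uniformClosure) :
    f ∈ G.roydenAlgebra :=
  Algebra.subset_adjoin hf

/-- `𝒜⁺ = 𝒜 + ℝ`. -/
theorem exists_eq_add_const {f : X → ℝ} (hf : f ∈ G.roydenAlgebra) :
    ∃ a ∈ G.uniformClosure, ∃ r : ℝ, ∀ x, f x = a x + r := by
  have h0 : (0 : X → ℝ) ∈ G.uniformClosure :=
    mem_uniformClosure_of_bounded G.finiteEnergy.zero_mem ⟨0, by simp⟩
  induction hf using Algebra.adjoin_induction with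
  | mem f hf => exact ⟨f, hf, 0, by simp⟩
  | algebraMap r => exact ⟨0, h0, r, by simp⟩
  | add f g _ _ hf hg =>
    obtain ⟨a, ha, r, har⟩ := hf
    obtain ⟨b, hb, s, hbs⟩ := hg
    exact ⟨a + b, uniformClosure_add ha hb, r + s, fun x => by
      simp only [Pi.add_apply, har, hbs]; ring⟩
  | mul f g _ _ hf hg =>
    obtain ⟨a, ha, r, har⟩ := hf
    obtain ⟨b, hb, s, hbs⟩ := hg
    refine ⟨a * b + (s • a + r • b), uniformClosure_add (uniformClosure_mul ha hb)
      (uniformClosure_add (uniformClosure_smul s ha) (uniformClosure_smul r hb)), r * s,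
      fun x => ?_⟩
    simp only [Pi.add_apply, Pi.mul_apply, Pi.smul_apply, smul_eq_mul, har, hbs]
    ring

/-- `𝒜⁺` is closed under composition with Lipschitz functions. -/
theorem comp_mem_roydenAlgebra {f : X → ℝ} (hf : f ∈ G.roydenAlgebra) {F : ℝ → ℝ} {L : ℝ}
    (hL : 0 < L) (hF : ∀ s t, |F s - F t| ≤ L * |s - t|) : F ∘ f ∈ G.roydenAlgebra := by
  obtain ⟨a, ha, r, har⟩ := exists_eq_add_const hf
  have h1 : (fun x => F (a x + r) - F r) ∈ G.uniformClosure := fun ε hε => by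
    obtain ⟨g, hg, ⟨M, hM⟩, hag⟩ := ha (ε / L) (div_pos hε hL)
    have h2 : ∀ x, |F (g x + r) - F r| ≤ L * |g x| := fun x => by simpa using hF (g x + r) r
    refine ⟨fun x => F (g x + r) - F r, ?_, ⟨L * M, fun x => (h2 x).trans
      (mul_le_mul_of_nonneg_left (hM x) hL.le)⟩, fun x => ?_⟩
    · refine (G.energy_le_of_lipschitz (g := L • g) (fun x y => ?_) fun x => ?_).trans_lt
        (G.finiteEnergy.smul_mem L hg)
      · simp only [sub_sub_sub_cancel_right, Pi.smul_apply, smul_eq_mul, ← mul_sub]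
        rw [abs_mul, abs_of_pos hL]
        simpa using hF (g x + r) (g y + r)
      · simp only [Pi.smul_apply, smul_eq_mul, abs_mul, abs_of_pos hL]
        exact h2 x
    · rw [sub_sub_sub_cancel_right]
      refine (hF _ _).trans ?_
      rw [add_sub_add_right_eq_sub, mul_comm, ← le_div_iff₀ hL]
      exact hag x
  have h3 : F ∘ f = (fun x => F (a x + r) - F r) + algebraMap ℝ (X → ℝ) (F r) := by
    ext x
    simp [har]
  rw [h3]
  exact add_mem (mem_roydenAlgebra_of_mem_uniformClosure h1) (Subalgebra.algebraMap_mem _ _)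

/-- Composition of an element of `𝒜⁺` with a normal contraction. -/
def compRoyden (C : ℝ → ℝ) (hC : IsNormalContraction C) (f : G.roydenAlgebra) : G.roydenAlgebra :=
  ⟨C ∘ f, comp_mem_roydenAlgebra f.2 one_pos fun s t => by simpa using hC.2 s t⟩

/-! ### Characters of the Royden algebra -/

namespace Royden

/-- A point of the Royden compactification as a character. -/
def toAlgHom (χ : G.Royden) : G.roydenAlgebra →ₐ[ℝ] ℝ := χ

theorem eval_toRoyden (x : X) (f : G.roydenAlgebra) : (G.toRoyden x).eval f = (f : X → ℝ) x := rfl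

@[simp] theorem eval_add (χ : G.Royden) (f g : G.roydenAlgebra) :
    χ.eval (f + g) = χ.eval f + χ.eval g := map_add χ.toAlgHom f g

@[simp] theorem eval_sub (χ : G.Royden) (f g : G.roydenAlgebra) :
    χ.eval (f - g) = χ.eval f - χ.eval g := map_sub χ.toAlgHom f g

@[simp] theorem eval_mul (χ : G.Royden) (f g : G.roydenAlgebra) :
    χ.eval (f * g) = χ.eval f * χ.eval g := map_mul χ.toAlgHom f g

@[simp] theorem eval_smul (χ : G.Royden) (a : ℝ) (f : G.roydenAlgebra) :
    χ.eval (a • f) = a * χ.eval f := map_smul χ.toAlgHom a f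

@[simp] theorem eval_zero (χ : G.Royden) : χ.eval 0 = 0 := map_zero χ.toAlgHom

@[simp] theorem eval_one (χ : G.Royden) : χ.eval 1 = 1 := map_one χ.toAlgHom

@[simp] theorem eval_algebraMap (χ : G.Royden) (r : ℝ) :
    χ.eval (algebraMap ℝ G.roydenAlgebra r) = r := χ.toAlgHom.commutes r

theorem ext {χ ψ : G.Royden} (h : ∀ f, χ.eval f = ψ.eval f) : χ = ψ :=
  show χ.toAlgHom = ψ.toAlgHom from AlgHom.ext h

/-- An element of the kernel of a character is not bounded away from zero on `X`. This expresses
the density of `X` in its Royden compactification. -/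
theorem exists_abs_lt_of_eval_eq_zero (χ : G.Royden) {f : G.roydenAlgebra} (hf : χ.eval f = 0)
    {ε : ℝ} (hε : 0 < ε) : ∃ x, |(f : X → ℝ) x| < ε := by
  by_contra! hcon
  -- if `ε ≤ |f|`, then `F ∘ f²` is an inverse of `f²` in `𝒜⁺`
  let F : ℝ → ℝ := fun t => (max t (ε ^ 2))⁻¹
  have hpos : ∀ t, 0 < max t (ε ^ 2) := fun t => lt_max_of_lt_right (by positivity)
  have hF : ∀ s t, |F s - F t| ≤ (ε ^ 4)⁻¹ * |s - t| := fun s t => by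
    have h1 := abs_max_sub_max_le_abs s t (ε ^ 2)
    have h2 : ε ^ 4 ≤ max s (ε ^ 2) * max t (ε ^ 2) := by
      rw [show ε ^ 4 = ε ^ 2 * ε ^ 2 by ring]
      exact mul_le_mul (le_max_right _ _) (le_max_right _ _) (by positivity) (hpos s).le
    simp only [F]
    rw [inv_sub_inv (hpos s).ne' (hpos t).ne', abs_div, abs_of_pos (mul_pos (hpos s) (hpos t)),
      abs_sub_comm, div_eq_inv_mul]
    exact mul_le_mul (inv_anti₀ (by positivity) h2) h1 (abs_nonneg _) (by positivity)
  have hmem := comp_mem_roydenAlgebra (f * f).2 (by positivity) hF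
  have h1 : (f * f) * ⟨_, hmem⟩ = 1 := by
    ext x
    have h2 : ε ^ 2 ≤ (f : X → ℝ) x * (f : X → ℝ) x := by
      rw [← sq, ← sq_abs ((f : X → ℝ) x)]
      exact pow_le_pow_left₀ hε.le (hcon x) 2
    simp only [MulMemClass.coe_mul, Pi.mul_apply, Function.comp_apply, F,
      OneMemClass.coe_one, Pi.one_apply, max_eq_left h2]
    exact mul_inv_cancel₀ (lt_of_lt_of_le (by positivity) h2).ne'
  have h2 := congrArg χ.eval h1
  rw [eval_mul, eval_mul, hf, zero_mul, zero_mul, eval_one] at h2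
  exact zero_ne_one h2

theorem eval_nonneg (χ : G.Royden) {f : G.roydenAlgebra} (hf : ∀ x, 0 ≤ (f : X → ℝ) x) :
    0 ≤ χ.eval f := by
  by_contra! h
  obtain ⟨x, hx⟩ := χ.exists_abs_lt_of_eval_eq_zero
    (f := f - algebraMap ℝ G.roydenAlgebra (χ.eval f)) (by simp) (neg_pos.2 h)
  have h1 : ((f - algebraMap ℝ G.roydenAlgebra (χ.eval f) : G.roydenAlgebra) : X → ℝ) x =
    (f : X → ℝ) x - χ.eval f := rfl
  rw [h1] at hx
  have := (le_abs_self _).trans_lt hx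
  linarith [hf x]

theorem eval_mono (χ : G.Royden) {f g : G.roydenAlgebra} (h : ∀ x, (f : X → ℝ) x ≤ (g : X → ℝ) x) :
    χ.eval f ≤ χ.eval g := by
  have := χ.eval_nonneg (f := g - f) fun x => sub_nonneg.2 (h x)
  rwa [eval_sub, sub_nonneg] at this

theorem abs_eval_le (χ : G.Royden) {f : G.roydenAlgebra} {M : ℝ} (h : ∀ x, |(f : X → ℝ) x| ≤ M) :
    |χ.eval f| ≤ M := by
  have h1 := χ.eval_mono (f := f) (g := algebraMap ℝ G.roydenAlgebra M) fun x =>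
    (abs_le.1 (h x)).2
  have h2 := χ.eval_mono (f := algebraMap ℝ G.roydenAlgebra (-M)) (g := f) fun x =>
    (abs_le.1 (h x)).1
  rw [eval_algebraMap] at h1 h2
  exact abs_le.2 ⟨h2, h1⟩

/-- Characters commute with normal contractions: `(C ∘ f - C t)² ≤ (f - t)²`, and for `t = χ f` the
right hand side vanishes at `χ`. -/
theorem eval_compRoyden (χ : G.Royden) {C : ℝ → ℝ} (hC : IsNormalContraction C)
    (f : G.roydenAlgebra) : χ.eval (compRoyden C hC f) = C (χ.eval f) := by
  let t := χ.eval f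
  let u := compRoyden C hC f - algebraMap ℝ G.roydenAlgebra (C t)
  let v := f - algebraMap ℝ G.roydenAlgebra t
  have h1 := χ.eval_mono (f := u * u) (g := v * v) fun x => by
    show (C ((f : X → ℝ) x) - C t) * (C ((f : X → ℝ) x) - C t) ≤
      ((f : X → ℝ) x - t) * ((f : X → ℝ) x - t)
    rw [← abs_mul_abs_self, ← abs_mul_abs_self ((f : X → ℝ) x - t)]
    exact mul_self_le_mul_self (abs_nonneg _) (hC.2 _ _)
  rw [eval_mul, eval_mul] at h1
  have h2 : χ.eval v = 0 := by simp [v, t]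
  have h3 : χ.eval u = χ.eval (compRoyden C hC f) - C t := by simp [u]
  rw [h2, h3] at h1
  have := mul_self_eq_zero.1 (le_antisymm (by simpa using h1) (mul_self_nonneg _))
  exact sub_eq_zero.1 this

/-! ### Topology of the Royden compactification -/

theorem isInducing_eval :
    IsInducing (fun (χ : G.Royden) (f : G.roydenAlgebra) => χ.eval f) := ⟨rfl⟩

theorem continuous_eval (f : G.roydenAlgebra) : Continuous fun χ : G.Royden => χ.eval f :=
  (continuous_apply f).comp isInducing_eval.continuous

instance : T2Space G.Royden :=
  T2Space.of_injective_continuous (fun _ _ h => ext fun f => congrFun h f)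
    isInducing_eval.continuous

instance : CompactSpace G.Royden := by
  refine ⟨isInducing_eval.isCompact_iff.2 ?_⟩
  choose M hM using fun f : G.roydenAlgebra => G.bounded_of_mem_roydenAlgebra f.2
  refine (isCompact_univ_pi fun f => isCompact_Icc (a := -M f) (b := M f)).of_isClosed_subset ?_ ?_
  · have h1 : (fun (χ : G.Royden) (f : G.roydenAlgebra) => χ.eval f) '' Set.univ =
        (⋂ (f) (g), {F : G.roydenAlgebra → ℝ | F (f + g) = F f + F g}) ∩
        ((⋂ (f) (g), {F : G.roydenAlgebra → ℝ | F (f * g) = F f * F g}) ∩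
        ⋂ r : ℝ, {F : G.roydenAlgebra → ℝ | F (algebraMap ℝ _ r) = r}) := by
      ext F
      simp only [Set.image_univ, Set.mem_range, Set.mem_inter_iff, Set.mem_iInter,
        Set.mem_ofPred_eq]
      constructor
      · rintro ⟨χ, rfl⟩
        exact ⟨χ.eval_add, χ.eval_mul, χ.eval_algebraMap⟩
      · rintro ⟨ha, hm, hr⟩
        let χ : G.roydenAlgebra →ₐ[ℝ] ℝ :=
          { toFun := F
            map_one' := by simpa using hr 1
            map_mul' := hm
            map_zero' := by simpa using hr 0
            map_add' := ha
            commutes' := hr }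
        exact ⟨χ, rfl⟩
    rw [h1]
    refine IsClosed.inter ?_ (IsClosed.inter ?_ ?_)
    · exact isClosed_iInter fun f => isClosed_iInter fun g =>
        isClosed_eq (by fun_prop) (by fun_prop)
    · exact isClosed_iInter fun f => isClosed_iInter fun g =>
        isClosed_eq (by fun_prop) (by fun_prop)
    · exact isClosed_iInter fun r => isClosed_eq (by fun_prop) (by fun_prop)
  · rintro _ ⟨χ, -, rfl⟩ f -
    exact abs_le.1 (χ.abs_eval_le (hM f))

/-- A linear space of functions which contains the squares of its elements and has no common zero
on a compact set contains a nonnegative function which is at least one on that set. -/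
theorem exists_one_le_eval {S : Set G.Royden} (hS : IsCompact S) (F : Submodule ℝ G.roydenAlgebra)
    (hF : ∀ f ∈ F, f * f ∈ F) (hne : ∀ χ ∈ S, ∃ f ∈ F, χ.eval f ≠ 0) :
    ∃ g ∈ F, (∀ x, 0 ≤ (g : X → ℝ) x) ∧ ∀ χ ∈ S, 1 ≤ χ.eval g := by
  refine hS.induction_on
    (p := fun S => ∃ g ∈ F, (∀ x, 0 ≤ (g : X → ℝ) x) ∧ ∀ χ ∈ S, 1 ≤ χ.eval g) ?_ ?_ ?_ ?_
  · exact ⟨0, F.zero_mem, fun x => le_rfl, fun χ hχ => absurd hχ (Set.notMem_empty χ)⟩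
  · rintro s t hst ⟨g, hg, h0, h1⟩
    exact ⟨g, hg, h0, fun χ hχ => h1 χ (hst hχ)⟩
  · rintro s t ⟨g, hg, hg0, hg1⟩ ⟨k, hk, hk0, hk1⟩
    refine ⟨g + k, F.add_mem hg hk, fun x => add_nonneg (hg0 x) (hk0 x), fun χ hχ => ?_⟩
    rw [eval_add]
    have h1 := χ.eval_nonneg hg0
    have h2 := χ.eval_nonneg hk0
    rcases hχ with h | h
    · linarith [hg1 χ h]
    · linarith [hk1 χ h]
  · intro χ hχ
    obtain ⟨f, hf, hfχ⟩ := hne χ hχ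
    have hpos : 0 < χ.eval f * χ.eval f := mul_self_pos.2 hfχ
    refine ⟨{ψ | χ.eval f * χ.eval f / 2 < ψ.eval (f * f)}, mem_nhdsWithin_of_mem_nhds ?_,
      (2 / (χ.eval f * χ.eval f)) • (f * f), F.smul_mem _ (hF f hf), fun x => ?_, fun ψ hψ => ?_⟩
    · refine ((continuous_eval (f * f)).tendsto χ).eventually (lt_mem_nhds ?_)
      rw [eval_mul]; linarith
    · exact mul_nonneg (by positivity) (mul_self_nonneg _)
    · have h2 : χ.eval f * χ.eval f / 2 < ψ.eval (f * f) := hψ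
      rw [eval_smul, div_mul_eq_mul_div, one_le_div hpos]
      linarith

end Royden

/-! ### The harmonic boundary and the maximum principle -/

/-- Points of `X` are not zeros of all bounded functions in `D₀`, so the requirement that points of
the harmonic boundary do not lie in `X` is automatic. -/
theorem mem_harmonicBoundary_iff {χ : G.Royden} : χ ∈ G.harmonicBoundary ↔
    ∀ f : G.roydenAlgebra, (f : X → ℝ) ∈ G.vanishing → χ.eval f = 0 := by
  classical
  refine ⟨fun h => h.2, fun h => ⟨?_, h⟩⟩
  rintro ⟨x, rfl⟩
  have h1 : (Pi.single x 1 : X → ℝ) ∈ G.vanishing :=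
    mem_vanishing_of_finite_support ((Set.finite_singleton x).subset fun y hy => by
      by_contra hxy
      simp [show y ≠ x from hxy] at hy)
  have h2 := h ⟨_, G.mem_roydenAlgebra_of_bounded h1.1 ⟨1, fun y => by
    rw [Pi.single_apply]; split_ifs <;> simp⟩⟩ h1
  rw [Royden.eval_toRoyden] at h2
  simp at h2

theorem isClosed_harmonicBoundary : IsClosed G.harmonicBoundary := by
  have h1 : G.harmonicBoundary = ⋂ f : {f : G.roydenAlgebra // (f : X → ℝ) ∈ G.vanishing},
      {χ : G.Royden | χ.eval f.1 = 0} := by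
    ext χ
    simp [mem_harmonicBoundary_iff]
  rw [h1]
  exact isClosed_iInter fun f => isClosed_eq (Royden.continuous_eval _) continuous_const

instance : CompactSpace G.harmonicBoundary :=
  isCompact_iff_compactSpace.1 isClosed_harmonicBoundary.isCompact

/-- The maximum principle: a bounded harmonic function of finite energy is bounded above by any
nonnegative upper bound of its values on the harmonic boundary. -/
theorem le_of_forall_boundary_le (hconn : G.Connected) (htrans : G.Transient) [Nonempty X]
    (h : G.roydenAlgebra) (hE : G.energy (h : X → ℝ) < ∞)
    (ho : ∀ v ∈ G.vanishing, G.energyForm (h : X → ℝ) v = 0) {r : ℝ} (hr : 0 ≤ r)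
    (hle : ∀ p : G.harmonicBoundary, G.preTrace h p ≤ r) (x : X) : (h : X → ℝ) x ≤ r := by
  refine le_of_forall_pos_le_add fun ε hε => ?_
  -- the excess of `h` over `r + ε` is dominated by a bounded function in `D₀`
  obtain ⟨g, hg, hg0, hg1⟩ := Royden.exists_one_le_eval
    (S := {χ : G.Royden | r + ε ≤ χ.eval h})
    (isClosed_le continuous_const (Royden.continuous_eval h)).isCompact
    (G.vanishingSubmodule.comap G.roydenAlgebra.val.toLinearMap)
    (fun f hf => by
      obtain ⟨M, hM⟩ := G.bounded_of_mem_roydenAlgebra f.2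
      exact mul_mem_vanishing hconn hf hf.1 hM hM)
    (fun χ hχ => by
      by_contra! hcon
      have h1 := hle ⟨χ, mem_harmonicBoundary_iff.2 fun f hf => hcon f hf⟩
      have h2 : r + ε ≤ χ.eval h := hχ
      simp only [preTrace] at h1
      linarith)
  obtain ⟨M, hM⟩ := G.bounded_of_mem_roydenAlgebra h.2
  have hM0 : 0 ≤ M := (abs_nonneg _).trans (hM x)
  let C : ℝ → ℝ := fun t => max (t - (r + ε)) 0
  have hmono : ∀ s t, s ≤ t → C s ≤ C t := fun s t hst =>
    max_le_max (by linarith) le_rfl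
  have hCL : ∀ s t, |C s - C t| ≤ |s - t| := fun s t => by
    simpa using abs_max_sub_max_le_abs (s - (r + ε)) (t - (r + ε)) 0
  have hC0 : C 0 = 0 := max_eq_right (by linarith)
  have hC : IsNormalContraction C := ⟨fun s => by simpa [hC0] using hCL s 0, hCL⟩
  have hCe : G.energy (C ∘ (h : X → ℝ)) < ∞ := (G.energy_comp_le hC _).trans_lt hE
  have hCV : C ∘ (h : X → ℝ) ∈ G.vanishing := by
    refine mem_vanishing_of_abs_le hconn (G.vanishingSubmodule.smul_mem M hg) hCe fun y => ?_
    simp only [Function.comp_apply, Pi.smul_apply, smul_eq_mul]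
    rcases le_total (r + ε) ((h : X → ℝ) y) with h1 | h1
    · have h2 : 1 ≤ (g : X → ℝ) y := hg1 (G.toRoyden y) h1
      refine (hC.1 _).trans ((hM y).trans ?_)
      refine le_trans ?_ (le_abs_self _)
      exact le_mul_of_one_le_right hM0 h2
    · have : C ((h : X → ℝ) y) = 0 := max_eq_right (by linarith)
      rw [this, abs_zero]
      exact abs_nonneg _
  -- `(∇(C ∘ h))² ≤ ∇h ∇(C ∘ h)` since `C` is monotone and contractive; the right hand side sums to
  -- zero as `h` is orthogonal to `D₀`
  have h1 : G.energyForm (C ∘ (h : X → ℝ)) (C ∘ (h : X → ℝ)) ≤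
      G.energyForm (h : X → ℝ) (C ∘ (h : X → ℝ)) := by
    refine (summable_grad_mul hCe hCe).tsum_le_tsum (fun i => ?_) (summable_grad_mul hE hCe)
    refine mul_le_mul_of_nonneg_left ?_ (G.gradWeight_nonneg i)
    rcases i with ⟨y, w⟩ | y
    · simp only [grad, Sum.elim_inl, Function.comp_apply]
      have h2 := hCL ((h : X → ℝ) y) ((h : X → ℝ) w)
      rcases le_total ((h : X → ℝ) y) ((h : X → ℝ) w) with h3 | h3
      · have h4 := hmono _ _ h3
        rw [abs_of_nonpos (by linarith), abs_of_nonpos (by linarith)] at h2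
        nlinarith
      · have h4 := hmono _ _ h3
        rw [abs_of_nonneg (by linarith), abs_of_nonneg (by linarith)] at h2
        nlinarith
    · simp only [grad, Sum.elim_inr, Function.comp_apply]
      have h2 : 0 ≤ C ((h : X → ℝ) y) := le_max_right _ _
      rcases h2.eq_or_lt with h3 | h3
      · rw [← h3]; simp
      · have h4 : C ((h : X → ℝ) y) = (h : X → ℝ) y - (r + ε) := by
          have h5 : 0 < C ((h : X → ℝ) y) := h3
          simp only [C, lt_max_iff, lt_irrefl, or_false] at h5
          exact max_eq_left h5.le
        refine mul_le_mul_of_nonneg_right ?_ h2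
        linarith
  rw [ho _ hCV] at h1
  have h2 : 0 ≤ G.energyForm (C ∘ (h : X → ℝ)) (C ∘ (h : X → ℝ)) :=
    toReal_energy (G := G) (f := C ∘ (h : X → ℝ)) ▸ ENNReal.toReal_nonneg
  have h3 := congrFun (eq_zero_of_energyForm_self htrans hCV (le_antisymm h1 h2)) x
  simp only [Function.comp_apply, Pi.zero_apply] at h3
  have h4 : (h : X → ℝ) x - (r + ε) ≤ C ((h : X → ℝ) x) := le_max_left _ _
  linarith

end WeightedGraph

namespace WeightedGraph

variable {X : Type*} {G : WeightedGraph X}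

/-! ### Existence of harmonic measures -/

/-- Restriction of the elements of `𝒜⁺` to the harmonic boundary. -/
def boundaryMap : G.roydenAlgebra →ₐ[ℝ] C(G.harmonicBoundary, ℝ) where
  toFun f := ⟨G.preTrace f, (Royden.continuous_eval f).comp continuous_subtype_val⟩
  map_one' := by ext p; exact p.1.eval_one
  map_mul' f g := by ext p; exact p.1.eval_mul f g
  map_zero' := by ext p; exact p.1.eval_zero
  map_add' f g := by ext p; exact p.1.eval_add f g
  commutes' r := by ext p; exact p.1.eval_algebraMap r

@[simp] theorem boundaryMap_apply (f : G.roydenAlgebra) (p : G.harmonicBoundary) :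
    boundaryMap f p = G.preTrace f p := rfl

theorem continuous_preTrace (f : G.roydenAlgebra) : Continuous (G.preTrace f) :=
  (boundaryMap f).continuous

variable (G) in
/-- The points of the harmonic boundary at which all functions in `𝒜` vanish. There is at most one
such point, called `p_∞`. -/
def commonZeros : Set G.harmonicBoundary :=
  {p | ∀ f : G.roydenAlgebra, (f : X → ℝ) ∈ G.uniformClosure → G.preTrace f p = 0}

theorem isClosed_commonZeros : IsClosed G.commonZeros := by
  have h1 : G.commonZeros =
      ⋂ f : {f : G.roydenAlgebra // (f : X → ℝ) ∈ G.uniformClosure},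
        {p : G.harmonicBoundary | G.preTrace f.1 p = 0} := by
    ext p
    simp [commonZeros]
  rw [h1]
  exact isClosed_iInter fun f => isClosed_eq (continuous_preTrace _) continuous_const

theorem exists_eq_add_algebraMap (f : G.roydenAlgebra) :
    ∃ (a : G.roydenAlgebra) (r : ℝ), (a : X → ℝ) ∈ G.uniformClosure ∧
      f = a + algebraMap ℝ G.roydenAlgebra r := by
  obtain ⟨a, ha, r, har⟩ := exists_eq_add_const f.2
  exact ⟨⟨a, mem_roydenAlgebra_of_mem_uniformClosure ha⟩, r, ha, Subtype.ext (funext har)⟩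

theorem subsingleton_commonZeros : G.commonZeros.Subsingleton := by
  intro p hp p' hp'
  refine Subtype.ext (Royden.ext fun f => ?_)
  obtain ⟨a, r, ha, rfl⟩ := exists_eq_add_algebraMap f
  have h1 : p.1.eval a = 0 := hp a ha
  have h2 : p'.1.eval a = 0 := hp' a ha
  simp [h1, h2]

variable (G) in
/-- The bounded harmonic functions of finite energy. -/
def boundedHarmonic : Submodule ℝ G.roydenAlgebra where
  carrier := {h | G.energy (h : X → ℝ) < ∞ ∧
    ∀ v ∈ G.vanishing, G.energyForm (h : X → ℝ) v = 0}
  zero_mem' := by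
    have h1 := IsHarmonicPart.of_mem_vanishing G.vanishingSubmodule.zero_mem
    exact ⟨h1.energy_lt_top, h1.orthogonal⟩
  add_mem' := fun {f g} hf hg => by
    have h1 := (IsHarmonicPart.self hf.1 hf.2).add (IsHarmonicPart.self hg.1 hg.2)
    exact ⟨h1.energy_lt_top, h1.orthogonal⟩
  smul_mem' := fun a f hf => by
    have h1 := (IsHarmonicPart.self hf.1 hf.2).smul a
    exact ⟨h1.energy_lt_top, h1.orthogonal⟩

theorem mem_boundedHarmonic_iff (hconn : G.Connected) [Nonempty X] {h : G.roydenAlgebra} :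
    h ∈ G.boundedHarmonic ↔ (h : X → ℝ) ∈ G.finiteEnergy ∧ G.IsHarmonic h :=
  and_congr_right fun hE => (isHarmonic_iff hconn hE).symm

/-- By the maximum principle, the values of harmonic functions at a vertex extend to a positive
linear functional of norm at most one on the continuous functions on the harmonic boundary. -/
theorem exists_positive_functional (hconn : G.Connected) (htrans : G.Transient) (x : X) :
    ∃ Λ : C(G.harmonicBoundary, ℝ) →ₗ[ℝ] ℝ, (∀ φ, (∀ p, 0 ≤ φ p) → 0 ≤ Λ φ) ∧ Λ 1 ≤ 1 ∧
      ∀ h ∈ G.boundedHarmonic, Λ (boundaryMap h) = (h : X → ℝ) x := by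
  have : Nonempty X := ⟨x⟩
  let γ : G.boundedHarmonic →ₗ[ℝ] C(G.harmonicBoundary, ℝ) :=
    boundaryMap.toLinearMap ∘ₗ G.boundedHarmonic.subtype
  have hmax : ∀ (h : G.boundedHarmonic) (r : ℝ), 0 ≤ r → (∀ p, γ h p ≤ r) →
      ∀ y, ((h : G.roydenAlgebra) : X → ℝ) y ≤ r := fun h r hr hp =>
    le_of_forall_boundary_le hconn htrans h.1 h.2.1 h.2.2 hr hp
  have hinj : Function.Injective γ := by
    have hle : ∀ h k : G.boundedHarmonic, γ h = γ k → ∀ y,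
        ((h : G.roydenAlgebra) : X → ℝ) y ≤ ((k : G.roydenAlgebra) : X → ℝ) y :=
      fun h k hhk y => by
        have h1 := hmax (h + (-1 : ℝ) • k) 0 le_rfl (fun p => by simp [hhk]) y
        have h2 : (((h + (-1 : ℝ) • k : G.boundedHarmonic) : G.roydenAlgebra) : X → ℝ) y =
          ((h : G.roydenAlgebra) : X → ℝ) y + -1 * ((k : G.roydenAlgebra) : X → ℝ) y := rfl
        linarith
    intro h k hhk
    exact Subtype.ext (Subtype.ext (funext fun y =>
      le_antisymm (hle h k hhk y) (hle k h hhk.symm y)))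
  let ev : G.boundedHarmonic →ₗ[ℝ] ℝ :=
    (LinearMap.proj x) ∘ₗ G.roydenAlgebra.val.toLinearMap ∘ₗ G.boundedHarmonic.subtype
  let f : C(G.harmonicBoundary, ℝ) →ₗ.[ℝ] ℝ :=
    ⟨LinearMap.range γ, ev ∘ₗ (LinearEquiv.ofInjective γ hinj).symm.toLinearMap⟩
  have hf : ∀ h : G.boundedHarmonic, f ⟨γ h, LinearMap.mem_range_self γ h⟩ = ev h := fun h => by
    show ev ((LinearEquiv.ofInjective γ hinj).symm ⟨γ h, _⟩) = ev h
    congr 1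
    rw [LinearEquiv.symm_apply_eq]
    rfl
  -- a linear functional dominated by `φ ↦ ‖φ⁺‖` is positive and of norm at most one
  have hN1 : ∀ c : ℝ, 0 < c → ∀ φ : C(G.harmonicBoundary, ℝ), ‖c • φ ⊔ 0‖ = c * ‖φ ⊔ 0‖ := by
    intro c hc φ
    have h1 : c • φ ⊔ 0 = c • (φ ⊔ 0) := by
      ext p
      simp only [ContinuousMap.sup_apply, ContinuousMap.smul_apply, ContinuousMap.zero_apply,
        smul_eq_mul]
      rw [mul_max_of_nonneg _ _ hc.le, mul_zero]
    rw [h1, norm_smul, Real.norm_of_nonneg hc.le]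
  have hN2 : ∀ φ ψ : C(G.harmonicBoundary, ℝ), ‖(φ + ψ) ⊔ 0‖ ≤ ‖φ ⊔ 0‖ + ‖ψ ⊔ 0‖ := by
    intro φ ψ
    refine (ContinuousMap.norm_le _ (by positivity)).2 fun p => ?_
    have h1 := (φ ⊔ 0).norm_coe_le_norm p
    have h2 := (ψ ⊔ 0).norm_coe_le_norm p
    simp only [ContinuousMap.sup_apply, ContinuousMap.zero_apply, Real.norm_eq_abs,
      ContinuousMap.add_apply] at h1 h2 ⊢
    rw [abs_of_nonneg (le_max_right _ _)] at h1 h2 ⊢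
    exact max_le (by linarith [le_max_left (φ p) 0, le_max_left (ψ p) 0]) (by positivity)
  have hN3 : ∀ φ : f.domain, f φ ≤ ‖(φ : C(G.harmonicBoundary, ℝ)) ⊔ 0‖ := by
    rintro ⟨_, h, rfl⟩
    refine (hf h).trans_le ?_
    refine hmax h _ (norm_nonneg _) (fun p => ?_) x
    have h1 := (γ h ⊔ 0).norm_coe_le_norm p
    simp only [ContinuousMap.sup_apply, ContinuousMap.zero_apply, Real.norm_eq_abs] at h1
    rw [abs_of_nonneg (le_max_right _ _)] at h1
    exact (le_max_left _ _).trans h1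
  obtain ⟨Λ, hΛf, hΛN⟩ := exists_extension_of_le_sublinear f (fun φ => ‖φ ⊔ 0‖) hN1 hN2 hN3
  refine ⟨Λ, fun φ hφ => ?_, ?_, fun h hh => ?_⟩
  · have h1 := hΛN (-φ)
    have h2 : -φ ⊔ 0 = 0 := by
      ext p
      simpa using hφ p
    rw [map_neg] at h1
    simp only [h2, norm_zero] at h1
    linarith
  · refine (hΛN 1).trans ((ContinuousMap.norm_le _ zero_le_one).2 fun p => ?_)
    simp
  · exact (hΛf ⟨γ ⟨h, hh⟩, LinearMap.mem_range_self γ _⟩).trans (hf ⟨h, hh⟩)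

open CompactlySupported in
/-- Existence of harmonic measures. Restricting the measure given by the Riesz representation theorem
to the complement of the common zeros of `𝒜` achieves the normalization without affecting the
integrals of boundary values of functions in `𝒜`. -/
theorem exists_isHarmonicMeasureAt (hconn : G.Connected) (htrans : G.Transient) (x : X) :
    ∃ μ, G.IsHarmonicMeasureAt x μ := by
  have : Nonempty X := ⟨x⟩
  obtain ⟨Λ, hpos, h1, hrep⟩ := exists_positive_functional hconn htrans x
  let Λ' : C_c(G.harmonicBoundary, ℝ) →ₚ[ℝ] ℝ :=
    { toFun := fun φ => Λ φ.toContinuousMap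
      map_add' := fun φ ψ => Λ.map_add φ.toContinuousMap ψ.toContinuousMap
      map_smul' := fun c φ => Λ.map_smul c φ.toContinuousMap
      monotone' := fun φ ψ h => by
        rw [← sub_nonneg, ← map_sub]
        exact hpos _ fun p => sub_nonneg.2 (h p) }
  let ν := RealRMK.rieszMeasure Λ'
  have hν : ∀ φ : C(G.harmonicBoundary, ℝ), ∫ p, φ p ∂ν = Λ φ := fun φ =>
    RealRMK.integral_rieszMeasure Λ' ⟨φ, HasCompactSupport.of_compactSpace _⟩
  have hmass : ν Set.univ ≤ 1 := by
    have h2 := hν 1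
    simp only [ContinuousMap.one_apply, integral_const, smul_eq_mul, mul_one] at h2
    rw [← h2, measureReal_def] at h1
    rw [← ENNReal.ofReal_toReal (measure_ne_top ν Set.univ)]
    exact (ENNReal.ofReal_le_ofReal h1).trans (by simp)
  have hmeas : MeasurableSet (G.commonZerosᶜ) := isClosed_commonZeros.measurableSet.compl
  refine ⟨ν.restrict G.commonZerosᶜ, Measure.Regular.restrict_of_measure_ne_top
    (measure_ne_top _ _), ?_, fun h hE hh => ?_, fun p hp => ?_⟩
  · exact (Measure.restrict_apply_le _ _).trans hmass
  · rw [← hrep h ((mem_boundedHarmonic_iff hconn).2 ⟨hE, hh⟩), ← hν]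
    refine (setIntegral_eq_integral_of_forall_compl_eq_zero fun p hp => ?_).symm
    exact not_not.1 hp h (mem_uniformClosure_of_bounded hE (G.bounded_of_mem_roydenAlgebra h.2))
  · rw [Measure.restrict_apply (measurableSet_singleton p)]
    have : {p} ∩ G.commonZerosᶜ = ∅ := by
      ext p'
      simp only [Set.mem_inter_iff, Set.mem_singleton_iff, Set.mem_compl_iff,
        Set.mem_empty_iff_false, iff_false, not_and, not_not]
      rintro rfl
      exact hp
    rw [this, measure_empty]

theorem isHarmonicMeasureAt_harmonicMeasure (hconn : G.Connected) (htrans : G.Transient) (x : X) :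
    G.IsHarmonicMeasureAt x (G.harmonicMeasure x) := by
  have h := exists_isHarmonicMeasureAt hconn htrans x
  rw [harmonicMeasure, dif_pos h]
  exact h.choose_spec

namespace IsHarmonicMeasureAt

variable {x z : X} {μ ν : Measure G.harmonicBoundary}

theorem isFiniteMeasure (h : G.IsHarmonicMeasureAt x μ) : IsFiniteMeasure μ :=
  ⟨h.mass_le_one.trans_lt (by simp)⟩

theorem measure_commonZeros (h : G.IsHarmonicMeasureAt x μ) : μ G.commonZeros = 0 := by
  rcases subsingleton_commonZeros.eq_empty_or_singleton with h1 | ⟨p, hp⟩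
  · rw [h1, measure_empty]
  · rw [hp]
    exact h.normalized p (hp ▸ Set.mem_singleton p : p ∈ G.commonZeros)

/-- The harmonic measure at `x` represents the value at `x` of the harmonic part of every bounded
function of finite energy, as the boundary values of `f` and its harmonic part agree. -/
theorem integral_preTrace (h : G.IsHarmonicMeasureAt x μ) (hconn : G.Connected)
    (htrans : G.Transient) (f : G.roydenAlgebra) {k : X → ℝ} (hk : G.IsHarmonicPart f k) :
    ∫ p, G.preTrace f p ∂μ = k x := by
  have : Nonempty X := ⟨x⟩
  obtain ⟨M, hM⟩ := G.bounded_of_mem_roydenAlgebra f.2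
  have hkb := hk.abs_le hconn htrans hM
  let k' : G.roydenAlgebra := ⟨k, G.mem_roydenAlgebra_of_bounded hk.energy_lt_top ⟨M, hkb⟩⟩
  have h1 := h.represents k' hk.energy_lt_top
    ((isHarmonic_iff hconn hk.energy_lt_top).2 hk.orthogonal)
  refine Eq.trans ?_ h1.symm
  refine integral_congr_ae (Eventually.of_forall fun p => ?_)
  have h2 := mem_harmonicBoundary_iff.1 p.2 (f - k') hk.sub_mem
  rw [Royden.eval_sub, sub_eq_zero] at h2
  exact h2

end IsHarmonicMeasureAt

/-! ### Density of boundary values and comparison of harmonic measures -/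

/-- If the functions in `𝒜` have no common zero on the harmonic boundary, then `1` is the boundary
value of a bounded function of finite energy. -/
theorem exists_preTrace_eq_one (h : G.commonZeros = ∅) :
    ∃ g : G.roydenAlgebra, (g : X → ℝ) ∈ G.finiteEnergy ∧ ∀ p, G.preTrace g p = 1 := by
  obtain ⟨g, hg, -, hg1⟩ := Royden.exists_one_le_eval
    (S := G.harmonicBoundary) isClosed_harmonicBoundary.isCompact
    (G.finiteEnergy.comap G.roydenAlgebra.val.toLinearMap)
    (fun f hf => by
      obtain ⟨M, hM⟩ := G.bounded_of_mem_roydenAlgebra f.2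
      exact (G.energy_mul_le hM hM).trans_lt (ENNReal.add_lt_top.2
        ⟨ENNReal.mul_lt_top ENNReal.ofReal_lt_top hf, ENNReal.mul_lt_top ENNReal.ofReal_lt_top hf⟩))
    (fun χ hχ => by
      have hp : (⟨χ, hχ⟩ : G.harmonicBoundary) ∉ G.commonZeros := by simp [h]
      simp only [commonZeros, Set.mem_ofPred_eq, not_forall] at hp
      obtain ⟨a, ha, ha0⟩ := hp
      have ha0' : χ.eval a ≠ 0 := ha0
      obtain ⟨g, hg, hgb, hag⟩ := ha (|χ.eval a| / 2) (half_pos (abs_pos.2 ha0'))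
      refine ⟨⟨g, G.mem_roydenAlgebra_of_bounded hg hgb⟩, hg, fun h0 => ?_⟩
      have h1 := χ.abs_eval_le (f := a - ⟨g, G.mem_roydenAlgebra_of_bounded hg hgb⟩) hag
      rw [Royden.eval_sub, h0, sub_zero] at h1
      linarith [abs_pos.2 ha0'])
  refine ⟨compRoyden (clamp 1) (isNormalContraction_clamp zero_le_one) g,
    (G.energy_comp_le (isNormalContraction_clamp zero_le_one) _).trans_lt hg, fun p => ?_⟩
  have h1 : 1 ≤ p.1.eval g := hg1 p.1 p.2
  rw [preTrace, Royden.eval_compRoyden, clamp, min_eq_right h1]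
  norm_num

/-- Continuous functions on the harmonic boundary vanishing at `p_∞` are uniform limits of boundary
values of bounded functions of finite energy. -/
theorem exists_preTrace_near (φ : C(G.harmonicBoundary, ℝ)) (hφ : ∀ p ∈ G.commonZeros, φ p = 0)
    {ε : ℝ} (hε : 0 < ε) :
    ∃ f : G.roydenAlgebra, (f : X → ℝ) ∈ G.finiteEnergy ∧ ∀ p, |φ p - G.preTrace f p| ≤ ε := by
  -- by the Stone-Weierstrass theorem `φ` is close to the boundary values of some `f = a + r ∈ 𝒜⁺`
  have hsep : (boundaryMap (G := G)).range.SeparatesPoints := by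
    intro p p' hpp'
    have : ∃ f, p.1.eval f ≠ p'.1.eval f := by
      by_contra! hcon
      exact hpp' (Subtype.ext (Royden.ext hcon))
    obtain ⟨f, hf⟩ := this
    exact ⟨_, ⟨boundaryMap f, ⟨f, rfl⟩, rfl⟩, hf⟩
  have hd := ContinuousMap.subalgebra_topologicalClosure_eq_top_of_separatesPoints _ hsep
  have hmem : φ ∈ (boundaryMap (G := G)).range.topologicalClosure := hd ▸ Algebra.mem_top
  obtain ⟨_, ⟨f, rfl⟩, hf⟩ := Metric.mem_closure_iff.1 hmem (ε / 3) (by positivity)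
  have hf' : ∀ p, |φ p - G.preTrace f p| < ε / 3 := fun p =>
    lt_of_le_of_lt (ContinuousMap.dist_apply_le_dist (f := φ) (g := boundaryMap f) p) hf
  obtain ⟨a, r, ha, rfl⟩ := exists_eq_add_algebraMap f
  have hpre : ∀ p, G.preTrace (a + algebraMap ℝ _ r) p = G.preTrace a p + r := fun p => by
    simp [preTrace]
  obtain ⟨g, hg, hgb, hag⟩ := ha (ε / 3) (by positivity)
  let g' : G.roydenAlgebra := ⟨g, G.mem_roydenAlgebra_of_bounded hg hgb⟩
  have hag' : ∀ p, |G.preTrace a p - G.preTrace g' p| ≤ ε / 3 := fun p => by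
    have := p.1.abs_eval_le (f := a - g') hag
    rwa [Royden.eval_sub] at this
  -- if `p_∞` exists, then evaluation there shows that `r` is small; otherwise the constant function
  -- is itself the boundary value of a function of finite energy
  rcases G.commonZeros.eq_empty_or_nonempty with h0 | ⟨p, hp⟩
  · obtain ⟨k, hk, hk1⟩ := exists_preTrace_eq_one h0
    refine ⟨g' + r • k, G.finiteEnergy.add_mem hg (G.finiteEnergy.smul_mem r hk), fun p => ?_⟩
    have h1 : G.preTrace (g' + r • k) p = G.preTrace g' p + r := by
      have := hk1 p
      simp only [preTrace] at this ⊢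
      simp [this]
    have h2 := hf' p
    have h3 := hag' p
    rw [hpre] at h2
    rw [h1]
    rw [abs_lt] at h2
    rw [abs_le] at h3 ⊢
    constructor <;> linarith
  · have hr : |r| ≤ ε / 3 := by
      have h1 := (hf' p).le
      rwa [hφ p hp, hpre, hp a ha, zero_add, zero_sub, abs_neg] at h1
    refine ⟨g', hg, fun p => ?_⟩
    have h2 := hf' p
    have h3 := hag' p
    rw [hpre] at h2
    rw [abs_lt] at h2
    rw [abs_le] at h3 hr ⊢
    constructor <;> linarith

/-- Harmonic measures at different vertices are comparable, by Harnack's inequality. -/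
theorem exists_harmonicMeasure_le (hconn : G.Connected) (htrans : G.Transient) {x z : X}
    {μ ν : Measure G.harmonicBoundary} (hμ : G.IsHarmonicMeasureAt x μ)
    (hν : G.IsHarmonicMeasureAt z ν) : ∃ K : ℝ≥0, μ ≤ K • ν := by
  have : Nonempty X := ⟨x⟩
  have := hμ.isFiniteMeasure
  have := hν.isFiniteMeasure
  have := hμ.regular
  have := hν.regular
  obtain ⟨K, hK0, hK⟩ := exists_harnack hconn x z
  have hint : ∀ φ : C(G.harmonicBoundary, ℝ), (∀ p, 0 ≤ φ p) → (∀ p ∈ G.commonZeros, φ p = 0) →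
      ∫ p, φ p ∂μ ≤ K * ∫ p, φ p ∂ν := fun φ hφ0 hφz => by
    refine le_of_forall_pos_le_add fun ε hε => ?_
    obtain ⟨f, hf, hφf⟩ := exists_preTrace_near φ hφz (ε := ε / (1 + K)) (by positivity)
    have hδ : 0 < ε / (1 + K) := by positivity
    set δ := ε / (1 + K) with hδdef
    -- the positive part of an approximation is an approximation as well
    let C : ℝ → ℝ := fun t => max t 0
    have hCL : ∀ s t, |C s - C t| ≤ |s - t| := fun s t => abs_max_sub_max_le_abs _ _ _
    have hC : IsNormalContraction C := ⟨fun s => by simpa [C] using hCL s 0, hCL⟩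
    let g := compRoyden C hC f
    have hgE : G.energy (g : X → ℝ) < ∞ := (G.energy_comp_le hC _).trans_lt hf
    have hg : ∀ p, G.preTrace g p = C (G.preTrace f p) := fun p => Royden.eval_compRoyden _ hC f
    have hφg : ∀ p, |φ p - G.preTrace g p| ≤ δ := fun p => by
      have h1 : φ p = C (φ p) := (max_eq_left (hφ0 p)).symm
      rw [hg, h1]
      exact (hCL _ _).trans (hφf p)
    obtain ⟨k, hk, -⟩ := exists_isHarmonicPart hconn htrans hgE
    obtain ⟨M, hM⟩ := G.bounded_of_mem_roydenAlgebra g.2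
    have hkb := hk.abs_le hconn htrans hM
    have hx := hμ.integral_preTrace hconn htrans g hk
    have hz := hν.integral_preTrace hconn htrans g hk
    have hk0 : ∀ y, 0 ≤ k y := fun y => by
      let k' : G.roydenAlgebra := ⟨k, G.mem_roydenAlgebra_of_bounded hk.energy_lt_top ⟨M, hkb⟩⟩
      have hneg := (IsHarmonicPart.self hk.energy_lt_top hk.orthogonal).smul (-1)
      have h1 := le_of_forall_boundary_le hconn htrans ((-1 : ℝ) • k') hneg.energy_lt_top
        hneg.orthogonal le_rfl (fun p => ?_) y
      · have h2 : (((-1 : ℝ) • k' : G.roydenAlgebra) : X → ℝ) y = -1 * k y := rfl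
        rw [h2] at h1
        linarith
      · have h2 := mem_harmonicBoundary_iff.1 p.2 (g - k') hk.sub_mem
        rw [Royden.eval_sub, sub_eq_zero] at h2
        have h3 := hg p
        simp only [preTrace] at h3 ⊢
        rw [Royden.eval_smul, ← h2, h3]
        have : 0 ≤ C (p.1.eval f) := le_max_right _ _
        linarith
    have hH := hK k ((isHarmonic_iff hconn hk.energy_lt_top).2 hk.orthogonal) hk.energy_lt_top hk0
    have int : ∀ (ρ : Measure G.harmonicBoundary) [IsFiniteMeasure ρ]
        (ψ : C(G.harmonicBoundary, ℝ)), Integrable ψ ρ := fun ρ _ ψ =>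
      ψ.continuous.integrable_of_hasCompactSupport (HasCompactSupport.of_compactSpace _)
    have hclose : ∀ (ρ : Measure G.harmonicBoundary) [IsFiniteMeasure ρ], ρ Set.univ ≤ 1 →
        |∫ p, φ p ∂ρ - ∫ p, G.preTrace g p ∂ρ| ≤ δ := fun ρ _ hρ => by
      have h1 := integral_sub (int ρ φ) (int ρ (boundaryMap g))
      simp only [boundaryMap_apply] at h1
      rw [← h1, ← Real.norm_eq_abs]
      refine (norm_integral_le_of_norm_le_const (Eventually.of_forall hφg)).trans ?_
      refine mul_le_of_le_one_right hδ.le ?_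
      rw [measureReal_def]
      exact ENNReal.toReal_le_of_le_ofReal zero_le_one (by simpa using hρ)
    have h1 := abs_le.1 (hclose μ hμ.mass_le_one)
    have h2 := abs_le.1 (hclose ν hν.mass_le_one)
    rw [hx] at h1
    rw [hz] at h2
    have h3 : ε = δ + K * δ := by rw [hδdef]; field_simp
    nlinarith
  refine ⟨K.toNNReal, ?_⟩
  have hKν : (K.toNNReal : ℝ) = K := Real.coe_toNNReal _ hK0
  -- Urysohn functions vanishing at `p_∞` pass the inequality to compact sets avoiding `p_∞`
  have hcompact : ∀ S : Set G.harmonicBoundary, IsCompact S → Disjoint S G.commonZeros →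
      μ S ≤ (K.toNNReal • ν) S := fun S hS hdisj => by
    refine ENNReal.le_of_forall_pos_le_add fun ε hε _ => ?_
    obtain ⟨U, hSU, hU, hUε⟩ := S.exists_isOpen_le_add (K.toNNReal • ν)
      (ε := ε) (by simpa using hε.ne')
    obtain ⟨φ, hφ0, hφ1, hφ01⟩ := exists_continuous_zero_one_of_isClosed
      ((hU.sdiff isClosed_commonZeros).isClosed_compl) hS.isClosed (by
        rw [Set.disjoint_compl_left_iff_subset]
        exact fun p hp => ⟨hSU hp, fun hpz => Set.disjoint_left.1 hdisj hp hpz⟩)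
    have hφU : ∀ p, φ p ≤ U.indicator 1 p := fun p => by
      by_cases hp : p ∈ U
      · simpa [hp] using (hφ01 p).2
      · rw [hφ0 (fun h => hp h.1)]
        exact Set.indicator_nonneg (fun _ _ => zero_le_one) _
    have hSφ : ∀ p, S.indicator 1 p ≤ φ p := fun p => by
      by_cases hp : p ∈ S
      · simp [hp, hφ1 hp]
      · simpa [hp] using (hφ01 p).1
    have int : ∀ (ρ : Measure G.harmonicBoundary) [IsFiniteMeasure ρ], Integrable φ ρ := fun ρ _ =>
      φ.continuous.integrable_of_hasCompactSupport (HasCompactSupport.of_compactSpace _)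
    have h1 : μ.real S ≤ K * ν.real U := calc
      μ.real S = ∫ p, S.indicator 1 p ∂μ := (integral_indicator_one hS.measurableSet).symm
      _ ≤ ∫ p, φ p ∂μ := integral_mono
        ((integrable_const (1 : ℝ)).indicator hS.measurableSet) (int μ) hSφ
      _ ≤ K * ∫ p, φ p ∂ν := hint φ (fun p => (hφ01 p).1) fun p hp => hφ0 fun h => h.2 hp
      _ ≤ K * ∫ p, U.indicator 1 p ∂ν := mul_le_mul_of_nonneg_left (integral_mono (int ν)
        ((integrable_const (1 : ℝ)).indicator hU.measurableSet) hφU) hK0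
      _ = K * ν.real U := by rw [integral_indicator_one hU.measurableSet]
    refine le_trans ?_ hUε
    rw [Measure.smul_apply, ENNReal.smul_def, smul_eq_mul,
      ← ENNReal.toReal_le_toReal (measure_ne_top _ _)
        (ENNReal.mul_ne_top ENNReal.coe_ne_top (measure_ne_top _ _)), ENNReal.toReal_mul]
    rw [← hKν] at h1
    exact h1
  refine Measure.le_iff.2 fun A hA => ?_
  have h1 : μ A = μ (A \ G.commonZeros) := (measure_sdiff_null hμ.measure_commonZeros).symm
  rw [h1]
  refine le_of_forall_lt fun r hr => ?_
  obtain ⟨S, hSA, hS, hrS⟩ := (hA.diff isClosed_commonZeros.measurableSet).exists_lt_isCompact hr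
  refine hrS.trans_le ((hcompact S hS ?_).trans (measure_mono (hSA.trans Set.sdiff_subset)))
  exact Set.disjoint_left.2 fun p hp => (hSA hp).2

end WeightedGraph

namespace WeightedGraph

variable {X : Type*} {G : WeightedGraph X}

/-! ### Harmonic extensions of square integrable functions -/

theorem tendsto_norm_of_tendsto_enorm_sq {ι E : Type*} [SeminormedAddCommGroup E] {l : Filter ι}
    {u : ι → E} (h : Tendsto (fun i => ‖u i‖ₑ ^ 2) l (𝓝 0)) : Tendsto u l (𝓝 0) := by
  refine tendsto_zero_iff_norm_tendsto_zero.2 (tendsto_of_tendsto_ofReal_sq (h.congr fun i => ?_))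
  rw [← ofReal_norm, ENNReal.ofReal_pow (norm_nonneg _)]

theorem IsHarmonicMeasureAt.exists_integralCLM (hconn : G.Connected) (htrans : G.Transient)
    {x z : X} {μ ν : Measure G.harmonicBoundary} (hμ : G.IsHarmonicMeasureAt x μ)
    (hν : G.IsHarmonicMeasureAt z ν) :
    ∃ H : Lp ℝ 2 ν →L[ℝ] ℝ, ∀ φ : Lp ℝ 2 ν, H φ = ∫ p, φ p ∂μ := by
  obtain ⟨K, hK⟩ := exists_harmonicMeasure_le hconn htrans hμ hν
  have := hν.isFiniteMeasure
  have hac : μ ≪ ν := Measure.absolutelyContinuous_of_le_smul (c := K) hK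
  have hint : ∀ φ : Lp ℝ 2 ν, Integrable φ μ := fun φ =>
    (((Lp.memLp φ).integrable (by norm_num)).smul_measure_nnreal (c := K)).mono_measure hK
  have hbd : ∀ φ : Lp ℝ 2 ν, ‖∫ p, φ p ∂μ‖ₑ ≤ K * ‖φ‖ₑ := fun φ => by
    calc ‖∫ p, φ p ∂μ‖ₑ ≤ ∫⁻ p, ‖φ p‖ₑ ∂μ := enorm_integral_le_lintegral_enorm _
      _ ≤ ∫⁻ p, ‖φ p‖ₑ ∂(K • ν) := lintegral_mono' hK le_rfl
      _ = K * eLpNorm φ 1 ν := by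
        rw [eLpNorm_one_eq_lintegral_enorm, lintegral_smul_measure]; rfl
      _ ≤ K * (eLpNorm φ 2 ν * ν Set.univ ^ (1 / (1 : ℝ≥0∞).toReal - 1 / (2 : ℝ≥0∞).toReal)) := by
        gcongr
        exact eLpNorm_le_eLpNorm_mul_rpow_measure_univ (by norm_num) (Lp.aestronglyMeasurable φ)
      _ ≤ K * (eLpNorm φ 2 ν * 1) := by
        gcongr
        exact ENNReal.rpow_le_one hν.mass_le_one (by norm_num)
      _ = K * ‖φ‖ₑ := by rw [mul_one, Lp.enorm_def]
  refine ⟨LinearMap.mkContinuous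
    { toFun := fun φ => ∫ p, φ p ∂μ
      map_add' := fun φ ψ => ?_
      map_smul' := fun a φ => ?_ } K fun φ => ?_, fun φ => rfl⟩
  · rw [← integral_add (hint φ) (hint ψ)]
    exact integral_congr_ae (hac.ae_le (Lp.coeFn_add φ ψ))
  · rw [RingHom.id_apply, ← integral_smul]
    exact integral_congr_ae (hac.ae_le (Lp.coeFn_smul a φ))
  · have h1 := ENNReal.toReal_mono (ENNReal.mul_ne_top ENNReal.coe_ne_top enorm_ne_top) (hbd φ)
    rwa [ENNReal.toReal_mul, toReal_enorm, toReal_enorm] at h1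

/-- The harmonic extension operator is linear and continuous with respect to pointwise
convergence. -/
theorem exists_harmonicExtensionCLM (hconn : G.Connected) (htrans : G.Transient) (z : X) :
    ∃ H : Lp ℝ 2 (G.harmonicMeasure z) →L[ℝ] (X → ℝ), ∀ φ, H φ = G.harmonicExtension φ := by
  choose H hH using fun x => (isHarmonicMeasureAt_harmonicMeasure hconn htrans x).exists_integralCLM
    hconn htrans (isHarmonicMeasureAt_harmonicMeasure hconn htrans z)
  exact ⟨ContinuousLinearMap.pi H, fun φ => funext fun x => hH x φ⟩

/-! ### Boundary values in `L²` -/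

section BoundaryLp

variable (μ : Measure G.harmonicBoundary) [IsFiniteMeasure μ]

/-- The class in `L²` of the boundary values of an element of `𝒜⁺`. -/
noncomputable def boundaryLp : G.roydenAlgebra →ₗ[ℝ] Lp ℝ 2 μ :=
  (ContinuousMap.toLp 2 μ ℝ).toLinearMap ∘ₗ boundaryMap.toLinearMap

theorem coeFn_boundaryLp (f : G.roydenAlgebra) : boundaryLp μ f =ᵐ[μ] G.preTrace f :=
  ContinuousMap.coeFn_toLp μ (boundaryMap f)

theorem norm_boundaryLp_sq (f : G.roydenAlgebra) :
    ‖boundaryLp μ f‖ ^ 2 = ∫ p, G.preTrace (f * f) p ∂μ := by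
  rw [← real_inner_self_eq_norm_sq, L2.inner_def]
  refine integral_congr_ae ?_
  filter_upwards [coeFn_boundaryLp μ f] with p hp
  rw [hp, real_inner_self_eq_norm_sq, Real.norm_eq_abs, sq_abs, preTrace, preTrace,
    Royden.eval_mul, sq]

theorem boundaryLp_of_mem_vanishing {f : G.roydenAlgebra} (hf : (f : X → ℝ) ∈ G.vanishing) :
    boundaryLp μ f = 0 := by
  refine Lp.ext ?_
  filter_upwards [coeFn_boundaryLp μ f, Lp.coeFn_zero ℝ 2 μ] with p h1 h2
  rw [h1, h2]
  exact mem_harmonicBoundary_iff.1 p.2 f hf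

theorem boundaryLp_compRoyden {C : ℝ → ℝ} (hC : IsNormalContraction C) (f : G.roydenAlgebra) :
    boundaryLp μ (compRoyden C hC f) =ᵐ[μ] fun p => C (boundaryLp μ f p) := by
  filter_upwards [coeFn_boundaryLp μ f, coeFn_boundaryLp μ (compRoyden C hC f)] with p h1 h2
  rw [h1, h2]
  exact Royden.eval_compRoyden _ hC f

variable {μ}

/-- Boundary values of bounded functions of finite energy depend continuously on the function. For
a harmonic function `h` the integral of the boundary values of `h²` with respect to the harmonic
measure at `z` is the value at `z` of the harmonic part of `h²`. -/
theorem IsHarmonicMeasureAt.exists_norm_boundaryLp_le {z : X} (hμ : G.IsHarmonicMeasureAt z μ)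
    (hconn : G.Connected) (htrans : G.Transient) :
    ∃ K : ℝ≥0, ∀ f : G.roydenAlgebra, (f : X → ℝ) ∈ G.finiteEnergy →
      ‖boundaryLp μ f‖ₑ ^ 2 ≤ K * G.normSq z f := by
  have : Nonempty X := ⟨z⟩
  obtain ⟨K₁, hK₁, h1⟩ := exists_harmonicPart_sq_le hconn htrans z
  obtain ⟨K₂, hK₂, h2⟩ := exists_sq_le_energy hconn htrans z
  refine ⟨(2 + 2 * K₂ + K₁).toNNReal, fun f hf => ?_⟩
  obtain ⟨h, hh, -⟩ := exists_isHarmonicPart hconn htrans hf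
  obtain ⟨M, hM⟩ := G.bounded_of_mem_roydenAlgebra f.2
  have hhM := hh.abs_le hconn htrans hM
  let h' : G.roydenAlgebra := ⟨h, G.mem_roydenAlgebra_of_bounded hh.energy_lt_top ⟨M, hhM⟩⟩
  have hfh : boundaryLp μ f = boundaryLp μ h' := by
    have h3 := boundaryLp_of_mem_vanishing μ (f := f - h') hh.sub_mem
    rwa [map_sub, sub_eq_zero] at h3
  have hE : G.energy (h * h) < ∞ := (G.energy_mul_le hhM hhM).trans_lt (ENNReal.add_lt_top.2
    ⟨ENNReal.mul_lt_top ENNReal.ofReal_lt_top hh.energy_lt_top,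
      ENNReal.mul_lt_top ENNReal.ofReal_lt_top hh.energy_lt_top⟩)
  obtain ⟨k, hk, -⟩ := exists_isHarmonicPart hconn htrans hE
  have h4 : ‖boundaryLp μ f‖ ^ 2 = k z := by
    rw [hfh, norm_boundaryLp_sq]
    exact hμ.integral_preTrace hconn htrans (h' * h') hk
  have h5 := h1 h k hh.energy_lt_top hh.orthogonal ⟨M, hhM⟩ hk
  have h6 := h2 _ hh.sub_mem
  have h7 := hh.energy_eq_add
  have h8 : 0 ≤ (G.energy h).toReal := ENNReal.toReal_nonneg
  have h9 : 0 ≤ (G.energy (f - h)).toReal := ENNReal.toReal_nonneg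
  rw [Pi.sub_apply] at h6
  have h10 : ‖boundaryLp μ f‖ ^ 2 ≤
      (2 + 2 * K₂ + K₁) * ((G.energy (f : X → ℝ)).toReal + (f : X → ℝ) z ^ 2) := by
    rw [h4, h7]
    have e1 : h z ^ 2 ≤ 2 * (f : X → ℝ) z ^ 2 + 2 * ((f : X → ℝ) z - h z) ^ 2 := by
      nlinarith [sq_nonneg (2 * (f : X → ℝ) z - h z)]
    nlinarith [mul_nonneg hK₂.le h8, mul_nonneg hK₁ h9, mul_nonneg hK₂.le (sq_nonneg ((f : X → ℝ) z)),
      mul_nonneg hK₁ (sq_nonneg ((f : X → ℝ) z))]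
  rw [← ofReal_norm, ← ENNReal.ofReal_pow (norm_nonneg _)]
  refine (ENNReal.ofReal_le_ofReal h10).trans (le_of_eq ?_)
  rw [ENNReal.ofReal_mul (by positivity), ENNReal.ofReal_add ENNReal.toReal_nonneg (sq_nonneg _),
    ENNReal.ofReal_toReal (ne_of_lt hf)]
  rfl

end BoundaryLp

/-! ### Existence of the trace map -/

/-- Truncation of a function as an element of `𝒜⁺`. -/
noncomputable def truncation (f : G.finiteEnergy) (n : ℕ) : G.roydenAlgebra :=
  ⟨clamp n ∘ (f : X → ℝ), G.mem_roydenAlgebra_of_bounded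
    ((G.energy_comp_le (isNormalContraction_clamp n.cast_nonneg) _).trans_lt f.2)
    ⟨n, fun _ => abs_clamp_le n.cast_nonneg _⟩⟩

theorem truncation_mem (f : G.finiteEnergy) (n : ℕ) : (truncation f n : X → ℝ) ∈ G.finiteEnergy :=
  (G.energy_comp_le (isNormalContraction_clamp n.cast_nonneg) _).trans_lt f.2

theorem tendsto_truncation (f : G.finiteEnergy) :
    Tendsto (fun n => (truncation f n : X → ℝ)) atTop (𝓝 f) := by
  refine tendsto_pi_nhds.2 fun x => tendsto_const_nhds.congr' ?_
  filter_upwards [eventually_ge_atTop ⌈|(f : X → ℝ) x|⌉₊] with n hn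
  exact (clamp_of_abs_le ((Nat.le_ceil _).trans (by exact_mod_cast hn))).symm

theorem tendsto_comp_truncation {C : ℝ → ℝ} (hC : IsNormalContraction C) (f : G.finiteEnergy) :
    Tendsto (fun n => C ∘ (truncation f n : X → ℝ)) atTop (𝓝 (C ∘ f)) :=
  tendsto_pi_nhds.2 fun x => (hC.continuous.tendsto _).comp
    (tendsto_pi_nhds.1 (tendsto_truncation f) x)

/-- Contractions of the truncations of `f` converge in energy, by dominated convergence. -/
theorem tendsto_energy_comp_truncation {C : ℝ → ℝ} (hC : IsNormalContraction C)
    (f : G.finiteEnergy) :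
    Tendsto (fun n => G.energy (C ∘ (truncation f n : X → ℝ) - C ∘ f)) atTop (𝓝 0) := by
  refine G.tendsto_energy_sub (tendsto_comp_truncation hC f) f.2 fun n => ?_
  have h1 := isNormalContraction_clamp (M := (n : ℝ)) n.cast_nonneg
  exact abs_grad_le_of_lipschitz (fun x y => (hC.2 _ _).trans (h1.2 _ _))
    fun x => (hC.1 _).trans (h1.1 _)

theorem tendsto_energy_truncation (f : G.finiteEnergy) :
    Tendsto (fun n => G.energy ((truncation f n : X → ℝ) - f)) atTop (𝓝 0) :=
  tendsto_energy_comp_truncation isNormalContraction_id f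

theorem cauchySeq_boundaryLp_truncation {z : X} {μ : Measure G.harmonicBoundary}
    [IsFiniteMeasure μ] {K : ℝ≥0}
    (hK : ∀ f : G.roydenAlgebra, (f : X → ℝ) ∈ G.finiteEnergy →
      ‖boundaryLp μ f‖ₑ ^ 2 ≤ K * G.normSq z f) (f : G.finiteEnergy) :
    CauchySeq fun n => boundaryLp μ (truncation f n) := by
  have hq := isQuadraticForm_normSq (G := G) z
  have h1 := tendsto_normSq (tendsto_truncation f) (tendsto_energy_truncation f) z
  have h4 : Tendsto (fun p : ℕ × ℕ =>
      (K : ℝ≥0∞) * (2 * (G.normSq z ((truncation f p.1 : X → ℝ) - f) +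
        G.normSq z ((truncation f p.2 : X → ℝ) - f)))) (atTop ×ˢ atTop) (𝓝 0) := by
    have h5 := ENNReal.Tendsto.const_mul (a := (K : ℝ≥0∞)) (ENNReal.Tendsto.const_mul (a := 2)
      ((h1.comp (tendsto_fst (f := atTop) (g := atTop))).add
        (h1.comp (tendsto_snd (f := atTop) (g := atTop))))
      (Or.inr ENNReal.ofNat_ne_top)) (Or.inr ENNReal.coe_ne_top)
    rw [add_zero, mul_zero, mul_zero] at h5
    exact h5
  have h6 : ∀ p : ℕ × ℕ, ‖boundaryLp μ (truncation f p.1) - boundaryLp μ (truncation f p.2)‖ₑ ^ 2 ≤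
      K * (2 * (G.normSq z ((truncation f p.1 : X → ℝ) - f) +
        G.normSq z ((truncation f p.2 : X → ℝ) - f))) := fun p => by
    have h7 := hK (truncation f p.1 - truncation f p.2)
      (G.finiteEnergy.sub_mem (truncation_mem f p.1) (truncation_mem f p.2))
    have h8 := hq.sub_le ((truncation f p.1 : X → ℝ) - f) ((truncation f p.2 : X → ℝ) - f)
    rw [sub_sub_sub_cancel_right] at h8
    rw [map_sub] at h7
    exact h7.trans (mul_le_mul_right h8 (K : ℝ≥0∞))
  rw [cauchySeq_iff_tendsto_dist_atTop_0, ← prod_atTop_atTop_eq]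
  have h9 := (tendsto_norm_of_tendsto_enorm_sq (tendsto_of_tendsto_of_tendsto_of_le_of_le
    tendsto_const_nhds h4 (fun _ => zero_le) h6)).norm
  rw [norm_zero] at h9
  exact h9.congr fun p => (dist_eq_norm _ _).symm

theorem exists_isTraceMap (hconn : G.Connected) (htrans : G.Transient) (z : X) :
    ∃ T, G.IsTraceMap z T := by
  have hμ := isHarmonicMeasureAt_harmonicMeasure hconn htrans z
  have := hμ.isFiniteMeasure
  obtain ⟨K, hK⟩ := hμ.exists_norm_boundaryLp_le hconn htrans
  have hq := isQuadraticForm_normSq (G := G) z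
  set μ := G.harmonicMeasure z
  -- `R f φ` expresses that `φ` is the limit of boundary values of functions converging to `f`
  let R : (X → ℝ) → Lp ℝ 2 μ → Prop := fun f φ =>
    ∃ u : ℕ → G.roydenAlgebra, (∀ n, (u n : X → ℝ) ∈ G.finiteEnergy) ∧
      Tendsto (fun n => G.normSq z ((u n : X → ℝ) - f)) atTop (𝓝 0) ∧
      Tendsto (fun n => boundaryLp μ (u n)) atTop (𝓝 φ)
  have hadd : ∀ {f g φ ψ}, R f φ → R g ψ → R (f + g) (φ + ψ) := by
    rintro f g φ ψ ⟨u, hu, hu1, hu2⟩ ⟨v, hv, hv1, hv2⟩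
    refine ⟨fun n => u n + v n, fun n => G.finiteEnergy.add_mem (hu n) (hv n), ?_, ?_⟩
    · have h1 := ENNReal.Tendsto.const_mul (a := 2) (hu1.add hv1) (Or.inr (by simp))
      rw [add_zero, mul_zero] at h1
      refine tendsto_of_tendsto_of_tendsto_of_le_of_le tendsto_const_nhds h1 (fun _ => zero_le)
        fun n => ?_
      have h2 := hq.add_le ((u n : X → ℝ) - f) ((v n : X → ℝ) - g)
      rwa [← add_sub_add_comm] at h2
    · simpa only [map_add] using hu2.add hv2
  have hsmul : ∀ (a : ℝ) {f φ}, R f φ → R (a • f) (a • φ) := by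
    rintro a f φ ⟨u, hu, hu1, hu2⟩
    refine ⟨fun n => a • u n, fun n => G.finiteEnergy.smul_mem a (hu n), ?_, ?_⟩
    · have h1 := ENNReal.Tendsto.const_mul (a := ENNReal.ofReal (a ^ 2)) hu1 (Or.inr (by simp))
      rw [mul_zero] at h1
      refine h1.congr fun n => ?_
      rw [← hq.smul, smul_sub]
      rfl
    · simpa only [map_smul] using hu2.const_smul a
  have hbd : ∀ {f φ}, R f φ → G.normSq z f < ∞ → ‖φ‖ₑ ^ 2 ≤ K * G.normSq z f := by
    rintro f φ ⟨u, hu, hu1, hu2⟩ hf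
    have h1 : Tendsto (fun n => G.normSq z (u n)) atTop (𝓝 (G.normSq z f)) := by
      refine hq.tendsto_of_tendsto_sub (u := fun _ => f) (fun _ => hf)
        (fun n => ENNReal.add_lt_top.2 ⟨hu n, ENNReal.ofReal_lt_top⟩) ?_ hf tendsto_const_nhds
      exact hu1.congr fun n => hq.sub_comm _ _
    refine le_of_tendsto_of_tendsto' (((ENNReal.continuous_pow 2).tendsto _).comp
      ((continuous_enorm.tendsto φ).comp hu2))
      (ENNReal.Tendsto.const_mul h1 (Or.inr ENNReal.coe_ne_top)) fun n => hK (u n) (hu n)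
  have huniq : ∀ {f φ ψ}, R f φ → R f ψ → φ = ψ := by
    intro f φ ψ h1 h2
    have h3 := hadd h1 (hsmul (-1) h2)
    rw [neg_one_smul, neg_one_smul, add_neg_cancel] at h3
    have h4 := hbd h3 (by rw [hq.map_zero]; exact ENNReal.zero_lt_top)
    rw [hq.map_zero, mul_zero] at h4
    have h5 : ‖φ + -ψ‖ₑ = 0 := by simpa using h4
    rw [enorm_eq_zero, add_neg_eq_zero] at h5
    exact h5
  have hex : ∀ f : G.finiteEnergy, ∃ φ, R f φ := fun f => by
    have h1 := tendsto_normSq (tendsto_truncation f) (tendsto_energy_truncation f) z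
    have h2 := cauchySeq_boundaryLp_truncation hK f
    obtain ⟨φ, hφ⟩ := cauchySeq_tendsto_of_complete h2
    exact ⟨φ, truncation f, truncation_mem f, h1, hφ⟩
  choose T hT using hex
  refine ⟨{ toFun := T
            map_add' := fun f g => huniq (hT (f + g)) (hadd (hT f) (hT g))
            map_smul' := fun a f => huniq (hT (a • f)) (hsmul a (hT f)) }, fun o => ?_,
    fun f hf => ?_⟩
  · obtain ⟨K', hK'⟩ := exists_sq_le_normSq hconn o z
    refine ⟨K * (1 + K'), fun f => ?_⟩
    refine (hbd (hT f) (ENNReal.add_lt_top.2 ⟨f.2, ENNReal.ofReal_lt_top⟩)).trans ?_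
    rw [ENNReal.coe_mul, mul_assoc]
    refine mul_le_mul_right ?_ _
    rw [normSq, ENNReal.coe_add, add_mul, ENNReal.coe_one, one_mul]
    exact add_le_add le_self_add (hK' f)
  · have h1 : R f (boundaryLp μ f) :=
      ⟨fun _ => f, fun _ => hf, by simp [hq.map_zero], tendsto_const_nhds⟩
    have h2 : T ⟨f, hf⟩ = boundaryLp μ f := huniq (hT ⟨f, hf⟩) h1
    show T ⟨f, hf⟩ =ᵐ[μ] G.preTrace f
    rw [h2]
    exact coeFn_boundaryLp μ f

theorem isTraceMap_traceMap (hconn : G.Connected) (htrans : G.Transient) (z : X) :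
    G.IsTraceMap z (G.traceMap z) := by
  have h := exists_isTraceMap hconn htrans z
  rw [traceMap, dif_pos h]
  exact h.choose_spec

/-! ### Properties of the trace map -/

namespace IsTraceMap

variable {z : X} {T : G.finiteEnergy →ₗ[ℝ] Lp ℝ 2 (G.harmonicMeasure z)}

theorem tendsto (hT : G.IsTraceMap z T) {u : ℕ → G.finiteEnergy} {f : G.finiteEnergy}
    (h1 : Tendsto (fun n => (u n : X → ℝ)) atTop (𝓝 f))
    (h2 : Tendsto (fun n => G.energy ((u n : X → ℝ) - f)) atTop (𝓝 0)) :
    Tendsto (fun n => T (u n)) atTop (𝓝 (T f)) := by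
  obtain ⟨K, hK⟩ := hT.continuous z
  have h3 := ENNReal.Tendsto.const_mul (a := K) (tendsto_normSq h1 h2 z) (Or.inr (by simp))
  rw [mul_zero] at h3
  have h4 : Tendsto (fun n => T (u n - f)) atTop (𝓝 0) :=
    tendsto_norm_of_tendsto_enorm_sq (tendsto_of_tendsto_of_tendsto_of_le_of_le tendsto_const_nhds
      h3 (fun _ => zero_le) fun n => hK (u n - f))
  have h5 := h4.add_const (T f)
  simpa using h5

theorem eq_boundaryLp [IsFiniteMeasure (G.harmonicMeasure z)] (hT : G.IsTraceMap z T)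
    (f : G.roydenAlgebra) (hf : (f : X → ℝ) ∈ G.finiteEnergy) :
    T ⟨f, hf⟩ = boundaryLp (G.harmonicMeasure z) f :=
  Lp.ext ((hT.extends_preTrace f hf).trans (coeFn_boundaryLp _ f).symm)

theorem apply_of_mem_vanishing (hT : G.IsTraceMap z T) (hconn : G.Connected)
    (htrans : G.Transient) {f : G.finiteEnergy} (hf : (f : X → ℝ) ∈ G.vanishing) : T f = 0 := by
  have : Nonempty X := ⟨z⟩
  have := (isHarmonicMeasureAt_harmonicMeasure hconn htrans z).isFiniteMeasure
  obtain ⟨φ, hφ, h1, h2⟩ := exists_tendsto_of_mem_vanishing hconn hf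
  have hφb : ∀ n, ∃ M : ℝ, ∀ x, |φ n x| ≤ M := fun n => by
    obtain ⟨M, hM⟩ := (((hφ n).image fun x => |φ n x|).insert 0).bddAbove
    refine ⟨M, fun x => ?_⟩
    by_cases hx : φ n x = 0
    · rw [hx, abs_zero]
      exact hM (Set.mem_insert _ _)
    · exact hM (Set.mem_insert_of_mem _ ⟨x, hx, rfl⟩)
  have hV := fun n => mem_vanishing_of_finite_support (G := G) (hφ n)
  have h3 := hT.tendsto (u := fun n => ⟨φ n, (hV n).1⟩) (f := f) h1 h2
  refine tendsto_nhds_unique h3 (tendsto_const_nhds.congr fun n => ?_)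
  have h4 := hT.eq_boundaryLp ⟨φ n, G.mem_roydenAlgebra_of_bounded (hV n).1 (hφb n)⟩ (hV n).1
  exact (h4.trans (boundaryLp_of_mem_vanishing _ (hV n))).symm

/-- The harmonic extension of the trace is the harmonic part. -/
theorem harmonicExtension_eq (hT : G.IsTraceMap z T) (hconn : G.Connected)
    (htrans : G.Transient) {f : G.finiteEnergy} {h : X → ℝ} (hh : G.IsHarmonicPart f h) :
    G.harmonicExtension (T f) = h := by
  have : Nonempty X := ⟨z⟩
  have hμ := isHarmonicMeasureAt_harmonicMeasure hconn htrans z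
  have := hμ.isFiniteMeasure
  obtain ⟨H, hH⟩ := exists_harmonicExtensionCLM hconn htrans z
  rw [← hH]
  have h1 := (H.continuous.tendsto _).comp
    (hT.tendsto (u := fun n => ⟨_, truncation_mem f n⟩) (tendsto_truncation f)
      (tendsto_energy_truncation f))
  choose k hk hkmin using fun n => exists_isHarmonicPart hconn htrans (truncation_mem f n)
  have h2 : ∀ n, H (T ⟨_, truncation_mem f n⟩) = k n := fun n => by
    rw [hH]
    funext x
    have hμx := isHarmonicMeasureAt_harmonicMeasure hconn htrans x
    rw [← hμx.integral_preTrace hconn htrans (truncation f n) (hk n)]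
    obtain ⟨K, hK⟩ := exists_harmonicMeasure_le hconn htrans hμx hμ
    exact integral_congr_ae ((Measure.absolutelyContinuous_of_le_smul (c := K) hK).ae_le
      (hT.extends_preTrace _ (truncation_mem f n)))
  refine tendsto_nhds_unique h1 ?_
  simp only [Function.comp_def, h2]
  -- the harmonic part depends continuously on the function
  have h3 : ∀ n, G.IsHarmonicPart ((truncation f n : X → ℝ) - f) (k n - h) := fun n => by
    have := (hk n).add (hh.smul (-1))
    rwa [neg_one_smul, neg_one_smul, ← sub_eq_add_neg, ← sub_eq_add_neg] at this
  refine tendsto_of_tendsto_normSq hconn z ?_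
  obtain ⟨K, -, hK⟩ := exists_sq_le_energy hconn htrans z
  have h4 := tendsto_energy_truncation f
  have h5 : ∀ n, G.energy (k n - h) ≤ G.energy ((truncation f n : X → ℝ) - f) := fun n => by
    have hlt := G.isQuadraticForm_energy.sub_lt_top (truncation_mem f n) f.2
    rw [← ENNReal.toReal_le_toReal (h3 n).energy_lt_top.ne hlt.ne, (h3 n).energy_eq_add]
    exact le_add_of_nonneg_right ENNReal.toReal_nonneg
  have h6 : ∀ n, ((truncation f n : X → ℝ) - f - (k n - h)) z ^ 2 ≤
      K * (G.energy ((truncation f n : X → ℝ) - f - (k n - h))).toReal := fun n =>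
    hK _ (h3 n).sub_mem
  have h7 : Tendsto (fun n => G.energy (k n - h)) atTop (𝓝 0) :=
    tendsto_of_tendsto_of_tendsto_of_le_of_le tendsto_const_nhds h4 (fun _ => zero_le) h5
  have h8 : Tendsto (fun n => (G.energy ((truncation f n : X → ℝ) - f - (k n - h))).toReal) atTop
      (𝓝 0) := by
    have h9 := (ENNReal.tendsto_toReal ENNReal.zero_ne_top).comp h4
    refine squeeze_zero (fun _ => ENNReal.toReal_nonneg) (fun n => ?_) h9
    have h10 := (h3 n).energy_eq_add
    have h11 : 0 ≤ (G.energy (k n - h)).toReal := ENNReal.toReal_nonneg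
    simp only [Function.comp_apply]
    linarith
  have h9 : Tendsto (fun n => ((truncation f n : X → ℝ) - f - (k n - h)) z) atTop (𝓝 0) := by
    have h10 := h8.const_mul K
    rw [mul_zero] at h10
    have h11 := squeeze_zero (fun _ => sq_nonneg _) h6 h10
    have h12 := (ENNReal.continuous_ofReal.tendsto _).comp h11
    rw [ENNReal.ofReal_zero] at h12
    exact tendsto_of_tendsto_ofReal_sq h12
  have h10 : Tendsto (fun n => (k n - h) z) atTop (𝓝 0) := by
    have h11 := (tendsto_pi_nhds.1 (tendsto_truncation f) z).sub_const ((f : X → ℝ) z)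
    have h12 := h11.sub h9
    rw [sub_self, sub_zero] at h12
    refine h12.congr fun n => ?_
    simp only [Pi.sub_apply]
    ring
  have h11 := (ENNReal.continuous_ofReal.tendsto _).comp (h10.pow 2)
  simpa [normSq] using h7.add h11

theorem eq_of_isHarmonicPart (hT : G.IsTraceMap z T) (hconn : G.Connected)
    (htrans : G.Transient) {f h : G.finiteEnergy} (hh : G.IsHarmonicPart f (h : X → ℝ)) :
    T f = T h := by
  have h1 := hT.apply_of_mem_vanishing hconn htrans (f := f - h) hh.sub_mem
  rwa [map_sub, sub_eq_zero] at h1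

/-- The trace map commutes with normal contractions. -/
theorem comp_ae_eq (hT : G.IsTraceMap z T) (hconn : G.Connected) (htrans : G.Transient)
    {C : ℝ → ℝ} (hC : IsNormalContraction C) (f : G.finiteEnergy) :
    T ⟨C ∘ f, (G.energy_comp_le hC _).trans_lt f.2⟩ =ᵐ[G.harmonicMeasure z]
      fun p => C (T f p) := by
  have := (isHarmonicMeasureAt_harmonicMeasure hconn htrans z).isFiniteMeasure
  have hL := hC.lipschitzWith
  have hn : ∀ n, C ∘ (truncation f n : X → ℝ) ∈ G.finiteEnergy := fun n =>
    (G.energy_comp_le hC _).trans_lt (truncation_mem f n)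
  have h1 := hT.tendsto (u := fun n => ⟨_, hn n⟩)
    (f := ⟨C ∘ f, (G.energy_comp_le hC _).trans_lt f.2⟩)
    (tendsto_comp_truncation hC f) (tendsto_energy_comp_truncation hC f)
  have h2 := ((LipschitzWith.continuous_compLp (p := 2) (μ := G.harmonicMeasure z) hL
    hC.map_zero).tendsto _).comp
    (hT.tendsto (u := fun n => ⟨_, truncation_mem f n⟩) (tendsto_truncation f)
      (tendsto_energy_truncation f))
  have h3 : ∀ n, T ⟨_, hn n⟩ = hL.compLp hC.map_zero (T ⟨_, truncation_mem f n⟩) := fun n => by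
    rw [hT.eq_boundaryLp (truncation f n) (truncation_mem f n)]
    refine (hT.eq_boundaryLp (compRoyden C hC (truncation f n)) (hn n)).trans (Lp.ext ?_)
    exact (boundaryLp_compRoyden _ hC _).trans
      (LipschitzWith.coeFn_compLp hL hC.map_zero _).symm
  have h4 : T ⟨C ∘ f, (G.energy_comp_le hC _).trans_lt f.2⟩ = hL.compLp hC.map_zero (T f) :=
    tendsto_nhds_unique h1 (h2.congr fun n => (h3 n).symm)
  rw [h4]
  exact LipschitzWith.coeFn_compLp hL hC.map_zero _

end IsTraceMap

end WeightedGraph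

/-! ### Square summable functions on a discrete space -/

section VertexMeasure

variable {X : Type*} [Countable X] [MeasurableSpace X] [DiscreteMeasurableSpace X] {m : X → ℝ}

theorem ae_vertexMeasure_iff (hm : ∀ x, 0 < m x) {P : X → Prop} :
    (∀ᵐ x ∂vertexMeasure m, P x) ↔ ∀ x, P x := by
  have h : ∀ x, (∀ᵐ y ∂(ENNReal.ofReal (m x) • Measure.dirac x), P y) ↔ P x := fun x => by
    have hx : ENNReal.ofReal (m x) ≠ 0 := by simpa using hm x
    simp [hx]
  rw [vertexMeasure, Measure.ae_sum_iff]
  simp only [h]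

theorem lintegral_vertexMeasure (f : X → ℝ≥0∞) :
    ∫⁻ x, f x ∂vertexMeasure m = ∑' x, ENNReal.ofReal (m x) * f x := by
  simp [vertexMeasure, lintegral_sum_measure, lintegral_smul_measure]

theorem eLpNorm_two_sq {α : Type*} [MeasurableSpace α] {μ : Measure α} (f : α → ℝ) :
    eLpNorm f 2 μ ^ 2 = ∫⁻ x, ‖f x‖ₑ ^ 2 ∂μ := by
  have := eLpNorm_nnreal_pow_eq_lintegral (f := f) (μ := μ) (p := 2) (by norm_num)
  simpa using this

theorem enorm_sq_eq_lintegral {α : Type*} [MeasurableSpace α] {μ : Measure α} (f : Lp ℝ 2 μ) :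
    ‖f‖ₑ ^ 2 = ∫⁻ x, ‖f x‖ₑ ^ 2 ∂μ := by
  rw [Lp.enorm_def, eLpNorm_two_sq]

/-- Evaluation of classes in `ℓ²(X, m)`, which have a single representative since `m > 0`. -/
noncomputable def evalLp (hm : ∀ x, 0 < m x) : Lp ℝ 2 (vertexMeasure m) →ₗ[ℝ] X → ℝ where
  toFun u := u
  map_add' u v := funext ((ae_vertexMeasure_iff hm).1 (Lp.coeFn_add u v))
  map_smul' a u := funext ((ae_vertexMeasure_iff hm).1 (Lp.coeFn_smul a u))

theorem evalLp_apply (hm : ∀ x, 0 < m x) (u : Lp ℝ 2 (vertexMeasure m)) :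
    evalLp hm u = u := rfl

theorem evalLp_injective (hm : ∀ x, 0 < m x) : Function.Injective (evalLp hm) := fun _ _ h =>
  Lp.ext ((ae_vertexMeasure_iff hm).2 fun x => congrFun h x)

theorem tendsto_evalLp (hm : ∀ x, 0 < m x) {u : ℕ → Lp ℝ 2 (vertexMeasure m)}
    {f : Lp ℝ 2 (vertexMeasure m)} (h : Tendsto u atTop (𝓝 f)) :
    Tendsto (fun n => evalLp hm (u n)) atTop (𝓝 (evalLp hm f)) := by
  refine tendsto_pi_nhds.2 fun x => ?_
  have h1 : ∀ v : Lp ℝ 2 (vertexMeasure m), ENNReal.ofReal (m x) * ‖v x‖ₑ ^ 2 ≤ ‖v‖ₑ ^ 2 := fun v => by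
    rw [enorm_sq_eq_lintegral, lintegral_vertexMeasure]
    exact ENNReal.le_tsum (f := fun x => ENNReal.ofReal (m x) * ‖v x‖ₑ ^ 2) x
  have hx : ENNReal.ofReal (m x) ≠ 0 := by simpa using hm x
  have h2 : Tendsto (fun n => (ENNReal.ofReal (m x))⁻¹ * ‖u n - f‖ₑ ^ 2) atTop (𝓝 0) := by
    have h3 : Tendsto (fun n => u n - f) atTop (𝓝 0) := tendsto_sub_nhds_zero_iff.2 h
    have h4 := ((ENNReal.continuous_pow 2).tendsto _).comp ((continuous_enorm.tendsto _).comp h3)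
    have h5 := ENNReal.Tendsto.const_mul (a := (ENNReal.ofReal (m x))⁻¹) h4
      (Or.inr (ENNReal.inv_ne_top.2 hx))
    simpa using h5
  have h6 : Tendsto (fun n => (evalLp hm (u n - f)) x) atTop (𝓝 0) := by
    refine WeightedGraph.tendsto_norm_of_tendsto_enorm_sq ?_
    refine tendsto_of_tendsto_of_tendsto_of_le_of_le tendsto_const_nhds h2 (fun _ => zero_le)
      fun n => ?_
    rw [mul_comm, ← div_eq_mul_inv,
      ENNReal.le_div_iff_mul_le (Or.inl hx) (Or.inl ENNReal.ofReal_ne_top), mul_comm]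
    exact h1 _
  simp only [map_sub, Pi.sub_apply] at h6
  exact tendsto_sub_nhds_zero_iff.1 h6

theorem exists_evalLp_eq (hm : ∀ x, 0 < m x) {f : X → ℝ}
    (hf : ∑' x, ENNReal.ofReal (m x) * ‖f x‖ₑ ^ 2 < ∞) :
    ∃ u : Lp ℝ 2 (vertexMeasure m), evalLp hm u = f := by
  have h1 : MemLp f 2 (vertexMeasure m) := by
    refine ⟨(measurable_of_countable f).aestronglyMeasurable, ?_⟩
    rw [← lintegral_vertexMeasure, ← eLpNorm_two_sq] at hf
    exact lt_of_le_of_ne le_top fun h => by simp [h] at hf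
  exact ⟨h1.toLp f, funext ((ae_vertexMeasure_iff hm).1 h1.coeFn_toLp)⟩

theorem exists_evalLp_eq_of_finite_support (hm : ∀ x, 0 < m x) {f : X → ℝ}
    (hf : (Function.support f).Finite) : ∃ u : Lp ℝ 2 (vertexMeasure m), evalLp hm u = f := by
  refine exists_evalLp_eq hm ?_
  rw [tsum_eq_sum (s := hf.toFinset) fun x hx => by
    have : f x = 0 := by simpa using hx
    simp [this]]
  exact ENNReal.sum_lt_top.2 fun x _ => ENNReal.mul_lt_top ENNReal.ofReal_lt_top
    (ENNReal.pow_lt_top enorm_lt_top)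

/-- The inclusion of the finitely supported functions into `ℓ²(X, m)`. -/
noncomputable def finsuppLp (hm : ∀ x, 0 < m x) : (X →₀ ℝ) →ₗ[ℝ] Lp ℝ 2 (vertexMeasure m) :=
  have h := fun φ : X →₀ ℝ => exists_evalLp_eq_of_finite_support hm φ.hasFiniteSupport
  { toFun := fun φ => (h φ).choose
    map_add' := fun φ ψ => evalLp_injective hm <| by
      rw [map_add, (h _).choose_spec, (h _).choose_spec, (h _).choose_spec, Finsupp.coe_add]
    map_smul' := fun a φ => evalLp_injective hm <| by
      rw [map_smul, (h _).choose_spec, (h _).choose_spec, Finsupp.coe_smul, RingHom.id_apply] }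

theorem evalLp_finsuppLp (hm : ∀ x, 0 < m x) (φ : X →₀ ℝ) : evalLp hm (finsuppLp hm φ) = φ :=
  (exists_evalLp_eq_of_finite_support hm φ.hasFiniteSupport).choose_spec

/-- Finitely supported functions are dense in `ℓ²(X, m)`. -/
theorem exists_finsuppLp_tendsto (hm : ∀ x, 0 < m x) (u : Lp ℝ 2 (vertexMeasure m)) :
    ∃ φ : ℕ → X →₀ ℝ, Tendsto (fun n => finsuppLp hm (φ n)) atTop (𝓝 u) := by
  classical
  obtain ⟨s, hs⟩ := exists_seq_tendsto (atTop : Filter (Finset X))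
  let φ : ℕ → X →₀ ℝ := fun n => Finsupp.onFinset (s n) (fun x => if x ∈ s n then u x else 0)
    fun x hx => by by_contra h; simp [h] at hx
  refine ⟨φ, tendsto_sub_nhds_zero_iff.1 (WeightedGraph.tendsto_norm_of_tendsto_enorm_sq ?_)⟩
  have h1 : ∀ n x, (finsuppLp hm (φ n) - u : Lp ℝ 2 (vertexMeasure m)) x = φ n x - u x :=
    fun n x => by
      rw [← evalLp_apply hm, map_sub, evalLp_finsuppLp]
      rfl
  simp only [enorm_sq_eq_lintegral, h1]
  have h2 := tendsto_lintegral_of_dominated_convergence (μ := vertexMeasure m)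
    (F := fun n x => ‖φ n x - u x‖ₑ ^ 2) (f := fun _ => 0) (fun x => ‖u x‖ₑ ^ 2)
    (fun n => measurable_of_countable _) (fun n => ae_of_all _ fun x => ?_) ?_
    (ae_of_all _ fun x => ?_)
  · simpa using h2
  · show ‖(if x ∈ s n then u x else 0) - u x‖ₑ ^ 2 ≤ _
    split_ifs <;> simp
  · rw [← enorm_sq_eq_lintegral]
    exact (ENNReal.pow_lt_top enorm_lt_top).ne
  · refine tendsto_const_nhds.congr' ?_
    filter_upwards [hs.eventually (eventually_ge_atTop {x})] with n hn
    have : x ∈ s n := hn (Finset.mem_singleton_self x)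
    simp [φ, this]

end VertexMeasure

/-! ### Markovian forms on finitely supported functions are energies of graphs -/

namespace WeightedGraph

variable {X : Type*}

theorem laplacian_single_self [DecidableEq X] (G : WeightedGraph X) (x : X) :
    G.laplacian (Pi.single x 1) x = ∑' y, G.b x y + G.c x := by
  rw [laplacian, Pi.single_eq_same, mul_one]
  congr 1
  refine tsum_congr fun y => ?_
  by_cases h : y = x
  · simp [h, G.b_diag]
  · simp [Pi.single_eq_of_ne h]

theorem laplacian_single_of_ne [DecidableEq X] (G : WeightedGraph X) {x y : X} (h : y ≠ x) :
    G.laplacian (Pi.single x 1) y = -G.b x y := by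
  rw [laplacian, Pi.single_eq_of_ne h, mul_zero, add_zero, tsum_eq_single x fun z hz => by
    simp [Pi.single_eq_of_ne hz]]
  simp [G.b_symm y x]

/-- A bilinear form on the finitely supported functions is determined by the associated matrix. -/
theorem energy_eq_of_matrix_eq [DecidableEq X] (G : WeightedGraph X)
    (B : (X →₀ ℝ) →ₗ[ℝ] (X →₀ ℝ) →ₗ[ℝ] ℝ)
    (h : ∀ x y, B (Finsupp.single x 1) (Finsupp.single y 1) = G.laplacian (Pi.single x 1) y)
    (φ : X →₀ ℝ) : (G.energy φ).toReal = B φ φ := by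
  have hfin : ∀ φ : X →₀ ℝ, G.energy φ < ∞ := fun φ =>
    energy_lt_top_of_finite_support φ.hasFiniteSupport
  have hs : ∀ (x : X) (a : ℝ), (Finsupp.single x a : X →₀ ℝ) = a • Finsupp.single x 1 := by simp
  have hc : ∀ x : X, ((Finsupp.single x 1 : X →₀ ℝ) : X → ℝ) = Pi.single x 1 :=
    fun x => Finsupp.single_eq_pi_single x 1
  have key : ∀ φ ψ : X →₀ ℝ, G.energyForm φ ψ = B φ ψ := fun φ ψ => by
    induction φ using Finsupp.induction_linear with
    | zero =>
      have := G.energyForm_smul_left 0 0 ψ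
      simpa using this
    | add f g hf hg =>
      rw [Finsupp.coe_add, energyForm_add_left (hfin f) (hfin g) (hfin ψ), hf, hg, map_add,
        LinearMap.add_apply]
    | single x a =>
      rw [hs, Finsupp.coe_smul, energyForm_smul_left, map_smul, LinearMap.smul_apply, smul_eq_mul]
      congr 1
      induction ψ using Finsupp.induction_linear with
      | zero =>
        have := G.energyForm_smul_right 0 (Finsupp.single x 1 : X →₀ ℝ) 0
        simpa using this
      | add f g hf hg =>
        rw [Finsupp.coe_add, energyForm_add_right (hfin _) (hfin f) (hfin g), hf, hg, map_add]
      | single y a =>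
        rw [hs y a, Finsupp.coe_smul, energyForm_smul_right, map_smul, smul_eq_mul, h, hc, hc,
          energyForm_single (energy_single_lt_top x)]
  rw [toReal_energy, key]

/-- A finite Markovian form on the finitely supported functions is the energy of a weighted
graph. The edge weights are the negative off-diagonal entries of its matrix. -/
theorem exists_energy_eq {q : (X →₀ ℝ) → ℝ≥0∞} (hq : IsQuadraticForm q) (hfin : ∀ φ, q φ < ∞)
    (hM : ∀ C, IsNormalContraction C → ∀ φ ψ : X →₀ ℝ, (ψ : X → ℝ) = C ∘ φ → q ψ ≤ q φ) :
    ∃ G : WeightedGraph X, ∀ φ : X →₀ ℝ, G.energy φ = q φ := by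
  classical
  obtain ⟨D, B₀, hsymm, hnonneg, hB₀, hoff⟩ := hq
  have hD : ∀ φ, φ ∈ D := fun φ => by
    by_contra h
    exact (hfin φ).ne (hoff φ h)
  let L : (X →₀ ℝ) →ₗ[ℝ] D := LinearMap.codRestrict D LinearMap.id hD
  let B : (X →₀ ℝ) →ₗ[ℝ] (X →₀ ℝ) →ₗ[ℝ] ℝ := B₀.compl₁₂ L L
  have hB : ∀ φ, q φ = ENNReal.ofReal (B φ φ) := fun φ => hB₀ (L φ)
  have hs : ∀ φ ψ, B φ ψ = B ψ φ := fun φ ψ => hsymm _ _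
  have hn : ∀ φ, 0 ≤ B φ φ := fun φ => hnonneg _
  have hle : ∀ C, IsNormalContraction C → ∀ φ ψ : X →₀ ℝ, (ψ : X → ℝ) = C ∘ φ → B ψ ψ ≤ B φ φ :=
    fun C hC φ ψ h => by
      have := hM C hC φ ψ h
      rwa [hB, hB, ENNReal.ofReal_le_ofReal_iff (hn φ)] at this
  let e : X → X →₀ ℝ := fun x => Finsupp.single x 1
  -- off-diagonal entries are nonpositive: contract `e x - e y` by the absolute value
  have hoffdiag : ∀ x y, x ≠ y → B (e x) (e y) ≤ 0 := fun x y hxy => by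
    have h1 := hle (fun r => |r|) ⟨fun r => (abs_abs r).le, fun r s => abs_abs_sub_abs_le_abs_sub r s⟩
      (e x - e y) (e x + e y) (by
        funext w
        by_cases hx : w = x
        · subst hx
          simp [e, hxy.symm]
        · by_cases hy : w = y
          · subst hy
            simp [e, hxy]
          · simp [e, Ne.symm hx, Ne.symm hy])
    simp only [map_add, map_sub, LinearMap.add_apply, LinearMap.sub_apply] at h1
    have := hs (e x) (e y)
    linarith
  -- partial row sums are nonnegative: truncate `1_s + t • e x` at level one and let `t → 0`
  have hrow : ∀ (x : X) (s : Finset X), x ∈ s → 0 ≤ ∑ y ∈ s, B (e x) (e y) := fun x s hx => by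
    have hv : ∀ w, (∑ y ∈ s, e y) w = if w ∈ s then 1 else 0 := fun w => by
      simp [e, Finsupp.finsetSum_apply, Finsupp.single_apply]
    have h1 : ∀ t : ℝ, 0 < t → 0 ≤ 2 * B (e x) (∑ y ∈ s, e y) + t * B (e x) (e x) := fun t ht => by
      have h2 := hle (clamp 1) (isNormalContraction_clamp zero_le_one)
        (∑ y ∈ s, e y + t • e x) (∑ y ∈ s, e y) (by
          funext w
          rw [hv, Function.comp_apply, Finsupp.add_apply, hv, Finsupp.smul_apply]
          by_cases hw : w = x
          · subst hw
            simp only [hx, if_true, e, Finsupp.single_eq_same, smul_eq_mul, mul_one, clamp]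
            rw [min_eq_right (by linarith), max_eq_left (by norm_num)]
          · rw [Finsupp.single_eq_of_ne hw, smul_zero, add_zero, clamp_of_abs_le]
            split_ifs <;> simp)
      simp only [map_add, map_smul, LinearMap.add_apply, LinearMap.smul_apply, smul_eq_mul,
        hs (∑ y ∈ s, e y) (e x)] at h2
      nlinarith
    have h2 : Tendsto (fun t : ℝ => 2 * B (e x) (∑ y ∈ s, e y) + t * B (e x) (e x)) (𝓝[>] 0)
        (𝓝 (2 * B (e x) (∑ y ∈ s, e y))) := by
      have h3 : Continuous fun t : ℝ =>
        2 * B (e x) (∑ y ∈ s, e y) + t * B (e x) (e x) := by fun_prop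
      have h4 := (h3.tendsto 0).mono_left (nhdsWithin_le_nhds (s := Set.Ioi 0))
      simpa using h4
    have h3 := ge_of_tendsto h2 (eventually_mem_nhdsWithin.mono fun t ht => h1 t ht)
    rw [map_sum] at h3
    linarith
  let b : X → X → ℝ := fun x y => if x = y then 0 else -B (e x) (e y)
  have hb0 : ∀ x y, 0 ≤ b x y := fun x y => by
    by_cases h : x = y
    · simp [b, h]
    · simpa [b, h] using hoffdiag x y h
  have hsum : ∀ (x : X) (s : Finset X), ∑ y ∈ s, b x y ≤ B (e x) (e x) := fun x s => by
    have h1 := hrow x (insert x s) (Finset.mem_insert_self x s)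
    rw [← Finset.insert_erase (Finset.mem_insert_self x s),
      Finset.sum_insert (Finset.notMem_erase _ _)] at h1
    have h2 : ∑ y ∈ (insert x s).erase x, b x y = -∑ y ∈ (insert x s).erase x, B (e x) (e y) := by
      rw [← Finset.sum_neg_distrib]
      exact Finset.sum_congr rfl fun y hy => if_neg (Finset.ne_of_mem_erase hy).symm
    have h3 : ∑ y ∈ s, b x y ≤ ∑ y ∈ insert x s, b x y :=
      Finset.sum_le_sum_of_subset_of_nonneg (Finset.subset_insert _ _) fun y _ _ => hb0 x y
    have h4 : ∑ y ∈ insert x s, b x y = ∑ y ∈ (insert x s).erase x, b x y := by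
      rw [← Finset.add_sum_erase _ _ (Finset.mem_insert_self x s)]
      simp [b]
    linarith
  have hbs : ∀ x, Summable (b x) := fun x => summable_of_sum_le (hb0 x) (hsum x)
  let G : WeightedGraph X :=
    { b := b
      c := fun x => B (e x) (e x) - ∑' y, b x y
      b_nonneg := hb0
      b_symm := fun x y => by simp only [b, eq_comm (a := x), hs (e x)]
      b_diag := fun x => if_pos rfl
      b_summable := hbs
      c_nonneg := fun x => sub_nonneg.2 ((hbs x).tsum_le_of_sum_le (hsum x)) }
  refine ⟨G, fun φ => ?_⟩
  rw [hB, ← G.energy_eq_of_matrix_eq B (fun x y => ?_) φ, ENNReal.ofReal_toReal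
    (energy_lt_top_of_finite_support φ.hasFiniteSupport).ne]
  by_cases h : y = x
  · subst h
    rw [laplacian_single_self]
    show B (e y) (e y) = ∑' w, b y w + (B (e y) (e y) - ∑' w, b y w)
    ring
  · rw [laplacian_single_of_ne _ h]
    show B (e x) (e y) = -b x y
    simp [b, Ne.symm h]

end WeightedGraph

/-! ### Lower semicontinuity of Dirichlet forms for pointwise convergence -/

section Semicontinuity

variable {X : Type*} [MeasurableSpace X] {μ : Measure X}

theorem isQuadraticForm_enorm_sq : IsQuadraticForm fun u : Lp ℝ 2 μ => ‖u‖ₑ ^ 2 := by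
  refine ⟨⊤, (innerₗ (Lp ℝ 2 μ)).compl₁₂ (Submodule.subtype _) (Submodule.subtype _),
    fun f g => real_inner_comm (g : Lp ℝ 2 μ) (f : Lp ℝ 2 μ),
    fun f => real_inner_self_nonneg (x := (f : Lp ℝ 2 μ)), fun f => ?_,
    fun f hf => absurd Submodule.mem_top hf⟩
  show ‖(f : Lp ℝ 2 μ)‖ₑ ^ 2 = ENNReal.ofReal (inner ℝ (f : Lp ℝ 2 μ) (f : Lp ℝ 2 μ))
  rw [real_inner_self_eq_norm_sq, ENNReal.ofReal_pow (norm_nonneg _), ofReal_norm]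

/-- The Moreau regularization of a form on `L²`, the form of the bounded operator
`α(1 - α(L + α)⁻¹)` if `q` is the form of `L`. -/
noncomputable def moreau (q : Lp ℝ 2 μ → ℝ≥0∞) (α : ℝ≥0) (u : Lp ℝ 2 μ) : ℝ≥0∞ :=
  ⨅ v, q v + α * ‖u - v‖ₑ ^ 2

variable {q : Lp ℝ 2 μ → ℝ≥0∞} {α : ℝ≥0}

theorem moreau_le (u : Lp ℝ 2 μ) : moreau q α u ≤ q u :=
  (iInf_le _ u).trans (by simp)

theorem moreau_le_norm (hq : IsQuadraticForm q) (u : Lp ℝ 2 μ) : moreau q α u ≤ α * ‖u‖ₑ ^ 2 :=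
  (iInf_le _ 0).trans (by simp [hq.map_zero])

theorem moreau_lt_top (hq : IsQuadraticForm q) (u : Lp ℝ 2 μ) : moreau q α u < ∞ :=
  (moreau_le_norm hq u).trans_lt
    (ENNReal.mul_lt_top ENNReal.coe_lt_top (ENNReal.pow_lt_top enorm_lt_top))

theorem isQuadraticForm_moreau (hq : IsQuadraticForm q) : IsQuadraticForm (moreau q α) := by
  have hN := isQuadraticForm_enorm_sq (μ := μ)
  have hle : ∀ (a : ℝ) u, moreau q α (a • u) ≤ ENNReal.ofReal (a ^ 2) * moreau q α u := by
    intro a u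
    rw [moreau, moreau, ENNReal.mul_iInf (fun h => absurd h ENNReal.ofReal_ne_top)]
    refine le_iInf fun v => (iInf_le _ (a • v)).trans (le_of_eq ?_)
    have h1 := hN.smul a (u - v)
    rw [← smul_sub, hq.smul, h1]
    ring
  refine IsQuadraticForm.of_parallelogram (fun a u => ?_) fun f g => ?_
  · refine le_antisymm (hle a u) ?_
    by_cases ha : a = 0
    · simp [ha]
    · have h1 := hle a⁻¹ (a • u)
      rw [inv_smul_smul₀ ha] at h1
      refine (mul_le_mul_right h1 _).trans (le_of_eq ?_)
      rw [← mul_assoc, ← ENNReal.ofReal_mul (sq_nonneg a), ← mul_pow, mul_inv_cancel₀ ha]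
      simp
  · have h1 : ∀ v w, moreau q α (f + g) + moreau q α (f - g) ≤
        2 * ((q v + α * ‖f - v‖ₑ ^ 2) + (q w + α * ‖g - w‖ₑ ^ 2)) := fun v w => by
      refine (add_le_add (iInf_le _ (v + w)) (iInf_le _ (v - w))).trans (le_of_eq ?_)
      have h2 := hN.parallelogram (f - v) (g - w)
      have h3 := hq.parallelogram v w
      rw [show f + g - (v + w) = f - v + (g - w) by abel,
        show f - g - (v - w) = f - v - (g - w) by abel, add_add_add_comm, h3, ← mul_add, h2]
      ring
    rw [moreau.eq_1 q α f, ENNReal.iInf_add, ENNReal.mul_iInf_of_ne two_ne_zero ENNReal.ofNat_ne_top]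
    refine le_iInf fun v => ?_
    rw [moreau.eq_1 q α g, ENNReal.add_iInf,
      ENNReal.mul_iInf_of_ne two_ne_zero ENNReal.ofNat_ne_top]
    exact le_iInf fun w => h1 v w

/-- The regularization of a Markovian form is Markovian. -/
theorem moreau_comp_le (hM : IsMarkovianForm q) {C : ℝ → ℝ} (hC : IsNormalContraction C)
    {f g : Lp ℝ 2 μ} (h : g =ᵐ[μ] fun x => C (f x)) : moreau q α g ≤ moreau q α f := by
  have hL := hC.lipschitzWith
  have hg : g = hL.compLp hC.map_zero f :=
    Lp.ext (h.trans (LipschitzWith.coeFn_compLp hL hC.map_zero f).symm)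
  refine le_iInf fun v => (iInf_le _ (hL.compLp hC.map_zero v)).trans ?_
  refine add_le_add (hM C hC _ _ (LipschitzWith.coeFn_compLp hL hC.map_zero v)) ?_
  refine mul_le_mul_right (pow_le_pow_left' ?_ 2) _
  rw [hg, ← ofReal_norm, ← ofReal_norm]
  refine ENNReal.ofReal_le_ofReal ?_
  simpa using hL.norm_compLp_sub_le hC.map_zero f v

/-- A closed form is the supremum of its regularizations. -/
theorem le_of_forall_moreau_le (hq : IsQuadraticForm q) (hc : IsClosedForm q)
    {u : Lp ℝ 2 μ} {M : ℝ≥0∞} (h : ∀ n : ℕ, moreau q n u ≤ M) : q u ≤ M := by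
  by_cases hM : M = ∞
  · simp [hM]
  refine ENNReal.le_of_forall_pos_le_add fun ε hε _ => ?_
  have hlt : M < M + ε := ENNReal.lt_add_right hM (by simpa using hε.ne')
  have hMε : M + ε < ∞ := ENNReal.add_lt_top.2 ⟨lt_top_iff_ne_top.2 hM, ENNReal.coe_lt_top⟩
  -- near minimizers `v n` converge to `u`, and their convex combinations do so in the form norm
  choose v hv using fun n => iInf_lt_iff.1 ((h n).trans_lt hlt)
  have hvu : Tendsto v atTop (𝓝 u) := by
    rw [← tendsto_sub_nhds_zero_iff]
    refine WeightedGraph.tendsto_norm_of_tendsto_enorm_sq ?_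
    have h1 : Tendsto (fun n : ℕ => (M + ε) / n) atTop (𝓝 0) :=
      ENNReal.Tendsto.const_div ENNReal.tendsto_nat_nhds_top (Or.inr hMε.ne) |>.trans (by simp)
    refine tendsto_of_tendsto_of_tendsto_of_le_of_le' tendsto_const_nhds h1
      (Eventually.of_forall fun _ => zero_le) ?_
    filter_upwards [eventually_gt_atTop 0] with n hn
    rw [ENNReal.le_div_iff_mul_le (Or.inl (by simpa using hn.ne')) (Or.inl (by simp)), mul_comm]
    have h2 := (isQuadraticForm_enorm_sq (μ := μ)).sub_comm (v n) u
    rw [h2]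
    exact le_add_self.trans (by simpa using (hv n).le)
  obtain ⟨w, hw, hwc, hwM, l, hl, hwl⟩ :=
    hq.exists_cauchy_mem_convexHull hMε (u := v) fun n => le_self_add.trans (hv n).le
  have hwu : Tendsto w atTop (𝓝 u) := tendsto_of_mem_convexHull LinearMap.id hvu hw
  obtain ⟨f, hf, h1, h2⟩ := hc w hwc hwu.cauchySeq
  obtain rfl := tendsto_nhds_unique h2 hwu
  have h3 := hq.tendsto_of_tendsto_sub (v := fun _ => f) hwc.1 (fun _ => hf) h1
    (hl.trans_lt hMε) hwl
  exact (tendsto_nhds_unique tendsto_const_nhds h3).trans_le hl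

variable [Countable X] [DiscreteMeasurableSpace X] {m : X → ℝ}
  {q : Lp ℝ 2 (vertexMeasure m) → ℝ≥0∞}

/-- The regularization of a Markovian form is the energy of a weighted graph. -/
theorem exists_energy_eq_moreau (hm : ∀ x, 0 < m x) (hq : IsQuadraticForm q)
    (hM : IsMarkovianForm q) (α : ℝ≥0) :
    ∃ G : WeightedGraph X, ∀ u, G.energy (evalLp hm u) = moreau q α u := by
  have hQ := isQuadraticForm_moreau (α := α) hq
  obtain ⟨G, hG⟩ := WeightedGraph.exists_energy_eq (hQ.comp (finsuppLp hm))
    (fun φ => moreau_lt_top hq _) fun C hC φ ψ h => moreau_comp_le hM hC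
      (f := finsuppLp hm φ) (g := finsuppLp hm ψ) <|
      (ae_vertexMeasure_iff hm).2 fun x => by
        have h1 := congrFun (evalLp_finsuppLp hm φ) x
        have h2 := congrFun (evalLp_finsuppLp hm ψ) x
        rw [evalLp_apply] at h1 h2
        simp only [h1, h2, h, Function.comp_apply]
  refine ⟨G, fun u => ?_⟩
  have hE := G.isQuadraticForm_energy
  have hsmall : ∀ {w : ℕ → Lp ℝ 2 (vertexMeasure m)} {v}, Tendsto w atTop (𝓝 v) →
      Tendsto (fun n => (α : ℝ≥0∞) * ‖w n - v‖ₑ ^ 2) atTop (𝓝 0) := fun {w v} h => by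
    have h1 := (((ENNReal.continuous_pow 2).tendsto _).comp
      ((continuous_enorm.tendsto _).comp (tendsto_sub_nhds_zero_iff.2 h)))
    simpa using ENNReal.Tendsto.const_mul (a := (α : ℝ≥0∞)) h1 (Or.inr ENNReal.coe_ne_top)
  have hcont : ∀ {w : ℕ → Lp ℝ 2 (vertexMeasure m)} {v}, Tendsto w atTop (𝓝 v) →
      Tendsto (fun n => moreau q α (w n)) atTop (𝓝 (moreau q α v)) := fun {w v} h =>
    hQ.tendsto_of_tendsto_sub (u := fun _ => v) (fun _ => moreau_lt_top hq v)
      (fun n => moreau_lt_top hq _) (tendsto_of_tendsto_of_tendsto_of_le_of_le tendsto_const_nhds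
        (hsmall h) (fun _ => zero_le) fun n => by
          rw [hQ.sub_comm]
          exact moreau_le_norm hq _) (moreau_lt_top hq v) tendsto_const_nhds
  have hle : ∀ u, G.energy (evalLp hm u) ≤ moreau q α u := fun u => by
    obtain ⟨φ, hφ⟩ := exists_finsuppLp_tendsto hm u
    refine G.lowerSemicontinuous_energy.le_of_tendsto_of_tendsto (tendsto_evalLp hm hφ)
      (hcont hφ) fun n => ?_
    rw [evalLp_finsuppLp, hG, Function.comp_apply]
  obtain ⟨φ, hφ⟩ := exists_finsuppLp_tendsto hm u
  have h1 : Tendsto (fun n => G.energy (evalLp hm (finsuppLp hm (φ n)))) atTop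
      (𝓝 (moreau q α u)) := by
    refine (hcont hφ).congr fun n => ?_
    rw [evalLp_finsuppLp, hG, Function.comp_apply]
  have h2 := hE.tendsto_of_tendsto_sub (v := fun _ => evalLp hm u)
    (fun n => (hle _).trans_lt (moreau_lt_top hq _)) (fun _ => (hle _).trans_lt (moreau_lt_top hq _))
    (tendsto_of_tendsto_of_tendsto_of_le_of_le tendsto_const_nhds (hsmall hφ) (fun _ => zero_le)
      fun n => by
        rw [← map_sub]
        exact (hle _).trans (moreau_le_norm hq _)) (moreau_lt_top hq u) h1
  exact tendsto_nhds_unique tendsto_const_nhds h2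

/-- Closed Markovian forms on `ℓ²(X, m)` are lower semicontinuous for pointwise convergence, being
suprema of energies of weighted graphs, to which Fatou's lemma applies. -/
theorem IsDirichletFormWide.le_of_tendsto (hq : IsDirichletFormWide q) (hm : ∀ x, 0 < m x)
    {u : ℕ → Lp ℝ 2 (vertexMeasure m)} {f : Lp ℝ 2 (vertexMeasure m)}
    (hu : Tendsto (fun n => evalLp hm (u n)) atTop (𝓝 (evalLp hm f))) {M : ℝ≥0∞}
    (h : ∀ᶠ n in atTop, q (u n) ≤ M) : q f ≤ M := by
  refine le_of_forall_moreau_le hq.quadratic hq.closed fun k => ?_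
  obtain ⟨G, hG⟩ := exists_energy_eq_moreau hm hq.quadratic hq.markovian k
  rw [← hG]
  exact G.lowerSemicontinuous_energy.le_of_tendsto hu (h.mono fun n hn => by
    rw [hG]
    exact (moreau_le _).trans hn)

end Semicontinuity

/-! ### The extended form -/

theorem exists_isApproximating {E : Type*} [MeasurableSpace E] {μ : Measure E}
    {Q : Lp ℝ 2 μ → ℝ≥0∞} {f : E → ℝ} (hf : extendedForm Q f < ∞) :
    ∃ u, IsApproximating Q u f := by
  by_contra h
  rw [extendedForm, dif_neg h] at hf
  exact hf.ne rfl

theorem WeightedGraph.neumannForm_le_dirichletForm {X : Type*} [MeasurableSpace X]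
    {G : WeightedGraph X} {m : X → ℝ} : G.neumannForm m ≤ G.dirichletForm m := fun u => by
  rw [dirichletForm]
  split_ifs
  · exact le_rfl
  · exact le_top

section ExtendedForm

variable {X : Type*} [Countable X] [MeasurableSpace X] [DiscreteMeasurableSpace X] {m : X → ℝ}
  {Q : Lp ℝ 2 (vertexMeasure m) → ℝ≥0∞}

theorem IsApproximating.tendsto_evalLp {u : ℕ → Lp ℝ 2 (vertexMeasure m)} {f : X → ℝ}
    (h : IsApproximating Q u f) (hm : ∀ x, 0 < m x) :
    Tendsto (fun n => evalLp hm (u n)) atTop (𝓝 f) :=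
  tendsto_pi_nhds.2 h.2

theorem isApproximating_of_tendsto (hm : ∀ x, 0 < m x) {u : ℕ → Lp ℝ 2 (vertexMeasure m)}
    {f : X → ℝ} (hu : IsFormCauchy Q u) (h : Tendsto (fun n => evalLp hm (u n)) atTop (𝓝 f)) :
    IsApproximating Q u f :=
  ⟨hu, tendsto_pi_nhds.1 h⟩

namespace IsDirichletFormWide

/-- Two approximating sequences of the same function are close in the form sense: their difference
`w` tends to zero pointwise, so `Q (w n) ≤ liminf Q (w n - w k)` by semicontinuity. -/
theorem tendsto_sub_of_isApproximating (hQ : IsDirichletFormWide Q) (hm : ∀ x, 0 < m x)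
    {u v : ℕ → Lp ℝ 2 (vertexMeasure m)} {f : X → ℝ} (hu : IsApproximating Q u f)
    (hv : IsApproximating Q v f) : Tendsto (fun n => Q (u n - v n)) atTop (𝓝 0) := by
  have hw := hu.1.sub hQ.quadratic hv.1
  have hw0 : Tendsto (fun n => evalLp hm (u n - v n)) atTop (𝓝 0) := by
    simpa using (hu.tendsto_evalLp hm).sub (hv.tendsto_evalLp hm)
  rw [ENNReal.tendsto_atTop_zero]
  intro ε hε
  have h1 := hw.2.eventually (Iic_mem_nhds hε)
  rw [eventually_atTop] at h1
  obtain ⟨⟨a, b⟩, hab⟩ := h1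
  refine ⟨a, fun n hn => hQ.le_of_tendsto hm (u := fun k => u n - v n - (u k - v k)) ?_ ?_⟩
  · simpa using (tendsto_const_nhds (x := evalLp hm (u n - v n))).sub hw0
  · filter_upwards [eventually_ge_atTop b] with k hk
    exact hab (n, k) ⟨hn, hk⟩

/-- The extended form can be computed along any approximating sequence. -/
theorem tendsto_extendedForm (hQ : IsDirichletFormWide Q) (hm : ∀ x, 0 < m x)
    {u : ℕ → Lp ℝ 2 (vertexMeasure m)} {f : X → ℝ} (hu : IsApproximating Q u f) :
    extendedForm Q f < ∞ ∧ Tendsto (fun n => Q (u n)) atTop (𝓝 (extendedForm Q f)) := by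
  have h : ∃ u, IsApproximating Q u f := ⟨u, hu⟩
  obtain ⟨l, hl, hlim⟩ := hQ.quadratic.exists_tendsto_of_cauchy h.choose_spec.1
  have h1 : extendedForm Q f = l := by
    rw [extendedForm, dif_pos h]
    exact hlim.limUnder_eq
  rw [h1]
  exact ⟨hl, hQ.quadratic.tendsto_of_tendsto_sub h.choose_spec.1.1 hu.1.1
    (hQ.tendsto_sub_of_isApproximating hm h.choose_spec hu) hl hlim⟩

theorem extendedForm_evalLp_le (hQ : IsDirichletFormWide Q) (hm : ∀ x, 0 < m x)
    (u : Lp ℝ 2 (vertexMeasure m)) : extendedForm Q (evalLp hm u) ≤ Q u := by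
  by_cases hu : Q u < ∞
  · have h1 : IsApproximating Q (fun _ => u) (evalLp hm u) :=
      ⟨⟨fun _ => hu, by simp [hQ.quadratic.map_zero]⟩, fun x => tendsto_const_nhds⟩
    exact (tendsto_nhds_unique (hQ.tendsto_extendedForm hm h1).2 tendsto_const_nhds).le
  · exact le_of_le_of_eq le_top (not_lt_top_iff.1 hu).symm

theorem extendedForm_le_of_tendsto (hQ : IsDirichletFormWide Q) (hm : ∀ x, 0 < m x)
    {u : ℕ → Lp ℝ 2 (vertexMeasure m)} {f : X → ℝ} {M : ℝ≥0∞}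
    (hu : Tendsto (fun n => evalLp hm (u n)) atTop (𝓝 f)) (h : ∀ n, Q (u n) ≤ M) :
    extendedForm Q f ≤ M := by
  by_cases hM : M < ∞
  · obtain ⟨v, hv, hvc, -, l, hl, hvl⟩ := hQ.quadratic.exists_cauchy_mem_convexHull hM h
    -- convex combinations of the tails still converge, coordinate by coordinate
    have h1 : IsApproximating Q v f := ⟨hvc, fun x =>
      tendsto_of_mem_convexHull ((LinearMap.proj x).comp (evalLp hm))
        ((tendsto_pi_nhds.1 hu) x) hv⟩
    exact (tendsto_nhds_unique (hQ.tendsto_extendedForm hm h1).2 hvl).trans_le hl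
  · exact le_of_le_of_eq le_top (not_lt_top_iff.1 hM).symm

/-- The sublevel sets of the extended form are intersections of closures of sublevel sets of the
form. -/
theorem extendedForm_le_iff (hQ : IsDirichletFormWide Q) (hm : ∀ x, 0 < m x) {f : X → ℝ}
    {M : ℝ≥0∞} :
    extendedForm Q f ≤ M ↔ ∀ N > M, f ∈ closure (evalLp hm '' {u | Q u ≤ N}) := by
  refine ⟨fun h N hN => ?_, fun h => le_of_forall_gt_imp_ge_of_dense fun N hN => ?_⟩
  · obtain ⟨u, hu⟩ := exists_isApproximating (h.trans_lt (hN.trans_le le_top))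
    have h1 := (hQ.tendsto_extendedForm hm hu).2.eventually_lt_const (h.trans_lt hN)
    exact mem_closure_of_tendsto (hu.tendsto_evalLp hm) (h1.mono fun n hn => ⟨u n, hn.le, rfl⟩)
  · obtain ⟨g, hg, hgf⟩ := mem_closure_iff_seq_limit.1 (h N hN)
    choose u hu hug using hg
    refine hQ.extendedForm_le_of_tendsto hm (u := u) ?_ hu
    simpa only [hug] using hgf

theorem lowerSemicontinuous_extendedForm (hQ : IsDirichletFormWide Q) (hm : ∀ x, 0 < m x) :
    LowerSemicontinuous (extendedForm Q) := by
  refine lowerSemicontinuous_iff_isClosed_preimage.2 fun M => ?_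
  have : extendedForm Q ⁻¹' Set.Iic M = ⋂ N > M, closure (evalLp hm '' {u | Q u ≤ N}) := by
    ext f
    simp only [Set.mem_preimage, Set.mem_Iic, Set.mem_iInter]
    exact hQ.extendedForm_le_iff hm
  rw [this]
  exact isClosed_biInter fun N _ => isClosed_closure

theorem isQuadraticForm_extendedForm (hQ : IsDirichletFormWide Q) (hm : ∀ x, 0 < m x) :
    IsQuadraticForm (extendedForm Q) := by
  have hq := hQ.quadratic
  have hle : ∀ (a : ℝ) f, extendedForm Q (a • f) ≤ ENNReal.ofReal (a ^ 2) * extendedForm Q f := by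
    intro a f
    by_cases hf : extendedForm Q f < ∞
    · obtain ⟨u, hu⟩ := exists_isApproximating hf
      have h1 : IsApproximating Q (fun n => a • u n) (a • f) :=
        isApproximating_of_tendsto hm (hu.1.smul hq a)
          (by simpa using (hu.tendsto_evalLp hm).const_smul a)
      have h2 := ENNReal.Tendsto.const_mul (a := ENNReal.ofReal (a ^ 2))
        (hQ.tendsto_extendedForm hm hu).2 (Or.inr ENNReal.ofReal_ne_top)
      refine (tendsto_nhds_unique (hQ.tendsto_extendedForm hm h1).2 (h2.congr fun n => ?_)).le
      rw [hq.smul]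
    · rw [not_lt_top_iff.1 hf]
      by_cases ha : a = 0
      · subst ha
        have h1 := hQ.extendedForm_evalLp_le hm 0
        rw [hq.map_zero, map_zero] at h1
        simpa using h1
      · rw [ENNReal.mul_top (by positivity)]
        exact le_top
  refine IsQuadraticForm.of_parallelogram (fun a f => le_antisymm (hle a f) ?_) fun f g => ?_
  · by_cases ha : a = 0
    · simp [ha]
    · have h1 := hle a⁻¹ (a • f)
      rw [inv_smul_smul₀ ha] at h1
      refine (mul_le_mul_right h1 _).trans (le_of_eq ?_)
      rw [← mul_assoc, ← ENNReal.ofReal_mul (sq_nonneg a), ← mul_pow, mul_inv_cancel₀ ha]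
      simp
  · by_cases hfg : extendedForm Q f < ∞ ∧ extendedForm Q g < ∞
    · obtain ⟨u, hu⟩ := exists_isApproximating hfg.1
      obtain ⟨v, hv⟩ := exists_isApproximating hfg.2
      have h1 : IsApproximating Q (fun n => u n + v n) (f + g) :=
        isApproximating_of_tendsto hm (hu.1.add hq hv.1)
          (by simpa using (hu.tendsto_evalLp hm).add (hv.tendsto_evalLp hm))
      have h2 : IsApproximating Q (fun n => u n - v n) (f - g) :=
        isApproximating_of_tendsto hm (hu.1.sub hq hv.1)
          (by simpa using (hu.tendsto_evalLp hm).sub (hv.tendsto_evalLp hm))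
      have h3 := (hQ.tendsto_extendedForm hm h1).2.add (hQ.tendsto_extendedForm hm h2).2
      have h4 := ENNReal.Tendsto.const_mul (a := 2) ((hQ.tendsto_extendedForm hm hu).2.add
        (hQ.tendsto_extendedForm hm hv).2) (Or.inr ENNReal.ofNat_ne_top)
      exact (tendsto_nhds_unique h3 (h4.congr fun n => (hq.parallelogram _ _).symm)).le
    · rw [not_and_or, not_lt_top_iff, not_lt_top_iff] at hfg
      rcases hfg with h | h <;> simp [h]

theorem extendedForm_comp_le (hQ : IsDirichletFormWide Q) (hm : ∀ x, 0 < m x) {C : ℝ → ℝ}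
    (hC : IsNormalContraction C) (f : X → ℝ) : extendedForm Q (C ∘ f) ≤ extendedForm Q f := by
  by_cases hf : extendedForm Q f < ∞
  · obtain ⟨u, hu⟩ := exists_isApproximating hf
    have hL := hC.lipschitzWith
    have h1 : ∀ n, evalLp hm (hL.compLp hC.map_zero (u n)) = C ∘ evalLp hm (u n) := fun n =>
      funext ((ae_vertexMeasure_iff hm).1 (LipschitzWith.coeFn_compLp hL hC.map_zero (u n)))
    refine (hQ.lowerSemicontinuous_extendedForm hm).le_of_tendsto_of_tendsto
      (u := fun n => evalLp hm (hL.compLp hC.map_zero (u n))) ?_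
      (hQ.tendsto_extendedForm hm hu).2 fun n => (hQ.extendedForm_evalLp_le hm _).trans
        (hQ.markovian C hC _ _ (LipschitzWith.coeFn_compLp hL hC.map_zero (u n)))
    simp only [h1]
    exact tendsto_pi_nhds.2 fun x => (hC.continuous.tendsto _).comp (hu.2 x)
  · exact le_of_le_of_eq le_top (not_lt_top_iff.1 hf).symm

end IsDirichletFormWide

namespace WeightedGraph

variable {G : WeightedGraph X}

theorem energy_le_extendedForm (hQ : IsDirichletFormWide Q) (hm : ∀ x, 0 < m x)
    (h : G.neumannForm m ≤ Q) (f : X → ℝ) : G.energy f ≤ extendedForm Q f := by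
  by_cases hf : extendedForm Q f < ∞
  · obtain ⟨u, hu⟩ := exists_isApproximating hf
    exact G.lowerSemicontinuous_energy.le_of_tendsto_of_tendsto (hu.tendsto_evalLp hm)
      (hQ.tendsto_extendedForm hm hu).2 fun n => h (u n)
  · exact le_of_le_of_eq le_top (not_lt_top_iff.1 hf).symm

theorem extendedForm_le_energy_of_finite_support (hQ : IsDirichletFormWide Q)
    (hm : ∀ x, 0 < m x) (h : Q ≤ G.dirichletForm m) {φ : X → ℝ}
    (hφ : (Function.support φ).Finite) : extendedForm Q φ ≤ G.energy φ := by
  obtain ⟨u, rfl⟩ := exists_evalLp_eq_of_finite_support hm hφ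
  refine (hQ.extendedForm_evalLp_le hm u).trans ((h u).trans (le_of_eq ?_))
  have h1 : G.neumannForm m (u - u) = G.energy (evalLp hm (u - u)) := rfl
  rw [sub_self, map_zero, G.isQuadraticForm_energy.map_zero] at h1
  rw [dirichletForm, if_pos fun ε hε => ⟨u, hφ, by simpa [h1] using hε⟩]
  rfl

theorem isDirichletFormWide_neumannForm (hm : ∀ x, 0 < m x) :
    IsDirichletFormWide (G.neumannForm m) where
  quadratic := G.isQuadraticForm_energy.comp (evalLp hm)
  closed u hu hc := by
    obtain ⟨f, hf⟩ := cauchySeq_tendsto_of_complete hc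
    have h1 : Tendsto (fun p : ℕ × ℕ => G.energy (evalLp hm (u p.1) - evalLp hm (u p.2))) atTop
        (𝓝 0) := by
      simp only [← map_sub]
      exact hu.2
    have h2 := G.lowerSemicontinuous_energy.tendsto_sub (tendsto_evalLp hm hf) h1
    refine ⟨f, energy_lt_top_of_tendsto (G := G) hu.1 h2, ?_, hf⟩
    simp only [← map_sub] at h2
    exact h2
  markovian C hC f g h := by
    have h1 : evalLp hm g = C ∘ evalLp hm f := funext ((ae_vertexMeasure_iff hm).1 h)
    show G.energy (evalLp hm g) ≤ G.energy (evalLp hm f)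
    rw [h1]
    exact G.energy_comp_le hC _

end WeightedGraph

end ExtendedForm

/-! ### Harmonic parts and forms dominating the energy -/

namespace WeightedGraph

variable {X : Type*} {G : WeightedGraph X}

/-- A Markovian quadratic form on all functions, lower semicontinuous for pointwise convergence,
which dominates the energy and agrees with it on the finitely supported functions. The extended
forms of the Dirichlet forms between `Q^(D)` and `Q^(N)` are of this kind. -/
structure IsEnergyExtension (G : WeightedGraph X) (F : (X → ℝ) → ℝ≥0∞) : Prop where
  quadratic : IsQuadraticForm F
  lowerSemicontinuous : LowerSemicontinuous F
  comp_le : ∀ C, IsNormalContraction C → ∀ f, F (C ∘ f) ≤ F f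
  energy_le : ∀ f, G.energy f ≤ F f
  le_energy : ∀ φ, (Function.support φ).Finite → F φ ≤ G.energy φ

namespace IsEnergyExtension

variable {F : (X → ℝ) → ℝ≥0∞}

/-- By semicontinuity, the form agrees with the energy on all of `D₀`. -/
theorem eq_energy_of_mem_vanishing (hF : G.IsEnergyExtension F) (hconn : G.Connected) [Nonempty X]
    {v : X → ℝ} (hv : v ∈ G.vanishing) : F v = G.energy v := by
  refine le_antisymm ?_ (hF.energy_le v)
  obtain ⟨φ, hφ, h1, h2⟩ := exists_tendsto_of_mem_vanishing hconn hv
  refine hF.lowerSemicontinuous.le_of_tendsto_of_tendsto h1 ?_ fun n => hF.le_energy _ (hφ n)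
  refine G.isQuadraticForm_energy.tendsto_of_tendsto_sub (u := fun _ => v) (fun _ => hv.1)
    (fun n => energy_lt_top_of_finite_support (hφ n)) ?_ hv.1 tendsto_const_nhds
  exact h2.congr fun n => G.isQuadraticForm_energy.sub_comm _ _

/-- Passing to the harmonic part `h` decreases the form. Indeed `F` agrees with the energy on the
direction `v = f - h`, and `F - energy` is nonnegative, hence constant on the line `h + t • v`,
where it is affine; so `h` and `v` are orthogonal for `F` as they are for the energy. -/
theorem le_of_isHarmonicPart (hF : G.IsEnergyExtension F) (hconn : G.Connected) [Nonempty X]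
    {f h : X → ℝ} (hh : G.IsHarmonicPart f h) (hf : F f < ∞) : F h ≤ F f := by
  have hq := hF.quadratic
  have hv := hF.eq_energy_of_mem_vanishing hconn hh.sub_mem
  have hvE : G.energy (f - h) < ∞ := hh.sub_mem.1
  have hvF : F (f - h) < ∞ := hv ▸ hvE
  have hhF : F h < ∞ := by
    have := hq.sub_lt_top hf hvF
    rwa [sub_sub_cancel] at this
  obtain ⟨β, hβ⟩ := hq.exists_expansion hhF hvF
  have h1 : ∀ t : ℝ, 0 ≤ (F h).toReal - (G.energy h).toReal + 2 * t * β := fun t => by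
    have h2 := ENNReal.toReal_mono (hq.add_lt_top hhF (hq.smul_lt_top t hvF)).ne
      (hF.energy_le (h + t • (f - h)))
    rw [hβ, energy_add_smul_toReal hh.energy_lt_top hvE, hh.orthogonal _ hh.sub_mem, hv] at h2
    linarith
  have hβ0 : β = 0 := by
    by_contra hne
    have h2 := h1 (-((F h).toReal - (G.energy h).toReal + 1) / (2 * β))
    have h3 : 2 * (-((F h).toReal - (G.energy h).toReal + 1) / (2 * β)) * β =
        -((F h).toReal - (G.energy h).toReal + 1) := by field_simp
    linarith
  have h2 := hβ 1
  rw [one_smul, add_sub_cancel, hβ0, mul_zero, add_zero, one_pow, one_mul] at h2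
  rw [← ENNReal.toReal_le_toReal hhF.ne hf.ne, h2]
  exact le_add_of_nonneg_right ENNReal.toReal_nonneg

end IsEnergyExtension

/-! ### The trace form -/

section TraceForm

variable [MeasurableSpace X] {m : X → ℝ} {Q : Lp ℝ 2 (vertexMeasure m) → ℝ≥0∞}
  {z : X}

/-- Among the functions with trace `φ`, the harmonic extension of `φ` minimizes the form. -/
theorem extendedForm_harmonicExtension_le (hF : G.IsEnergyExtension (extendedForm Q))
    (hconn : G.Connected) (htrans : G.Transient) {f : G.finiteEnergy}
    (hf : extendedForm Q f < ∞) :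
    extendedForm Q (G.harmonicExtension (G.traceMap z f)) ≤ extendedForm Q f ∧
      ∃ h : G.finiteEnergy, (h : X → ℝ) = G.harmonicExtension (G.traceMap z f) ∧
        G.traceMap z h = G.traceMap z f := by
  have : Nonempty X := ⟨z⟩
  have hT := isTraceMap_traceMap hconn htrans z
  obtain ⟨h, hh, -⟩ := exists_isHarmonicPart hconn htrans f.2
  rw [hT.harmonicExtension_eq hconn htrans hh]
  exact ⟨hF.le_of_isHarmonicPart hconn hh hf, ⟨h, hh.energy_lt_top⟩, rfl,
    (hT.eq_of_isHarmonicPart hconn htrans (h := ⟨h, hh.energy_lt_top⟩) hh).symm⟩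

theorem traceForm_of_mem {φ : Lp ℝ 2 (G.harmonicMeasure z)} (hφ : φ ∈ G.traceDomain z Q) :
    G.traceForm z Q φ = extendedForm Q (G.harmonicExtension φ) := if_pos hφ

theorem traceForm_of_notMem {φ : Lp ℝ 2 (G.harmonicMeasure z)} (hφ : φ ∉ G.traceDomain z Q) :
    G.traceForm z Q φ = ∞ := if_neg hφ

theorem exists_of_mem_traceDomain (hF : G.IsEnergyExtension (extendedForm Q))
    (hconn : G.Connected) (htrans : G.Transient) {φ : Lp ℝ 2 (G.harmonicMeasure z)}
    (hφ : φ ∈ G.traceDomain z Q) :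
    ∃ h : G.finiteEnergy, (h : X → ℝ) = G.harmonicExtension φ ∧ G.traceMap z h = φ ∧
      extendedForm Q h < ∞ := by
  obtain ⟨f, hf, rfl⟩ := hφ
  obtain ⟨h1, h, hh, h2⟩ := extendedForm_harmonicExtension_le (z := z) hF hconn htrans hf
  exact ⟨h, hh, h2, hh ▸ h1.trans_lt hf⟩

theorem formDomain_traceForm (hF : G.IsEnergyExtension (extendedForm Q)) (hconn : G.Connected)
    (htrans : G.Transient) : formDomain (G.traceForm z Q) = G.traceDomain z Q := by
  ext φ
  refine ⟨fun h => ?_, fun h => ?_⟩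
  · by_contra hφ
    exact (ne_of_lt h) (traceForm_of_notMem hφ)
  · obtain ⟨h, hh, -, hlt⟩ := exists_of_mem_traceDomain hF hconn htrans h
    show G.traceForm z Q φ < ∞
    rwa [traceForm_of_mem ‹_›, ← hh]

/-- The trace domain of a form whose extended form is quadratic, as a linear subspace. -/
noncomputable def traceSubmodule (z : X) (hq : IsQuadraticForm (extendedForm Q)) :
    Submodule ℝ (Lp ℝ 2 (G.harmonicMeasure z)) :=
  (hq.domain.comap G.finiteEnergy.subtype).map (G.traceMap z)

theorem mem_traceSubmodule (hq : IsQuadraticForm (extendedForm Q))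
    {φ : Lp ℝ 2 (G.harmonicMeasure z)} : φ ∈ traceSubmodule z hq ↔ φ ∈ G.traceDomain z Q :=
  Iff.rfl

theorem isDirichletFormWide_traceForm (hF : G.IsEnergyExtension (extendedForm Q))
    (hconn : G.Connected) (htrans : G.Transient) : IsDirichletFormWide (G.traceForm z Q) := by
  have hq := hF.quadratic
  have hT := isTraceMap_traceMap hconn htrans z
  obtain ⟨H, hH⟩ := exists_harmonicExtensionCLM hconn htrans z
  have hD := formDomain_traceForm (z := z) hF hconn htrans
  have hQ : IsQuadraticForm (G.traceForm z Q) := by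
    refine hq.comp_of_domain (traceSubmodule z hq)
      (H.toLinearMap ∘ₗ (traceSubmodule z hq).subtype) (fun φ => ?_) fun φ hφ =>
        traceForm_of_notMem fun h => hφ ((mem_traceSubmodule hq).2 h)
    rw [traceForm_of_mem ((mem_traceSubmodule hq).1 φ.2), ← hH]
    rfl
  refine ⟨hQ, fun u hu hc => ?_, fun C hC φ ψ h => ?_⟩
  · obtain ⟨φ, hφ⟩ := cauchySeq_tendsto_of_complete hc
    have hmem : ∀ n, u n ∈ G.traceDomain z Q := fun n => hD ▸ hu.1 n
    choose h hh hTh hlt using fun n => exists_of_mem_traceDomain hF hconn htrans (hmem n)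
    have h1 : Tendsto (fun n => (h n : X → ℝ)) atTop (𝓝 (H φ)) := by
      refine ((H.continuous.tendsto φ).comp hφ).congr fun n => ?_
      rw [Function.comp_apply, hH, hh]
    have h2 : ∀ k l, G.traceForm z Q (u k - u l) = extendedForm Q (h k - h l) := fun k l => by
      have h3 : u k - u l ∈ G.traceDomain z Q := (traceSubmodule z hq).sub_mem (hmem k) (hmem l)
      rw [traceForm_of_mem h3, ← hH, map_sub, hH, hH, hh, hh]
    -- the harmonic extensions form a Cauchy sequence which converges pointwise
    have h3 : Tendsto (fun n => extendedForm Q (h n - H φ)) atTop (𝓝 0) :=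
      hF.lowerSemicontinuous.tendsto_sub h1 (hu.2.congr fun p => h2 p.1 p.2)
    have h4 : extendedForm Q (H φ) < ∞ := by
      obtain ⟨n, hn⟩ := (h3.eventually_lt_const ENNReal.zero_lt_top).exists
      have := hq.sub_lt_top (hlt n) hn
      rwa [sub_sub_cancel] at this
    have h5 : G.energy (H φ) < ∞ := (hF.energy_le _).trans_lt h4
    have h6 := hT.tendsto (u := h) (f := ⟨H φ, h5⟩) h1
      (tendsto_of_tendsto_of_tendsto_of_le_of_le tendsto_const_nhds h3 (fun _ => zero_le)
        fun n => hF.energy_le _)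
    simp only [hTh] at h6
    have h7 : φ ∈ G.traceDomain z Q := ⟨⟨H φ, h5⟩, h4, tendsto_nhds_unique h6 hφ⟩
    refine ⟨φ, hD ▸ h7, h3.congr fun n => ?_, hφ⟩
    have h8 : u n - φ ∈ G.traceDomain z Q := (traceSubmodule z hq).sub_mem (hmem n) h7
    rw [traceForm_of_mem h8, ← hH, map_sub, hH (u n), hh]
  · by_cases hφ : φ ∈ G.traceDomain z Q
    · obtain ⟨h', hh, hTh, hlt⟩ := exists_of_mem_traceDomain hF hconn htrans hφ
      have h1 := hF.comp_le C hC h'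
      have h2 := hT.comp_ae_eq hconn htrans hC h'
      rw [hTh] at h2
      have h3 : G.traceMap z ⟨C ∘ h', (G.energy_comp_le hC _).trans_lt h'.2⟩ = ψ :=
        Lp.ext (h2.trans h.symm)
      have h4 : ψ ∈ G.traceDomain z Q :=
        ⟨⟨C ∘ h', (G.energy_comp_le hC _).trans_lt h'.2⟩, h1.trans_lt hlt, h3⟩
      rw [traceForm_of_mem h4, traceForm_of_mem hφ, ← hh, ← h3]
      exact (extendedForm_harmonicExtension_le
        (f := ⟨C ∘ h', (G.energy_comp_le hC _).trans_lt h'.2⟩) hF hconn htrans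
        (h1.trans_lt hlt)).1.trans h1
    · rw [traceForm_of_notMem hφ]
      exact le_top

end TraceForm

/-! ### Density of the Dirichlet-to-Neumann form -/

/-- The boundary values of bounded functions of finite energy are dense in `L²`. They are uniformly
dense in the continuous functions vanishing at the common zeros of `𝒜`, which form a null set. -/
theorem dense_boundaryLp {μ : Measure G.harmonicBoundary} [IsFiniteMeasure μ] (hμ : μ.Regular)
    (hμ0 : μ G.commonZeros = 0) :
    Dense {φ | ∃ f : G.roydenAlgebra, (f : X → ℝ) ∈ G.finiteEnergy ∧ boundaryLp μ f = φ} := by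
  set S := {φ | ∃ f : G.roydenAlgebra, (f : X → ℝ) ∈ G.finiteEnergy ∧ boundaryLp μ f = φ}
  have hL := (ContinuousMap.toLp (E := ℝ) 2 μ ℝ).continuous
  have hn : Tendsto (fun n : ℕ => (1 : ℝ) / (n + 1)) atTop (𝓝 0) :=
    tendsto_one_div_add_atTop_nhds_zero_nat
  -- continuous functions vanishing at the common zeros of `𝒜`
  have h1 : ∀ φ : C(G.harmonicBoundary, ℝ), (∀ p ∈ G.commonZeros, φ p = 0) →
      ContinuousMap.toLp 2 μ ℝ φ ∈ closure S := fun φ hφ => by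
    choose f hf hnear using fun n : ℕ => exists_preTrace_near φ hφ (Nat.one_div_pos_of_nat (n := n))
    have h2 : Tendsto (fun n => boundaryMap (f n)) atTop (𝓝 φ) := by
      rw [tendsto_iff_dist_tendsto_zero]
      refine squeeze_zero (fun _ => dist_nonneg) (fun n => ?_) hn
      rw [dist_comm, ContinuousMap.dist_le (by positivity)]
      exact fun p => hnear n p
    exact mem_closure_of_tendsto ((hL.tendsto φ).comp h2)
      (Eventually.of_forall fun n => ⟨f n, hf n, rfl⟩)
  -- arbitrary continuous functions, cut off near the common zeros
  have h2 : ∀ φ : C(G.harmonicBoundary, ℝ), ContinuousMap.toLp 2 μ ℝ φ ∈ closure S := fun φ => by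
    have hpos : ∀ n : ℕ, (0 : ℝ≥0∞) < (n : ℝ≥0∞)⁻¹ := fun n => by simp
    choose U hU hUo hUμ using fun n : ℕ => G.commonZeros.exists_isOpen_lt_of_lt (n : ℝ≥0∞)⁻¹
      (hμ0.trans_lt (hpos n))
    choose ψ hψ0 hψ1 hψ using fun n : ℕ => exists_continuous_zero_one_of_isClosed
      (isClosed_commonZeros (G := G)) (hUo n).isClosed_compl
      (Set.disjoint_compl_right_iff_subset.2 (hU n))
    refine isClosed_closure.mem_of_tendsto (f := fun n => ContinuousMap.toLp 2 μ ℝ (φ * ψ n))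
      (b := atTop) ?_ (Eventually.of_forall fun n => h1 _ fun p hp => ?_)
    · rw [← tendsto_sub_nhds_zero_iff]
      refine tendsto_norm_of_tendsto_enorm_sq ?_
      have h3 : Tendsto (fun n : ℕ => ‖φ‖ₑ ^ 2 * (n : ℝ≥0∞)⁻¹) atTop (𝓝 0) := by
        have := ENNReal.Tendsto.const_mul (a := ‖φ‖ₑ ^ 2) ENNReal.tendsto_inv_nat_nhds_zero
          (Or.inr (ENNReal.pow_lt_top enorm_lt_top).ne)
        rwa [mul_zero] at this
      refine tendsto_of_tendsto_of_tendsto_of_le_of_le tendsto_const_nhds h3 (fun _ => zero_le)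
        fun n => ?_
      rw [← map_sub, enorm_sq_eq_lintegral]
      calc _ = ∫⁻ p, ‖φ p * ψ n p - φ p‖ₑ ^ 2 ∂μ := by
            refine lintegral_congr_ae ?_
            filter_upwards [ContinuousMap.coeFn_toLp (p := 2) (𝕜 := ℝ) μ (φ * ψ n - φ)] with p hp
            rw [hp]
            rfl
        _ ≤ ∫⁻ p, (U n).indicator (fun _ => ‖φ‖ₑ ^ 2) p ∂μ := lintegral_mono fun p => by
            by_cases hp : p ∈ U n
            · rw [Set.indicator_of_mem hp]
              refine pow_le_pow_left' ?_ 2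
              rw [← ofReal_norm, ← ofReal_norm]
              refine ENNReal.ofReal_le_ofReal ?_
              rw [← mul_sub_one, norm_mul]
              refine (mul_le_of_le_one_right (norm_nonneg _) ?_).trans (φ.norm_coe_le_norm p)
              rw [Real.norm_eq_abs, abs_le]
              constructor <;> linarith [(hψ n p).1, (hψ n p).2]
            · have h4 : ψ n p = 1 := hψ1 n hp
              simp [h4]
        _ = ‖φ‖ₑ ^ 2 * μ (U n) := lintegral_indicator_const (hUo n).measurableSet _
        _ ≤ _ := mul_le_mul_right (hUμ n).le _
    · rw [ContinuousMap.mul_apply, hψ0 n hp, Pi.zero_apply, mul_zero]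
  have h3 := ContinuousMap.toLp_denseRange (E := ℝ) (μ := μ) (p := 2) ℝ (by norm_num)
  refine dense_iff_closure_eq.2 (Set.eq_univ_of_univ_subset ?_)
  rw [← h3.closure_range]
  exact closure_minimal (Set.range_subset_iff.2 h2) isClosed_closure

section Discrete

variable [Countable X] [MeasurableSpace X] [DiscreteMeasurableSpace X] {m : X → ℝ}

theorem isEnergyExtension_extendedForm {Q : Lp ℝ 2 (vertexMeasure m) → ℝ≥0∞}
    (hm : ∀ x, 0 < m x) (hQ : IsDirichletFormWide Q)
    (h1 : Q ≤ G.dirichletForm m) (h2 : G.neumannForm m ≤ Q) :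
    G.IsEnergyExtension (extendedForm Q) where
  quadratic := hQ.isQuadraticForm_extendedForm hm
  lowerSemicontinuous := hQ.lowerSemicontinuous_extendedForm hm
  comp_le _ hC f := hQ.extendedForm_comp_le hm hC f
  energy_le := energy_le_extendedForm hQ hm h2
  le_energy _ hφ := extendedForm_le_energy_of_finite_support hQ hm h1 hφ

theorem boundaryLp_mem_traceDomain {z : X} [IsFiniteMeasure (G.harmonicMeasure z)] (hm : ∀ x, 0 < m x)
    (hs : Summable m) (hconn : G.Connected) (htrans : G.Transient) {f : G.roydenAlgebra}
    (hf : (f : X → ℝ) ∈ G.finiteEnergy) :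
    boundaryLp (G.harmonicMeasure z) f ∈ G.traceDomain z (G.neumannForm m) := by
  have hT := isTraceMap_traceMap hconn htrans z
  obtain ⟨M, hM⟩ := G.bounded_of_mem_roydenAlgebra f.2
  have h1 : ∑' x, ENNReal.ofReal (m x) * ‖(f : X → ℝ) x‖ₑ ^ 2 < ∞ := by
    refine lt_of_le_of_lt (b := ∑' x, ENNReal.ofReal (m x) * ENNReal.ofReal M ^ 2)
      (ENNReal.tsum_le_tsum fun x => mul_le_mul_right (pow_le_pow_left' ?_ 2) _) ?_
    · rw [← ofReal_norm]
      exact ENNReal.ofReal_le_ofReal (hM x)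
    · rw [ENNReal.tsum_mul_right]
      exact ENNReal.mul_lt_top (lt_top_iff_ne_top.2 hs.tsum_ofReal_ne_top)
        (ENNReal.pow_lt_top ENNReal.ofReal_lt_top)
  obtain ⟨u, hu⟩ := exists_evalLp_eq hm h1
  refine ⟨⟨f, hf⟩, ?_, hT.eq_boundaryLp f hf⟩
  have h2 := (isDirichletFormWide_neumannForm (G := G) hm).extendedForm_evalLp_le hm u
  rw [hu] at h2
  refine h2.trans_lt (show G.energy (evalLp hm u) < ∞ from ?_)
  rw [hu]
  exact hf

end Discrete

end WeightedGraph

theorem theorem3p9 {X : Type*} [Countable X] [Infinite X] [MeasurableSpace X]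
    [DiscreteMeasurableSpace X] (G : WeightedGraph X) (hconn : G.Connected)
    (htrans : G.Transient) (m : X → ℝ) (hm : ∀ x, 0 < m x)
    (hne : G.harmonicBoundary.Nonempty) (z : X) :
    -- the harmonic measures and the trace map are well defined
    (∀ x, G.IsHarmonicMeasureAt x (G.harmonicMeasure x)) ∧
    G.IsTraceMap z (G.traceMap z) ∧
    -- traces of the Dirichlet forms between `Q^(D)` and `Q^(N)`
    (∀ Q : Lp ℝ 2 (vertexMeasure m) → ℝ≥0∞, IsDirichletForm Q →
      Q ≤ G.dirichletForm m → G.neumannForm m ≤ Q →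
      formDomain (G.traceForm z Q) = G.traceDomain z Q ∧
      IsDirichletFormWide (G.traceForm z Q)) ∧
    -- the Dirichlet-to-Neumann form
    IsDirichletFormWide (G.dirichletToNeumannForm m z) ∧
    (Summable m → Dense (formDomain (G.dirichletToNeumannForm m z))) := by
  have hh := fun x => WeightedGraph.isHarmonicMeasureAt_harmonicMeasure hconn htrans x
  have := (hh z).isFiniteMeasure
  have hN := WeightedGraph.isDirichletFormWide_neumannForm (G := G) hm
  have hNF := WeightedGraph.isEnergyExtension_extendedForm hm hN
    WeightedGraph.neumannForm_le_dirichletForm le_rfl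
  refine ⟨hh, WeightedGraph.isTraceMap_traceMap hconn htrans z, fun Q hQ h1 h2 => ?_,
    WeightedGraph.isDirichletFormWide_traceForm hNF hconn htrans, fun hs => ?_⟩
  · have hF := WeightedGraph.isEnergyExtension_extendedForm hm hQ.toIsDirichletFormWide h1 h2
    exact ⟨WeightedGraph.formDomain_traceForm hF hconn htrans,
      WeightedGraph.isDirichletFormWide_traceForm hF hconn htrans⟩
  · rw [WeightedGraph.dirichletToNeumannForm, WeightedGraph.formDomain_traceForm hNF hconn htrans]
    refine (WeightedGraph.dense_boundaryLp (hh z).regular (hh z).measure_commonZeros).mono ?_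
    rintro _ ⟨f, hf, rfl⟩
    exact WeightedGraph.boundaryLp_mem_traceDomain hm hs hconn htrans hf
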